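/- **Setting.** Let $(\mathcal X,\rho_{\mathcal X})$ and $(\mathcal Y,\rho_{\mathcal Y})$ be separable metric spaces with their Borel $\sigma$-algebras, where $\mathcal Y$ has at least two points, and let $\ell=\rho_{\mathcal Y}^{\alpha}$ with $\alpha\ge 1$. *Learning rules.* An online learning rule $f_\cdot$ consists of a measurable space $\mathcal R$, probability distributions $R_t$ on $\mathcal R$ and measurable maps $f_t:\mathcal R\times\mathcal X^{t-1}\times\mathcal Y^{t-1}\times\mathcal X\to\mathcal Y$, $t\ge1$. Its prediction at time $t$ is $f_t(r_t;X_{<t},Y_{<t},X_t)$, where $r_t\sim R_t$. *Adversarial responses.* Let $\mathbb X=(X_t)_{t\ge1}$ be a stochastic process on $\mathcal X$. An adversarial response mechanism on $\mathbb X$ is a stochastic process $(\tilde X_t,\mathbf Y_t)_{t\ge1}$, where $(\tilde X_t)_t$ has the law of $\mathbb X$ and $\mathbf Y_t$ is a (random) Markov kernel from $\mathcal R^{t-1}$ to $\mathcal Y$; the response $Y_t$ is drawn from $\mathbf Y_t(\cdot\mid r_1,\dots,r_{t-1})$, and $r_t$ is independent of the mechanism, of $r_1,\dots,r_{t-1}$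 and of $Y_1,\dots,Y_t$. The process $(Y_t)$ is empirically integrable if there is $y_0\in\mathcal Y$ such that for every $\epsilon>0$, almost surely there is $M\ge0$ with $\limsup_{T}\frac1T\sum_{t=1}^T\ell(y_0,Y_t)\mathbf 1_{\ell(y_0,Y_t)\ge M}\le\epsilon$ (automatic if $\ell$ is bounded). *Consistency.* The rule $f_\cdot$ is consistent under $(\tilde X_t,Y_t)_t$ if for every measurable $g:\mathcal X\to\mathcal Y$, almost surely $$\limsup_{T\to\infty}\frac1T\sum_{t=1}^T\Big(\ell\big(f_t(r_t;\tilde X_{<t},Y_{<t},\tilde X_t),Y_t\big)-\ell\big(g(\tilde X_t),Y_t\big)\Big)\le 0 .$$ It is universally consistent under $\mathbb X$ for adversarial (resp. noiseless) responses if it is consistent for every adversarial response mechanism on $\mathbb X$ with empirically integrable responses (resp. for all responses of the form $Y_t=h(\tilde X_t)$, $h:\mathcal X\to\mathcal Y$ measurable). Let $\mathrm{SOLAR}$ (resp. $\mathrm{SOUL}$) be the set of processes $\mathbb X$ under which some learning rule, possibly depending on $\mathbb X$, is universally consistent for adversarial (resp. noiseless) responses. A rule is optimistically universal for adversarial regression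 if it is universally consistent for adversarial responses under every $\mathbb X\in\mathrm{SOLAR}$. *Condition SMV.* $\mathbb X\in\mathrm{SMV}$ if for every partition $(A_k)_{k\ge1}$ of $\mathcal X$ into measurable sets, almost surely $|\{k\ge 1: A_k\cap\{X_1,\dots,X_T\}\ne\emptyset\}|=o(T)$ as $T\to\infty$. *Property F-TiME.* For every $\eta>0$ there are a horizon $T_\eta\ge1$ and an online learning rule $g_{\le T_\eta}$ without covariates (so $g_t$ maps the private randomness and $y_{<t}$ to $\mathcal Y$) such that for all $y_1,\dots,y_{T_\eta}\in\mathcal Y$ and all $y\in\mathcal Y$, $$\frac1{T_\eta}\,\mathbb E\Big[\sum_{t=1}^{T_\eta}\big(\ell(g_t(y_{<t}),y_t)-\ell(y,y_t)\big)\Big]\le\eta .$$ **Theorem.** Suppose that $\ell$ is bounded and that $(\mathcal Y,\ell)$ satisfies F-TiME. Then $\mathrm{SOLAR}=\mathrm{SMV}=\mathrm{SOUL}$, and there exists an optimistically universal learning rule for adversarial regression, i.e. one single learning rule that is universally consistent for adversarial responses under every process $\mathbb X\in\mathrm{SMV}$. -/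

import Mathlib

open MeasureTheory ProbabilityTheory Filter

universe u v

/-- The loss `ℓ = ρ ^ α`, a power of the metric of the value space. -/
noncomputable def powLoss {𝒴 : Type v} [MetricSpace 𝒴] (α : ℝ) (y y' : 𝒴) : ℝ :=
  dist y y' ^ α

/-- An online learning rule `(f_t, R_t)` from `𝒳` to `𝒴`. Times are indexed from `0`, so that
`Fin t → _` is the history strictly before time `t`. The prediction at time `t` is
`predict t r_t x_{<t} y_{<t} x_t`, where `r_t` has law `law t` on the space `R` of private
randomness. -/
structure OnlineRule (𝒳 𝒴 : Type u) [MeasurableSpace 𝒳] [MeasurableSpace 𝒴] where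
  R : Type
  [mR : MeasurableSpace R]
  law : ℕ → Measure R
  [isProb : ∀ t, IsProbabilityMeasure (law t)]
  predict : (t : ℕ) → R → (Fin t → 𝒳) → (Fin t → 𝒴) → 𝒳 → 𝒴
  measurable_predict : ∀ t, Measurable
    (fun p : R × (Fin t → 𝒳) × (Fin t → 𝒴) × 𝒳 => predict t p.1 p.2.1 p.2.2.1 p.2.2.2)

attribute [instance] OnlineRule.mR OnlineRule.isProb

/-- An adversarial response mechanism `(X̃_t, 𝐘_t)_t`: a stochastic process on a probability space
`(Ω, P)`, where `X̃_t` is an instance and `𝐘_t` is a random Markov kernel from `R^{t}` (the private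
randomness used by the learner strictly before time `t`) to the value space, i.e. a Markov kernel
that also depends measurably on the outcome in `Ω`. -/
structure AdversarialMechanism (𝒳 𝒴 : Type u) (R : Type) [MeasurableSpace 𝒳] [MeasurableSpace 𝒴]
    [MeasurableSpace R] where
  Ω : Type u
  [mΩ : MeasurableSpace Ω]
  P : Measure Ω
  [isProb : IsProbabilityMeasure P]
  X : ℕ → Ω → 𝒳
  measurable_X : ∀ t, Measurable (X t)
  Y : (t : ℕ) → Kernel (Ω × (Fin t → R)) 𝒴
  [markov : ∀ t, IsMarkovKernel (Y t)]

attribute [instance] AdversarialMechanism.mΩ AdversarialMechanism.isProb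
  AdversarialMechanism.markov

/-- The law of the instance process of the mechanism. -/
noncomputable def AdversarialMechanism.instanceLaw {𝒳 𝒴 : Type u} {R : Type} [MeasurableSpace 𝒳]
    [MeasurableSpace 𝒴] [MeasurableSpace R] (M : AdversarialMechanism 𝒳 𝒴 R) :
    Measure (ℕ → 𝒳) :=
  M.P.map (fun ω t => M.X t ω)

/-- A run of the learning rule `f` against the mechanism `M`, on a probability space `(Ω', Q)`:
* `ω` is the outcome of the mechanism, of law `M.P`;
* `r t` is the private randomness of the learner at time `t`; it has law `f.law t` and is
  independent of the outcome of the mechanism, of the past private randomness and of the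
  responses up to and including time `t`;
* `Y t` is the response at time `t`, drawn from the kernel `M.Y t` given the outcome of the
  mechanism and the past private randomness. -/
structure IsRun {𝒳 𝒴 : Type u} [MeasurableSpace 𝒳] [MeasurableSpace 𝒴] (f : OnlineRule 𝒳 𝒴)
    (M : AdversarialMechanism 𝒳 𝒴 f.R) {Ω' : Type u} [MeasurableSpace Ω'] (Q : Measure Ω')
    (ω : Ω' → M.Ω) (r : ℕ → Ω' → f.R) (Y : ℕ → Ω' → 𝒴) : Prop where
  measurable_outcome : Measurable ω
  measurable_rand : ∀ t, Measurable (r t)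
  measurable_resp : ∀ t, Measurable (Y t)
  law_outcome : Q.map ω = M.P
  law_rand : ∀ t, Q.map (r t) = f.law t
  indep_rand : ∀ t, IndepFun (r t)
    (fun w => (ω w, (fun i : Fin t => r i w), (fun i : Fin (t + 1) => Y i w))) Q
  law_resp : ∀ t, Q.map (fun w => ((ω w, (fun i : Fin t => r i w)), Y t w)) =
    (Q.map (fun w => (ω w, (fun i : Fin t => r i w)))) ⊗ₘ (M.Y t)

/-- The long-run average excess loss of the rule `f` over the predictor `g`, along the sequences of
private randomness `r`, instances `x` and values `y`. -/
noncomputable def excessLoss {𝒳 𝒴 : Type u} [MeasurableSpace 𝒳] [MeasurableSpace 𝒴]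
    (ℓ : 𝒴 → 𝒴 → ℝ) (f : OnlineRule 𝒳 𝒴) (g : 𝒳 → 𝒴) (r : ℕ → f.R) (x : ℕ → 𝒳) (y : ℕ → 𝒴) :
    EReal :=
  limsup (fun T : ℕ => (((1 / (T : ℝ)) * ∑ t ∈ Finset.range T,
    (ℓ (f.predict t (r t) (fun i : Fin t => x i) (fun i : Fin t => y i) (x t)) (y t)
      - ℓ (g (x t)) (y t)) : ℝ) : EReal)) atTop

open Classical in
/-- Empirical integrability of a process of values. -/
def EmpiricallyIntegrable {𝒴 : Type u} (ℓ : 𝒴 → 𝒴 → ℝ) {Ω' : Type u} [MeasurableSpace Ω']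
    (Q : Measure Ω') (Y : ℕ → Ω' → 𝒴) : Prop :=
  ∃ y₀ : 𝒴, ∀ ε : ℝ, 0 < ε → ∀ᵐ w ∂Q, ∃ M : ℝ, 0 ≤ M ∧
    limsup (fun T : ℕ => (((1 / (T : ℝ)) * ∑ t ∈ Finset.range T,
      (if M ≤ ℓ y₀ (Y t w) then ℓ y₀ (Y t w) else 0) : ℝ) : EReal)) atTop ≤ (ε : EReal)

/-- `f` is consistent under the process with private randomness `r`, instances `X`, values `Y`:
against every measurable predictor the long-run average excess loss is almost surely `≤ 0`. -/
def Consistent {𝒳 𝒴 : Type u} [MeasurableSpace 𝒳] [MeasurableSpace 𝒴]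
    (ℓ : 𝒴 → 𝒴 → ℝ) (f : OnlineRule 𝒳 𝒴) {Ω' : Type u} [MeasurableSpace Ω'] (Q : Measure Ω')
    (r : ℕ → Ω' → f.R) (X : ℕ → Ω' → 𝒳) (Y : ℕ → Ω' → 𝒴) : Prop :=
  ∀ g : 𝒳 → 𝒴, Measurable g →
    ∀ᵐ w ∂Q, excessLoss ℓ f g (fun t => r t w) (fun t => X t w) (fun t => Y t w) ≤ 0

/-- `f` is universally consistent under the instance process of law `μ`, for empirically integrable
adversarial responses. -/
def UniversallyConsistent {𝒳 𝒴 : Type u} [MeasurableSpace 𝒳] [MeasurableSpace 𝒴]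
    (ℓ : 𝒴 → 𝒴 → ℝ) (f : OnlineRule 𝒳 𝒴) (μ : ProbabilityMeasure (ℕ → 𝒳)) : Prop :=
  ∀ M : AdversarialMechanism 𝒳 𝒴 f.R, M.instanceLaw = (μ : Measure (ℕ → 𝒳)) →
    ∀ (Ω' : Type u) [MeasurableSpace Ω'] (Q : Measure Ω') (ω : Ω' → M.Ω) (r : ℕ → Ω' → f.R)
      (Y : ℕ → Ω' → 𝒴), IsRun f M Q ω r Y → EmpiricallyIntegrable ℓ Q Y →
        Consistent ℓ f Q r (fun t w => M.X t (ω w)) Y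

/-- The noiseless mechanism: the instances have law `μ` and the response is `h (X_t)`. -/
noncomputable def noiselessMechanism {𝒳 𝒴 : Type u} {R : Type} [MeasurableSpace 𝒳]
    [MeasurableSpace 𝒴] [MeasurableSpace R] (μ : ProbabilityMeasure (ℕ → 𝒳)) (h : 𝒳 → 𝒴)
    (hh : Measurable h) : AdversarialMechanism 𝒳 𝒴 R where
  Ω := ℕ → 𝒳
  P := (μ : Measure (ℕ → 𝒳))
  X := fun t x => x t
  measurable_X := fun t => measurable_pi_apply t
  Y := fun t => Kernel.deterministic (fun p => h (p.1 t))
    (hh.comp ((measurable_pi_apply t).comp measurable_fst))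

/-- `f` is universally consistent under the instance process of law `μ` for noiseless (realizable)
responses. -/
def NoiselessUniversallyConsistent {𝒳 𝒴 : Type u} [MeasurableSpace 𝒳] [MeasurableSpace 𝒴]
    (ℓ : 𝒴 → 𝒴 → ℝ) (f : OnlineRule 𝒳 𝒴) (μ : ProbabilityMeasure (ℕ → 𝒳)) : Prop :=
  ∀ (h : 𝒳 → 𝒴) (hh : Measurable h) (Ω' : Type u) [MeasurableSpace Ω'] (Q : Measure Ω')
    (x : Ω' → ℕ → 𝒳) (r : ℕ → Ω' → f.R) (Y : ℕ → Ω' → 𝒴),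
    IsRun f (noiselessMechanism μ h hh) Q x r Y → Consistent ℓ f Q r (fun t w => x w t) Y

/-- The (laws of) instance processes that admit a universally consistent learning rule for
empirically integrable adversarial responses. -/
def SOLAR {𝒳 𝒴 : Type u} [MeasurableSpace 𝒳] [MeasurableSpace 𝒴] (ℓ : 𝒴 → 𝒴 → ℝ) :
    Set (ProbabilityMeasure (ℕ → 𝒳)) :=
  {μ | ∃ f : OnlineRule 𝒳 𝒴, UniversallyConsistent ℓ f μ}

/-- The (laws of) instance processes that admit a universally consistent learning rule for noiseless
responses. -/
def SOUL {𝒳 𝒴 : Type u} [MeasurableSpace 𝒳] [MeasurableSpace 𝒴] (ℓ : 𝒴 → 𝒴 → ℝ) :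
    Set (ProbabilityMeasure (ℕ → 𝒳)) :=
  {μ | ∃ f : OnlineRule 𝒳 𝒴, NoiselessUniversallyConsistent ℓ f μ}

/-- The (laws of) processes with sublinear measurable visits: for every countable measurable
partition, the number of cells visited before time `T` is almost surely `o(T)`. -/
def SMV (𝒳 : Type u) [MeasurableSpace 𝒳] : Set (ProbabilityMeasure (ℕ → 𝒳)) :=
  {μ | ∀ A : ℕ → Set 𝒳, (∀ k, MeasurableSet (A k)) → Pairwise (fun i j => Disjoint (A i) (A j)) →
    (⋃ k, A k) = Set.univ → ∀ᵐ x ∂(μ : Measure (ℕ → 𝒳)),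
      (fun T : ℕ => (({k : ℕ | ∃ t < T, x t ∈ A k}.ncard : ℕ) : ℝ))
        =o[atTop] (fun T : ℕ => (T : ℝ))}

/-- A learning rule that is universally consistent for empirically integrable adversarial responses
under every process for which some learning rule is. -/
def OptimisticallyUniversal {𝒳 𝒴 : Type u} [MeasurableSpace 𝒳] [MeasurableSpace 𝒴]
    (ℓ : 𝒴 → 𝒴 → ℝ) (f : OnlineRule 𝒳 𝒴) : Prop :=
  ∀ μ ∈ SOLAR (𝒳 := 𝒳) ℓ, UniversallyConsistent ℓ f μ

/-- Finite-time mean estimation: for every `η > 0` there are a horizon `T ≥ 1` and an online learning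
rule `g` without covariates (the instance space is a point; only the predictions at times `< T`
matter) whose expected average excess loss over the horizon is at most `η`, on every sequence of
values and against every fixed value. -/
def FTiME {𝒴 : Type u} [MeasurableSpace 𝒴] (ℓ : 𝒴 → 𝒴 → ℝ) : Prop :=
  ∀ η : ℝ, 0 < η → ∃ T : ℕ, 1 ≤ T ∧ ∃ g : OnlineRule PUnit.{u + 1} 𝒴,
    ∀ (z : ℕ → 𝒴) (y : 𝒴),
      (1 / (T : ℝ)) * ∫ r, ∑ t ∈ Finset.range T,
        (ℓ (g.predict t (r t) (fun _ => PUnit.unit) (fun i : Fin t => z i) PUnit.unit) (z t)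
          - ℓ y (z t)) ∂(Measure.infinitePi g.law) ≤ η

/-! ### Ranks of repeated keys, and blocks of `L` occurrences of a key -/

section KeyRank

variable {K : Type*}

/-! Sufficiency of SMV. Let `g` be a rule without covariates with horizon `L` and error `η`, as
F-TiME provides. If the times are sorted online into groups of `L` times on which the comparator is
constant, a fresh copy of `g` in each group has average regret at most `η`. One sorting works, up to
small errors, for all comparators at once: `groupKey` sorts the first `N` occurrences of a point by
its cell in a finite partition refined slowly with time, later occurrences by the point itself, and
the occurrences of each key are cut into blocks of `L`.

By `sum_le_of_groups` two kinds of groups cost extra. Unfinished blocks: at most one per key, and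
there are at most `o(T) + T / N` keys (`card_image_groupKey_le`). Groups on which the comparator
varies: point keys give none. For cell keys, consider the measurable sets that the groups cut only
`o(T)` times. They include the sets of finite depth and are closed under complements; under SMV they
are closed under countable disjoint unions, so all measurable sets qualify, and then all countable
partitions (`ae_sublinear_mixedTimes`). For the union step, a piece whose own bound is not yet
effective at time `T` is handled by counting distinct points: some fixed countable partition
separates the relevant ones, so SMV makes them `o(T)`, and each point is sorted by cell only `N`
times.

Letting `η → 0` and `N / L → ∞` gives countably many experts, none depending on the process.
Multiplicative weights with one rate per expert (`exists_aggregate_regret`) make the aggregate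
compete with each expert up to a slope tending to `0`. Losses are replaced by their means over the
fresh randomness through a law of large numbers for orthogonal differences
(`ae_tendsto_average_of_orthogonal`). Adaptive responses do no harm, because the expert regret holds
for every response sequence off a null set of instance sequences.

Necessity of SMV. Put a fair coin on each cell of a partition and let it choose between two values.
At the first visit to a cell its coin is independent of the past responses, so the mean loss is
bounded below, and a consistent rule forces first visits to be `o(T)`
(`mem_SMV_of_noiselessUniversallyConsistent`). -/

open Classical in
/-- The number of times before `t` that carry the same key as `t`. -/
noncomputable def keyRank (κ : ℕ → K) (t : ℕ) : ℕ :=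
  ((Finset.range t).filter (fun s => κ s = κ t)).card

theorem keyRank_lt_keyRank {κ : ℕ → K} {s t : ℕ} (h : s < t) (hk : κ s = κ t) :
    keyRank κ s < keyRank κ t := by
  classical
  unfold keyRank
  apply Finset.card_lt_card
  rw [Finset.ssubset_iff_of_subset]
  · exact ⟨s, by simp [h, hk], by simp⟩
  · intro r hr
    simp only [Finset.mem_filter, Finset.mem_range] at hr ⊢
    exact ⟨hr.1.trans h, hr.2.trans hk⟩

theorem eq_of_keyRank_eq {κ : ℕ → K} {s t : ℕ} (hk : κ s = κ t)
    (h : keyRank κ s = keyRank κ t) : s = t := by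
  rcases lt_trichotomy s t with hlt | heq | hgt
  · exact absurd h (keyRank_lt_keyRank hlt hk).ne
  · exact heq
  · exact absurd h.symm (keyRank_lt_keyRank hgt hk.symm).ne

/-- The rank is injective on the earlier times with the key of `t` and takes values below `keyRank κ
t`, which is exactly their number; hence it is onto. -/
theorem exists_keyRank_eq {κ : ℕ → K} {t m : ℕ} (hm : m < keyRank κ t) :
    ∃ s < t, κ s = κ t ∧ keyRank κ s = m := by
  classical
  have hmaps : ∀ s ∈ (Finset.range t).filter (fun s => κ s = κ t),
      keyRank κ s ∈ Finset.range (keyRank κ t) := by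
    intro s hs
    simp only [Finset.mem_filter, Finset.mem_range] at hs ⊢
    exact keyRank_lt_keyRank hs.1 hs.2
  have hinj : Set.InjOn (keyRank κ) ((Finset.range t).filter (fun s => κ s = κ t) : Set ℕ) := by
    intro a ha b hb hab
    simp only [Finset.coe_filter, Finset.mem_range, Set.mem_ofPred_eq] at ha hb
    exact eq_of_keyRank_eq (ha.2.trans hb.2.symm) hab
  have hsurj := Finset.surjOn_of_injOn_of_card_le (keyRank κ) hmaps hinj
    (by rw [Finset.card_range]; rfl)
  obtain ⟨s, hs, rfl⟩ := hsurj (show m ∈ (Finset.range (keyRank κ t) : Set ℕ) by simpa using hm)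
  simp only [Finset.coe_filter, Finset.mem_range, Set.mem_ofPred_eq] at hs
  exact ⟨s, hs.1, hs.2, rfl⟩

/-- Ranks see only coincidences of keys up to time `t`. This is the source of the adaptedness of
everything built from them. -/
theorem keyRank_congr {κ κ' : ℕ → K} {t : ℕ} (h : ∀ s ≤ t, (κ s = κ t ↔ κ' s = κ' t)) :
    keyRank κ t = keyRank κ' t := by
  classical
  unfold keyRank
  congr 1
  apply Finset.filter_congr
  intro s hs
  exact h s (Finset.mem_range.1 hs).le

/-- The group of a time: its key, and the index of its block of `L` successive occurrences of that
key. -/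
noncomputable def groupId (κ : ℕ → K) (L t : ℕ) : K × ℕ := (κ t, keyRank κ t / L)

open Classical in
/-- The times before `T` that belong to the group `γ`. -/
noncomputable def groupTimes (κ : ℕ → K) (L T : ℕ) (γ : K × ℕ) : Finset ℕ :=
  (Finset.range T).filter (fun t => groupId κ L t = γ)

theorem mem_groupTimes {κ : ℕ → K} {L T t : ℕ} {γ : K × ℕ} :
    t ∈ groupTimes κ L T γ ↔ t < T ∧ groupId κ L t = γ := by
  simp [groupTimes]

theorem keyRank_of_mem_groupTimes {κ : ℕ → K} {L T t : ℕ} {γ : K × ℕ} (hL : 0 < L)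
    (ht : t ∈ groupTimes κ L T γ) :
    κ t = γ.1 ∧ L * γ.2 ≤ keyRank κ t ∧ keyRank κ t < L * γ.2 + L := by
  obtain ⟨-, rfl⟩ := mem_groupTimes.1 ht
  refine ⟨rfl, Nat.mul_div_le _ _, ?_⟩
  have := Nat.lt_mul_div_succ (keyRank κ t) hL
  simpa [groupId, mul_add] using this

theorem injOn_keyRank_groupTimes (κ : ℕ → K) (L T : ℕ) (γ : K × ℕ) :
    Set.InjOn (keyRank κ) (groupTimes κ L T γ : Set ℕ) := by
  intro a ha b hb hab
  obtain ⟨-, ha⟩ := mem_groupTimes.1 (Finset.mem_coe.1 ha)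
  obtain ⟨-, hb⟩ := mem_groupTimes.1 (Finset.mem_coe.1 hb)
  exact eq_of_keyRank_eq (congrArg Prod.fst (ha.trans hb.symm)) hab

theorem mapsTo_keyRank_groupTimes (κ : ℕ → K) {L : ℕ} (hL : 0 < L) (T : ℕ) (γ : K × ℕ) :
    ∀ t ∈ groupTimes κ L T γ, keyRank κ t ∈ Finset.Ico (L * γ.2) (L * γ.2 + L) := by
  intro t ht
  have := keyRank_of_mem_groupTimes hL ht
  simp [this.2.1, this.2.2]

theorem card_groupTimes_le (κ : ℕ → K) {L : ℕ} (hL : 0 < L) (T : ℕ) (γ : K × ℕ) :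
    (groupTimes κ L T γ).card ≤ L := by
  have := Finset.card_le_card_of_injOn (keyRank κ) (mapsTo_keyRank_groupTimes κ hL T γ)
    (injOn_keyRank_groupTimes κ L T γ)
  simpa using this

/-- A complete group is enumerated in increasing order of rank. -/
theorem exists_enum_groupTimes (κ : ℕ → K) {L : ℕ} (hL : 0 < L) (T : ℕ) (γ : K × ℕ)
    (hcard : (groupTimes κ L T γ).card = L) :
    ∃ τ : ℕ → ℕ, (∀ j < L, τ j ∈ groupTimes κ L T γ ∧ keyRank κ (τ j) = L * γ.2 + j) ∧
      ∀ φ : ℕ → ℝ, ∑ t ∈ groupTimes κ L T γ, φ t = ∑ j ∈ Finset.range L, φ (τ j) := by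
  have hsurj := Finset.surjOn_of_injOn_of_card_le (keyRank κ) (mapsTo_keyRank_groupTimes κ hL T γ)
    (injOn_keyRank_groupTimes κ L T γ) (by simp [hcard])
  have hex : ∀ j, ∃ s, j < L → s ∈ groupTimes κ L T γ ∧ keyRank κ s = L * γ.2 + j := by
    intro j
    by_cases hj : j < L
    · obtain ⟨s, hs, hsj⟩ := hsurj
        (show L * γ.2 + j ∈ (Finset.Ico (L * γ.2) (L * γ.2 + L) : Set ℕ) by simp [hj])
      exact ⟨s, fun _ => ⟨Finset.mem_coe.1 hs, hsj⟩⟩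
    · exact ⟨0, fun h => absurd h hj⟩
  choose τ hτ using hex
  refine ⟨τ, hτ, fun φ => ?_⟩
  symm
  apply Finset.sum_bij (fun j _ => τ j)
  · intro j hj
    exact (hτ j (Finset.mem_range.1 hj)).1
  · intro a ha b hb hab
    have h1 := (hτ a (Finset.mem_range.1 ha)).2
    have h2 := (hτ b (Finset.mem_range.1 hb)).2
    rw [hab] at h1
    omega
  · intro t ht
    have h := keyRank_of_mem_groupTimes hL ht
    have hj : keyRank κ t - L * γ.2 < L := by omega
    refine ⟨keyRank κ t - L * γ.2, Finset.mem_range.2 hj, ?_⟩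
    obtain ⟨h1, h2⟩ := hτ _ hj
    apply injOn_keyRank_groupTimes κ L T γ (Finset.mem_coe.2 h1) (Finset.mem_coe.2 ht)
    omega
  · intros; rfl

/-- Of the groups with a given key, only the last one can be incomplete. -/
theorem groupTimes_complete_of_lt (κ : ℕ → K) {L : ℕ} (hL : 0 < L) {T t b : ℕ} (ht : t < T)
    (hb : b < keyRank κ t / L) : (groupTimes κ L T (κ t, b)).card = L := by
  apply le_antisymm (card_groupTimes_le κ hL T _)
  have hle : L * (b + 1) ≤ keyRank κ t :=
    (Nat.mul_le_mul_left L hb).trans (Nat.mul_div_le _ _)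
  have hex : ∀ j < L, ∃ s < t, κ s = κ t ∧ keyRank κ s = L * b + j := by
    intro j hj
    exact exists_keyRank_eq (by rw [mul_add] at hle; omega)
  have hsurj : Set.SurjOn (keyRank κ) (groupTimes κ L T (κ t, b) : Set ℕ)
      (Finset.Ico (L * b) (L * b + L) : Set ℕ) := by
    intro m hm
    simp only [Finset.coe_Ico, Set.mem_Ico] at hm
    obtain ⟨s, hs, hk, hr⟩ := hex (m - L * b) (by omega)
    refine ⟨s, Finset.mem_coe.2 (mem_groupTimes.2 ⟨hs.trans ht, ?_⟩), by omega⟩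
    rw [groupId, hk, hr, Nat.mul_add_div hL, Nat.div_eq_of_lt (by omega), add_zero]
  have := Finset.card_le_card_of_surjOn _ hsurj
  simpa using this

open Classical in
/-- The time before `t` that carries the key of `t` and has rank `m` (and `0` if there is none). -/
noncomputable def memberTime (κ : ℕ → K) (t m : ℕ) : ℕ :=
  ∑ s ∈ Finset.range t, if κ s = κ t ∧ keyRank κ s = m then s else 0

theorem memberTime_eq {κ : ℕ → K} {s t : ℕ} (hst : s < t) (hk : κ s = κ t) :
    memberTime κ t (keyRank κ s) = s := by
  classical
  unfold memberTime
  rw [Finset.sum_eq_single s]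
  · simp [hk]
  · intro r hr hrs
    rw [if_neg]
    rintro ⟨h1, h2⟩
    exact hrs (eq_of_keyRank_eq (h1.trans hk.symm) h2)
  · intro h
    exact absurd (Finset.mem_range.2 hst) h

theorem memberTime_congr {κ κ' : ℕ → K} {t : ℕ} (h : ∀ s ≤ t, ∀ r ≤ t, (κ s = κ r ↔ κ' s = κ' r))
    (m : ℕ) : memberTime κ t m = memberTime κ' t m := by
  classical
  unfold memberTime
  apply Finset.sum_congr rfl
  intro s hs
  have hs' := (Finset.mem_range.1 hs).le
  rw [keyRank_congr (κ := κ) (κ' := κ') (fun r hr => h r (hr.trans hs') s hs')]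
  simp only [h s hs' t le_rfl]

theorem memberTime_lt {κ : ℕ → K} {t m : ℕ} (hm : m < keyRank κ t) : memberTime κ t m < t := by
  obtain ⟨s, hs, hk, rfl⟩ := exists_keyRank_eq hm
  rwa [memberTime_eq hs hk]

open Classical in
/-- If the deviations are bounded by `C` and sum to at most `η * L` over each complete group with
constant label, then only incomplete groups and groups with varying label contribute more. -/
theorem sum_le_of_groups (κ : ℕ → K) {L : ℕ} (hL : 0 < L) (T : ℕ) {ι : Type*} (lab : ℕ → ι)
    (dev : ℕ → ℝ) {C η : ℝ} (hη : 0 ≤ η) (hC : 0 ≤ C) (hdev : ∀ t, dev t ≤ C)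
    (hgood : ∀ γ, (groupTimes κ L T γ).card = L →
      (∀ s ∈ groupTimes κ L T γ, ∀ t ∈ groupTimes κ L T γ, lab s = lab t) →
      ∑ t ∈ groupTimes κ L T γ, dev t ≤ η * L) :
    ∑ t ∈ Finset.range T, dev t ≤ η * T + C * L * (((Finset.range T).image κ).card +
      ((Finset.range T).filter
        (fun t => ∃ s ≤ t, groupId κ L s = groupId κ L t ∧ lab s ≠ lab t)).card) := by
  set Γ := (Finset.range T).image (groupId κ L) with hΓ
  set Bad := (Finset.range T).filter
        (fun t => ∃ s ≤ t, groupId κ L s = groupId κ L t ∧ lab s ≠ lab t) with hBad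
  set Inc := Γ.filter (fun γ => (groupTimes κ L T γ).card ≠ L) with hInc
  set Imp := Bad.image (groupId κ L) with hImp
  have hsum : ∑ t ∈ Finset.range T, dev t = ∑ γ ∈ Γ, ∑ t ∈ groupTimes κ L T γ, dev t := by
    rw [← Finset.sum_fiberwise_of_maps_to (t := Γ) (g := groupId κ L)
      (fun t ht => Finset.mem_image_of_mem _ ht)]
    rfl
  have hcardsum : (T : ℝ) = ∑ γ ∈ Γ, ((groupTimes κ L T γ).card : ℝ) := by
    have := Finset.card_eq_sum_card_fiberwise (s := Finset.range T) (t := Γ) (f := groupId κ L)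
      (fun t ht => Finset.mem_coe.2 (Finset.mem_image_of_mem _ (Finset.mem_coe.1 ht)))
    rw [Finset.card_range] at this
    exact_mod_cast this
  -- Two incomplete groups with the same key coincide, since a smaller block index would mean a
  -- complete group; so the key is injective on `Inc`.
  have hIncCard : Inc.card ≤ ((Finset.range T).image κ).card := by
    apply Finset.card_le_card_of_injOn Prod.fst
    · intro γ hγ
      obtain ⟨hγ, -⟩ := Finset.mem_filter.1 hγ
      obtain ⟨t, ht, rfl⟩ := Finset.mem_image.1 hγ
      exact Finset.mem_coe.2 (Finset.mem_image_of_mem _ ht)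
    · rintro γ hγ γ' hγ' hfst
      obtain ⟨hγ, h1⟩ := Finset.mem_filter.1 (Finset.mem_coe.1 hγ)
      obtain ⟨hγ', h1'⟩ := Finset.mem_filter.1 (Finset.mem_coe.1 hγ')
      obtain ⟨t, ht, rfl⟩ := Finset.mem_image.1 hγ
      obtain ⟨t', ht', rfl⟩ := Finset.mem_image.1 hγ'
      have hk : κ t = κ t' := hfst
      rcases lt_trichotomy (keyRank κ t / L) (keyRank κ t' / L) with h | h | h
      · refine absurd ?_ h1
        have := groupTimes_complete_of_lt κ hL (Finset.mem_range.1 ht') h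
        rwa [← hk] at this
      · exact Prod.ext hk h
      · refine absurd ?_ h1'
        have := groupTimes_complete_of_lt κ hL (Finset.mem_range.1 ht) h
        rwa [hk] at this
  -- A group with varying label contains at least one bad time, and a group costs at most `C * L`
  -- whatever happens in it.
  have hImpCard : Imp.card ≤ Bad.card := Finset.card_image_le
  have hterm : ∀ γ ∈ Γ, ∑ t ∈ groupTimes κ L T γ, dev t ≤
      η * (groupTimes κ L T γ).card + C * L * ((if γ ∈ Inc then 1 else 0) +
        (if γ ∈ Imp then 1 else 0)) := by
    intro γ hγ
    have hCL : 0 ≤ C * L := by positivity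
    have htriv : ∑ t ∈ groupTimes κ L T γ, dev t ≤ C * L := by
      calc ∑ t ∈ groupTimes κ L T γ, dev t ≤ ∑ t ∈ groupTimes κ L T γ, C :=
            Finset.sum_le_sum (fun t _ => hdev t)
        _ = (groupTimes κ L T γ).card * C := by simp
        _ ≤ L * C := by
            apply mul_le_mul_of_nonneg_right _ hC
            exact_mod_cast card_groupTimes_le κ hL T γ
        _ = C * L := mul_comm _ _
    have hηc : 0 ≤ η * (groupTimes κ L T γ).card := by positivity
    by_cases hi : γ ∈ Inc
    · rw [if_pos hi]
      split_ifs <;> nlinarith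
    by_cases hp : γ ∈ Imp
    · rw [if_pos hp, if_neg hi]
      nlinarith
    rw [if_neg hi, if_neg hp]
    have hfull : (groupTimes κ L T γ).card = L := by
      by_contra h
      exact hi (Finset.mem_filter.2 ⟨hγ, h⟩)
    have hpure : ∀ s ∈ groupTimes κ L T γ, ∀ t ∈ groupTimes κ L T γ, s ≤ t → lab s = lab t := by
      intro s hs t ht hst
      by_contra hne
      obtain ⟨hsT, hs⟩ := mem_groupTimes.1 hs
      obtain ⟨htT, ht⟩ := mem_groupTimes.1 ht
      refine hp (Finset.mem_image.2 ⟨t, Finset.mem_filter.2 ⟨Finset.mem_range.2 htT, ?_⟩, ht⟩)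
      exact ⟨s, hst, hs.trans ht.symm, hne⟩
    have := hgood γ hfull (fun s hs t ht => by
      rcases le_total s t with h | h
      · exact hpure s hs t ht h
      · exact (hpure t ht s hs h).symm)
    rw [hfull]
    linarith
  calc ∑ t ∈ Finset.range T, dev t = ∑ γ ∈ Γ, ∑ t ∈ groupTimes κ L T γ, dev t := hsum
    _ ≤ ∑ γ ∈ Γ, (η * (groupTimes κ L T γ).card + C * L * ((if γ ∈ Inc then 1 else 0) +
        (if γ ∈ Imp then 1 else 0))) := Finset.sum_le_sum hterm
    _ = η * T + C * L * (((Γ.filter (· ∈ Inc)).card : ℝ) + ((Γ.filter (· ∈ Imp)).card : ℝ)) := by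
        rw [Finset.sum_add_distrib, ← Finset.mul_sum, ← Finset.mul_sum, ← hcardsum,
          Finset.sum_add_distrib, Finset.sum_boole, Finset.sum_boole]
    _ ≤ _ := by
        gcongr
        · exact (Finset.card_le_card (fun γ hγ => (Finset.mem_filter.1 hγ).2)).trans hIncCard
        · exact (Finset.card_le_card (fun γ hγ => (Finset.mem_filter.1 hγ).2)).trans hImpCard

end KeyRank

/-! ### Sublinear counts and diagonal thresholds -/

/-- A sequence of natural numbers that is `o(T)`. -/
def Sublinear (a : ℕ → ℕ) : Prop :=
  ∀ ε : ℝ, 0 < ε → ∀ᶠ T : ℕ in atTop, (a T : ℝ) ≤ ε * T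

theorem Sublinear.of_le {a b : ℕ → ℕ} (hb : Sublinear b) (h : ∀ T, a T ≤ b T) : Sublinear a := by
  intro ε hε
  filter_upwards [hb ε hε] with T hT
  exact (Nat.cast_le.2 (h T)).trans hT

theorem sublinear_of_bounded {a : ℕ → ℕ} {c : ℕ} (h : ∀ T, a T ≤ c) : Sublinear a := by
  intro ε hε
  filter_upwards [eventually_ge_atTop ⌈c / ε⌉₊] with T hT
  have h1 : (c : ℝ) / ε ≤ T := Nat.ceil_le.1 hT
  rw [div_le_iff₀ hε] at h1
  have h2 : (a T : ℝ) ≤ c := Nat.cast_le.2 (h T)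
  linarith

theorem sublinear_iff_isLittleO {a : ℕ → ℕ} :
    Sublinear a ↔ (fun T : ℕ => (a T : ℝ)) =o[atTop] (fun T : ℕ => (T : ℝ)) := by
  rw [Asymptotics.isLittleO_iff]
  constructor
  · intro h c hc
    filter_upwards [h c hc] with T hT
    simpa using hT
  · intro h c hc
    filter_upwards [h hc] with T hT
    simpa using hT

/-- Countably many almost sure eventual properties hold simultaneously, each from a deterministic
threshold on. -/
theorem exists_diagonal_threshold {Ω : Type*} [MeasurableSpace Ω] (μ : Measure Ω)
    [IsFiniteMeasure μ] {p : ℕ → ℕ → Ω → Prop} (hm : ∀ k T, MeasurableSet {x | p k T x})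
    (h : ∀ k, ∀ᵐ x ∂μ, ∀ᶠ T in atTop, p k T x) :
    ∃ τ : ℕ → ℕ, (∀ k, k ≤ τ k) ∧ ∀ᵐ x ∂μ, ∃ T₀, ∀ T ≥ T₀, ∀ k, τ k ≤ T → p k T x := by
  set E : ℕ → ℕ → Set Ω := fun k n => ⋃ T, ⋃ (_ : n ≤ T), {x | p k T x}ᶜ with hE
  have hEm : ∀ k n, MeasurableSet (E k n) := fun k n =>
    MeasurableSet.iUnion fun T => MeasurableSet.iUnion fun _ => (hm k T).compl
  have hanti : ∀ k, Antitone (E k) := by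
    intro k m n hmn
    exact Set.iUnion_mono fun T => Set.iUnion_subset fun hT =>
      Set.subset_iUnion_of_subset (hmn.trans hT) subset_rfl
  have hnull : ∀ k, μ (⋂ n, E k n) = 0 := by
    intro k
    refine measure_mono_null ?_ (ae_iff.1 (h k))
    intro x hx
    simp only [hE, Set.mem_iInter, Set.mem_iUnion] at hx
    intro hev
    obtain ⟨n, hn⟩ := eventually_atTop.1 hev
    obtain ⟨T, hT, hxT⟩ := hx n
    exact hxT (hn T hT)
  -- Choose `τ k` so that failure of property `k` after `τ k` has measure at most `ε k`. By
  -- Borel–Cantelli only finitely many `k` fail, and those have a common, outcome-dependent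
  -- threshold.
  obtain ⟨ε, hε, hεsum⟩ := ENNReal.exists_pos_sum_of_countable' (ε := 1) one_ne_zero ℕ
  have hex : ∀ k, ∃ n, k ≤ n ∧ μ (E k n) ≤ ε k := by
    intro k
    have ht := tendsto_measure_iInter_atTop (fun n => (hEm k n).nullMeasurableSet (μ := μ))
      (hanti k) ⟨0, measure_ne_top μ _⟩
    rw [hnull k] at ht
    have h1 := (ht.eventually (ge_mem_nhds (hε k))).and (eventually_ge_atTop k)
    obtain ⟨n, hn⟩ := h1.exists
    exact ⟨n, hn.2, hn.1⟩
  choose τ hτ hτμ using hex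
  refine ⟨τ, hτ, ?_⟩
  have hsum : ∑' k, μ (E k (τ k)) ≠ ⊤ :=
    ((ENNReal.tsum_le_tsum hτμ).trans hεsum.le).trans_lt ENNReal.one_lt_top |>.ne
  filter_upwards [ae_eventually_notMem hsum, ae_all_iff.2 h] with x hx hall
  obtain ⟨k₀, hk₀⟩ := eventually_atTop.1 hx
  have hfin : ∀ᶠ T in atTop, ∀ k ∈ Finset.range k₀, p k T x :=
    (Finset.eventually_all _).2 fun k _ => hall k
  obtain ⟨T₀, hT₀⟩ := eventually_atTop.1 hfin
  refine ⟨T₀, fun T hT k hk => ?_⟩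
  by_cases hkk : k < k₀
  · exact hT₀ T hT k (Finset.mem_range.2 hkk)
  · by_contra hp
    exact hk₀ k (not_lt.1 hkk) (Set.mem_iUnion₂.2 ⟨T, hk, hp⟩)

/-! ### Measurability of ranks and groups -/

section Measurability

variable {Ω K : Type*} [MeasurableSpace Ω]

theorem measurable_card_filter_range {p : Ω → ℕ → Prop} [∀ ω, DecidablePred (p ω)] {T : ℕ}
    (hp : ∀ t < T, MeasurableSet {ω | p ω t}) :
    Measurable (fun ω => ((Finset.range T).filter (p ω)).card) := by
  simp only [Finset.card_filter]
  refine Finset.measurable_sum _ fun t ht => ?_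
  exact Measurable.ite (hp t (Finset.mem_range.1 ht)) measurable_const measurable_const

theorem measurable_keyRank {κ : Ω → ℕ → K} (hκ : ∀ s t, MeasurableSet {ω | κ ω s = κ ω t}) (t : ℕ) :
    Measurable (fun ω => keyRank (κ ω) t) := by
  classical
  exact measurable_card_filter_range fun s _ => hκ s t

theorem measurable_memberTime {κ : Ω → ℕ → K} (hκ : ∀ s t, MeasurableSet {ω | κ ω s = κ ω t})
    (t m : ℕ) : Measurable (fun ω => memberTime (κ ω) t m) := by
  classical
  refine Finset.measurable_sum _ fun s _ => ?_
  refine Measurable.ite ((hκ s t).inter ?_) measurable_const measurable_const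
  exact (measurable_keyRank hκ s) (measurableSet_singleton m)

theorem measurableSet_groupId_eq {κ : Ω → ℕ → K} (hκ : ∀ s t, MeasurableSet {ω | κ ω s = κ ω t})
    (L s t : ℕ) : MeasurableSet {ω | groupId (κ ω) L s = groupId (κ ω) L t} := by
  simp only [groupId, Prod.mk.injEq]
  refine (hκ s t).inter (measurableSet_eq_fun ?_ ?_)
  · exact (measurable_from_top (f := fun n : ℕ => n / L)).comp (measurable_keyRank hκ s)
  · exact (measurable_from_top (f := fun n : ℕ => n / L)).comp (measurable_keyRank hκ t)

end Measurability

/-! ### Finite partitions refined with time, and the keys built on them -/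

section Cells

variable {𝒳 : Type*} [MeasurableSpace 𝒳] [MeasurableSpace.CountablyGenerated 𝒳]

/-- The cell of a point in the finite partition generated by the first `n` sets of a countable
generating sequence, coded as the finite set of the indices of the sets that contain the point. -/
noncomputable def genCell (n : ℕ) (a : 𝒳) : Finset ℕ :=
  (Finset.range n).filter (fun i => MeasurableSpace.mapNatBool 𝒳 a i = true)

theorem genCell_eq_iff {n : ℕ} {a b : 𝒳} : genCell n a = genCell n b ↔
    ∀ i < n, MeasurableSpace.mapNatBool 𝒳 a i = MeasurableSpace.mapNatBool 𝒳 b i := by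
  unfold genCell
  rw [Finset.filter_inj']
  simp only [Finset.mem_range]
  refine forall₂_congr fun i _ => ?_
  exact Bool.eq_iff_iff.symm

theorem genCell_mono {m n : ℕ} (hmn : m ≤ n) {a b : 𝒳} (h : genCell n a = genCell n b) :
    genCell m a = genCell m b :=
  genCell_eq_iff.2 fun i hi => genCell_eq_iff.1 h i (hi.trans_le hmn)

theorem measurableSet_genCell_eq_const (n : ℕ) (c : Finset ℕ) :
    MeasurableSet {a : 𝒳 | genCell n a = c} := by
  have : {a : 𝒳 | genCell n a = c} = ⋂ i, {a : 𝒳 |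
      (i < n ∧ MeasurableSpace.mapNatBool 𝒳 a i = true) ↔ i ∈ c} := by
    ext a
    simp [genCell, Finset.ext_iff]
  rw [this]
  refine MeasurableSet.iInter fun i => measurableSet_setOfPred.2 ?_
  have hi : Measurable fun a : 𝒳 => MeasurableSpace.mapNatBool 𝒳 a i :=
    (measurable_pi_apply i).comp (MeasurableSpace.measurable_mapNatBool 𝒳)
  fun_prop

theorem measurableSet_genCell_eq {Ω : Type*} [MeasurableSpace Ω] (n : ℕ) {f g : Ω → 𝒳}
    (hf : Measurable f) (hg : Measurable g) :
    MeasurableSet {ω | genCell n (f ω) = genCell n (g ω)} := by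
  simp only [genCell_eq_iff]
  have hi : ∀ i, Measurable fun a : 𝒳 => MeasurableSpace.mapNatBool 𝒳 a i := fun i =>
    (measurable_pi_apply i).comp (MeasurableSpace.measurable_mapNatBool 𝒳)
  refine measurableSet_setOfPred.2 (Measurable.forall fun i => ?_)
  have h1 := (hi i).comp hf
  have h2 := (hi i).comp hg
  refine Measurable.imp (by fun_prop) ?_
  exact measurableSet_setOfPred.1 (measurableSet_eq_fun h1 h2)

/-- The generating sets separate points, and only finitely many pairs have to be separated. -/
theorem eventually_genCell_separates [MeasurableSpace.SeparatesPoints 𝒳] (x : ℕ → 𝒳) (S : ℕ) :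
    ∀ᶠ m in atTop, ∀ s < S, ∀ t < S, genCell m (x s) = genCell m (x t) → x s = x t := by
  have h : ∀ s t, ∀ᶠ m in atTop, genCell m (x s) = genCell m (x t) → x s = x t := by
    intro s t
    by_cases hst : x s = x t
    · exact Eventually.of_forall fun _ _ => hst
    · have hne : MeasurableSpace.mapNatBool 𝒳 (x s) ≠ MeasurableSpace.mapNatBool 𝒳 (x t) :=
        fun h => hst (MeasurableSpace.injective_mapNatBool 𝒳 h)
      obtain ⟨i, hi⟩ := Function.ne_iff.1 hne
      filter_upwards [eventually_gt_atTop i] with m hm hc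
      exact absurd (genCell_eq_iff.1 hc i hm) hi
  have h2 : ∀ᶠ m in atTop, ∀ s ∈ Finset.range S, ∀ t ∈ Finset.range S,
      genCell m (x s) = genCell m (x t) → x s = x t :=
    (Finset.eventually_all _).2 fun s _ => (Finset.eventually_all _).2 fun t _ => h s t
  filter_upwards [h2] with m hm s hs t ht
  exact hm s (Finset.mem_range.2 hs) t (Finset.mem_range.2 ht)

/-- The depth of the partition used at time `t`. -/
def cellDepth (t : ℕ) : ℕ := Nat.log 16 (t + 1)

/-- The key of a time: the first `N` occurrences of a point are keyed by its current cell, the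
later ones by the point itself. -/
noncomputable def groupKey (N : ℕ) (x : ℕ → 𝒳) (t : ℕ) : (ℕ × Finset ℕ) ⊕ 𝒳 :=
  if keyRank x t < N then Sum.inl (cellDepth t, genCell (cellDepth t) (x t)) else Sum.inr (x t)

theorem groupKey_eq_iff {N : ℕ} {x : ℕ → 𝒳} {s t : ℕ} : groupKey N x s = groupKey N x t ↔
    (keyRank x s < N ∧ keyRank x t < N ∧ cellDepth s = cellDepth t ∧
      genCell (cellDepth t) (x s) = genCell (cellDepth t) (x t)) ∨
    (¬ keyRank x s < N ∧ ¬ keyRank x t < N ∧ x s = x t) := by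
  unfold groupKey
  split_ifs with h1 h2 h2
  · simp only [Sum.inl.injEq, Prod.mk.injEq, h1, h2, true_and, not_true, false_and, or_false]
    constructor
    · rintro ⟨h, h'⟩
      rw [h] at h'
      exact ⟨h, h'⟩
    · rintro ⟨h, h'⟩
      rw [← h] at h'
      exact ⟨h, h ▸ h'⟩
  · simp [h1, h2]
  · simp [h1, h2]
  · simp [h1, h2]

theorem groupKey_congr {N : ℕ} {x x' : ℕ → 𝒳} {t : ℕ} (h : ∀ s ≤ t, x s = x' s) :
    groupKey N x t = groupKey N x' t := by
  have : keyRank x t = keyRank x' t :=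
    keyRank_congr fun s hs => by rw [h s hs, h t le_rfl]
  unfold groupKey
  rw [this, h t le_rfl]

open Classical in
/-- The times before `T` with a cell key whose group mixes points of different labels. -/
noncomputable def mixedTimes (N L : ℕ) {ι : Type*} (lab : 𝒳 → ι) (x : ℕ → 𝒳) (T : ℕ) : Finset ℕ :=
  (Finset.range T).filter (fun t => keyRank x t < N ∧ ∃ s ≤ t,
    groupId (groupKey N x) L s = groupId (groupKey N x) L t ∧ lab (x s) ≠ lab (x t))

theorem mem_mixedTimes {N L : ℕ} {ι : Type*} {lab : 𝒳 → ι} {x : ℕ → 𝒳} {T t : ℕ} :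
    t ∈ mixedTimes N L lab x T ↔ t < T ∧ keyRank x t < N ∧ ∃ s ≤ t,
      groupId (groupKey N x) L s = groupId (groupKey N x) L t ∧ lab (x s) ≠ lab (x t) := by
  simp [mixedTimes]

variable [MeasurableEq 𝒳]

theorem measurableSet_groupKey_eq (N s t : ℕ) :
    MeasurableSet {x : ℕ → 𝒳 | groupKey N x s = groupKey N x t} := by
  have hx : ∀ s t, MeasurableSet {x : ℕ → 𝒳 | x s = x t} := fun s t =>
    measurableSet_eq_fun (measurable_pi_apply s) (measurable_pi_apply t)
  have hr : ∀ t, MeasurableSet {x : ℕ → 𝒳 | keyRank x t < N} := fun t =>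
    measurableSet_lt (measurable_keyRank (κ := fun x : ℕ → 𝒳 => x) hx t) measurable_const
  simp only [groupKey_eq_iff]
  refine MeasurableSet.union ((hr s).inter ((hr t).inter (MeasurableSet.inter ?_ ?_)))
    ((hr s).compl.inter ((hr t).compl.inter (hx s t)))
  · exact MeasurableSet.const _
  · exact measurableSet_genCell_eq _ (measurable_pi_apply s) (measurable_pi_apply t)

theorem measurable_card_mixedTimes (N L : ℕ) {ι : Type*} {lab : 𝒳 → ι}
    (hlab : MeasurableSet {p : 𝒳 × 𝒳 | lab p.1 = lab p.2}) (T : ℕ) :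
    Measurable (fun x : ℕ → 𝒳 => (mixedTimes N L lab x T).card) := by
  classical
  have hx : ∀ s t, MeasurableSet {x : ℕ → 𝒳 | x s = x t} := fun s t =>
    measurableSet_eq_fun (measurable_pi_apply s) (measurable_pi_apply t)
  refine measurable_card_filter_range fun t _ => MeasurableSet.inter ?_ ?_
  · exact measurableSet_lt (measurable_keyRank (κ := fun x : ℕ → 𝒳 => x) hx t) measurable_const
  · have : {x : ℕ → 𝒳 | ∃ s ≤ t, groupId (groupKey N x) L s = groupId (groupKey N x) L t ∧
        lab (x s) ≠ lab (x t)} = ⋃ s, ⋃ (_ : s ≤ t),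
        ({x : ℕ → 𝒳 | groupId (groupKey N x) L s = groupId (groupKey N x) L t} ∩
        {x : ℕ → 𝒳 | lab (x s) = lab (x t)}ᶜ) := by
      ext x
      simp only [Set.mem_ofPred_eq, Set.mem_iUnion, Set.mem_inter_iff, Set.mem_compl_iff,
        exists_prop, ne_eq]
    change MeasurableSet {x : ℕ → 𝒳 | ∃ s ≤ t, _}
    rw [this]
    refine MeasurableSet.iUnion fun s => MeasurableSet.iUnion fun _ => ?_
    refine (measurableSet_groupId_eq (measurableSet_groupKey_eq N) L s t).inter ?_
    have hp : Measurable fun x : ℕ → 𝒳 => (x s, x t) := by fun_prop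
    exact (hp hlab).compl

end Cells

/-! ### Under `SMV`, groups rarely mix labels -/

/-- Under `SMV`, a countably valued measurable label takes `o(T)` values before time `T`. -/
theorem ae_sublinear_card_labels {𝒳 : Type u} [MeasurableSpace 𝒳]
    {μ : ProbabilityMeasure (ℕ → 𝒳)} (hμ : μ ∈ SMV 𝒳) {ι : Type*} [Countable ι] [DecidableEq ι] {Λ : 𝒳 → ι}
    (hΛ : ∀ i, MeasurableSet {a | Λ a = i}) :
    ∀ᵐ x ∂(μ : Measure (ℕ → 𝒳)),
      Sublinear (fun T => ((Finset.range T).image (fun t => Λ (x t))).card) := by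
  obtain ⟨e, he⟩ := exists_injective_nat ι
  set A : ℕ → Set 𝒳 := fun n => {a | e (Λ a) = n} with hA
  have hmeas : ∀ n, MeasurableSet (A n) := by
    intro n
    by_cases h : ∃ i, e i = n
    · obtain ⟨i, rfl⟩ := h
      convert hΛ i using 1
      ext a
      exact he.eq_iff
    · convert MeasurableSet.empty
      ext a
      simp only [hA, Set.mem_ofPred_eq, Set.mem_empty_iff_false, iff_false]
      exact fun ha => h ⟨_, ha⟩
  have hdisj : Pairwise (fun i j => Disjoint (A i) (A j)) := by
    intro i j hij
    rw [Set.disjoint_left]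
    intro a hi hj
    exact hij (hi.symm.trans hj)
  have hcov : (⋃ k, A k) = Set.univ :=
    Set.eq_univ_of_forall fun a => Set.mem_iUnion.2 ⟨_, rfl⟩
  filter_upwards [hμ A hmeas hdisj hcov] with x hx
  rw [sublinear_iff_isLittleO]
  convert hx using 3 with T
  have : {k : ℕ | ∃ t < T, x t ∈ A k} =
      (((Finset.range T).image (fun t => Λ (x t))).image e : Set ℕ) := by
    ext k
    simp [hA]
  rw [this, Set.ncard_coe_finset, Finset.card_image_of_injective _ he]

section Mixed

variable {𝒳 : Type u} [MeasurableSpace 𝒳] [MeasurableSpace.CountablyGenerated 𝒳]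

/-- A label determined by a finite-depth cell is eventually constant on groups. -/
theorem sublinear_mixedTimes_of_genCell (N L : ℕ) {ι : Type*} {lab : 𝒳 → ι} {n : ℕ}
    (hlab : ∀ a b, genCell n a = genCell n b → lab a = lab b) (x : ℕ → 𝒳) :
    Sublinear (fun T => (mixedTimes N L lab x T).card) := by
  classical
  -- From time `16 ^ n` on the depth `Nat.log 16 (t + 1)` is at least `n`, so a cell group stays
  -- inside one cell of depth `n`.
  apply sublinear_of_bounded (c := 16 ^ n)
  intro T
  have : mixedTimes N L lab x T ⊆ Finset.range (16 ^ n) := by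
    intro t ht
    obtain ⟨-, hN, s, -, hg, hne⟩ := mem_mixedTimes.1 ht
    rw [Finset.mem_range]
    by_contra hlt
    apply hne
    apply hlab
    have hk : groupKey N x s = groupKey N x t := congrArg Prod.fst hg
    rcases groupKey_eq_iff.1 hk with ⟨-, -, -, h⟩ | ⟨-, h, -⟩
    · refine genCell_mono ?_ h
      unfold cellDepth
      exact Nat.le_log_of_pow_le (by norm_num) (by omega)
    · exact absurd hN h
  simpa using Finset.card_le_card this

/-- If few distinct points have property `p`, then few early occurrences have it. -/
theorem card_filter_keyRank_lt_le {𝒳 : Type*} [DecidableEq 𝒳] (N : ℕ) (x : ℕ → 𝒳) (T : ℕ)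
    (p : ℕ → Prop) [DecidablePred p] :
    ((Finset.range T).filter (fun t => keyRank x t < N ∧ p t)).card ≤
      N * (((Finset.range T).filter p).image x).card := by
  have := Finset.card_le_mul_card_image_of_maps_to
    (s := (Finset.range T).filter (fun t => keyRank x t < N ∧ p t))
    (t := ((Finset.range T).filter p).image x) (f := x) ?_ N ?_
  · exact this
  · intro t ht
    obtain ⟨h1, -, h2⟩ := Finset.mem_filter.1 ht
    exact Finset.mem_image_of_mem _ (Finset.mem_filter.2 ⟨h1, h2⟩)
  · intro a _
    have := Finset.card_le_card_of_injOn (s := Finset.filter (fun t => x t = a)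
      ((Finset.range T).filter (fun t => keyRank x t < N ∧ p t))) (t := Finset.range N)
      (keyRank x) ?_ ?_
    · simpa using this
    · intro t ht
      have := (Finset.mem_filter.1 (Finset.mem_filter.1 ht).1).2.1
      simpa using this
    · intro s hs t ht hst
      have h1 := (Finset.mem_filter.1 (Finset.mem_coe.1 hs)).2
      have h2 := (Finset.mem_filter.1 (Finset.mem_coe.1 ht)).2
      exact eq_of_keyRank_eq (h1.trans h2.symm) hst

variable [MeasurableEq 𝒳] [MeasurableSpace.SeparatesPoints 𝒳]

/-- If every nonzero value of a label is asymptotically respected by the groups, so is the label. -/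
theorem ae_sublinear_mixedTimes_of_values {μ : ProbabilityMeasure (ℕ → 𝒳)} (hμ : μ ∈ SMV 𝒳)
    (N : ℕ) {L : ℕ} (hL : 0 < L) {lab : 𝒳 → ℕ} (hlab : Measurable lab)
    (h : ∀ k ≠ 0, ∀ᵐ x ∂(μ : Measure (ℕ → 𝒳)),
      Sublinear (fun T => (mixedTimes N L (fun a => lab a = k) x T).card)) :
    ∀ᵐ x ∂(μ : Measure (ℕ → 𝒳)), Sublinear (fun T => (mixedTimes N L lab x T).card) := by
  classical
  -- The thresholds below depend on the precision, so it runs over a countable set. Of the factor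
  -- `2`, one part pays for values whose threshold has passed, the other for the remaining ones.
  suffices H : ∀ n : ℕ, ∀ᵐ x ∂(μ : Measure (ℕ → 𝒳)), ∀ᶠ T : ℕ in atTop,
      ((mixedTimes N L lab x T).card : ℝ) ≤ 2 * (1 / ((n : ℝ) + 1)) * T by
    filter_upwards [ae_all_iff.2 H] with x hx
    intro ε hε
    obtain ⟨n, hn⟩ := exists_nat_one_div_lt (half_pos hε)
    filter_upwards [hx n] with T hT
    refine hT.trans (mul_le_mul_of_nonneg_right (by linarith) (Nat.cast_nonneg _))
  intro n
  set ε : ℝ := 1 / ((n : ℝ) + 1) with hε_def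
  have hε : 0 < ε := Nat.one_div_pos_of_nat
  -- thresholds for the individual values
  obtain ⟨τ, hτk, hτ⟩ := exists_diagonal_threshold (μ : Measure (ℕ → 𝒳))
    (p := fun k T x => k ≠ 0 →
      ((mixedTimes N L (fun a => lab a = k) x T).card : ℝ) ≤ (ε * (1 / 2) ^ (k + 1)) * T)
    (fun k T => by
      by_cases hk : k = 0
      · simp [hk]
      · simp only [ne_eq, hk, not_false_eq_true, true_imp_iff]
        have hm := measurable_card_mixedTimes (𝒳 := 𝒳) N L (lab := fun a => lab a = k) (by
          refine measurableSet_setOfPred.2 ?_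
          have h1 : MeasurableSet {a : 𝒳 | lab a = k} := hlab (measurableSet_singleton k)
          have h2 : Measurable fun a : 𝒳 => lab a = k := measurableSet_setOfPred.1 h1
          have h3 : Measurable fun p : 𝒳 × 𝒳 => lab p.1 = k := h2.comp measurable_fst
          have h4 : Measurable fun p : 𝒳 × 𝒳 => lab p.2 = k := h2.comp measurable_snd
          simpa only [eq_iff_iff] using h3.iff h4) T
        exact measurableSet_le ((measurable_from_top (f := fun n : ℕ => (n : ℝ))).comp hm)
          measurable_const)
    (fun k => by
      by_cases hk : k = 0
      · simp [hk]
      · filter_upwards [h k hk] with x hx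
        filter_upwards [hx (ε * (1 / 2) ^ (k + 1)) (by positivity)] with T hT _
        exact hT)
  -- thresholds for the separation of points
  obtain ⟨σ, -, hσ⟩ := exists_diagonal_threshold (μ : Measure (ℕ → 𝒳))
    (p := fun S m x => ∀ s < S, ∀ t < S, genCell m (x s) = genCell m (x t) → x s = x t)
    (fun S m => by
      have : {x : ℕ → 𝒳 | ∀ s < S, ∀ t < S, genCell m (x s) = genCell m (x t) → x s = x t} =
          ⋂ s, ⋂ (_ : s < S), ⋂ t, ⋂ (_ : t < S),
          ({x : ℕ → 𝒳 | genCell m (x s) = genCell m (x t)}ᶜ ∪ {x : ℕ → 𝒳 | x s = x t}) := by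
        ext x
        simp only [Set.mem_ofPred_eq, Set.mem_iInter, Set.mem_union, Set.mem_compl_iff,
          imp_iff_not_or]
      rw [this]
      refine MeasurableSet.iInter fun s => MeasurableSet.iInter fun _ =>
        MeasurableSet.iInter fun t => MeasurableSet.iInter fun _ => MeasurableSet.union ?_ ?_
      · exact (measurableSet_genCell_eq _ (measurable_pi_apply s) (measurable_pi_apply t)).compl
      · exact measurableSet_eq_fun (measurable_pi_apply s) (measurable_pi_apply t))
    (fun S => Eventually.of_forall fun x => eventually_genCell_separates x S)
  -- Depth `σ (τ k)` is meant to separate the points met before time `τ k`. This is guaranteed only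
  -- for depths beyond a random `m₀`, and the maximum with `k` ensures `m₀ ≤ M k` once `m₀ ≤ k`.
  set M : ℕ → ℕ := fun k => max k (σ (τ k)) with hM
  have hΛ := ae_sublinear_card_labels hμ (Λ := fun a => (lab a, genCell (M (lab a)) a)) (by
    rintro ⟨k, c⟩
    have : {a : 𝒳 | (lab a, genCell (M (lab a)) a) = (k, c)} =
        {a | lab a = k} ∩ {a | genCell (M k) a = c} := by
      ext a
      simp only [Set.mem_ofPred_eq, Prod.mk.injEq, Set.mem_inter_iff]
      constructor
      · rintro ⟨rfl, h⟩
        exact ⟨rfl, h⟩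
      · rintro ⟨rfl, h⟩
        exact ⟨rfl, h⟩
    rw [this]
    exact (hlab (measurableSet_singleton k)).inter (measurableSet_genCell_eq_const _ _))
  filter_upwards [hτ, hσ, hΛ] with x ⟨T₀, hT₀⟩ ⟨m₀, hm₀⟩ hV
  have hpos : 0 < ε / ((1 + L) * N + 1) := by positivity
  -- Past the supremum of `τ` on `range m₀`, a value that is still late is at least `m₀`, as the
  -- separation by `M` requires.
  filter_upwards [hV _ hpos, eventually_ge_atTop T₀,
    eventually_ge_atTop ((Finset.range m₀).sup τ)] with T hVT hTT₀ hTm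
  set V := ((Finset.range T).image (fun t => (lab (x t), genCell (M (lab (x t))) (x t)))).card
  set late : ℕ → Prop := fun t => T < τ (lab (x t)) with hlate
  set P := (Finset.range T).filter (fun t => keyRank x t < N ∧ late t) with hP
  set κ := groupKey N x with hκ
  set G := P.biUnion (fun s => groupTimes κ L T (groupId κ L s)) with hG
  -- The range `T + 1` contains every value with `τ k ≤ T`, because `k ≤ τ k`.
  set E := ((Finset.range (T + 1)).filter (fun k => k ≠ 0 ∧ τ k ≤ T)).biUnion
    (fun k => mixedTimes N L (fun a => lab a = k) x T) with hE
  -- At a mixed time one of the two conflicting labels is nonzero; follow that of `t` if possible,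
  -- else that of `s`. If it is not late, the time is already mixed for that single value. If it is
  -- late, `t` is itself a late time or lies in the group of one.
  have hsub : mixedTimes N L lab x T ⊆ E ∪ (P ∪ G) := by
    intro t ht
    obtain ⟨htT, hN, s, hst, hg, hne⟩ := mem_mixedTimes.1 ht
    have hkey : ∀ k, (lab (x s) = k) ≠ (lab (x t) = k) → k ≠ 0 → τ k ≤ T → t ∈ E := by
      intro k hk hk0 hkT
      refine Finset.mem_biUnion.2 ⟨k, Finset.mem_filter.2 ⟨?_, hk0, hkT⟩, ?_⟩
      · exact Finset.mem_range.2 (Nat.lt_succ_of_le ((hτk k).trans hkT))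
      · exact mem_mixedTimes.2 ⟨htT, hN, s, hst, hg, hk⟩
    have hsN : keyRank x s < N := by
      rcases groupKey_eq_iff.1 (congrArg Prod.fst hg) with ⟨h, -⟩ | ⟨-, h, -⟩
      · exact h
      · exact absurd hN h
    by_cases h0 : lab (x t) = 0
    · have hs0 : lab (x s) ≠ 0 := fun h => hne (h.trans h0.symm)
      by_cases hl : late s
      · apply Finset.mem_union_right
        apply Finset.mem_union_right
        refine Finset.mem_biUnion.2 ⟨s, Finset.mem_filter.2 ⟨Finset.mem_range.2 (by omega),
          hsN, hl⟩, mem_groupTimes.2 ⟨htT, hg.symm⟩⟩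
      · apply Finset.mem_union_left
        exact hkey (lab (x s)) (by simp [Ne.symm hne]) hs0 (not_lt.1 hl)
    · by_cases hl : late t
      · apply Finset.mem_union_right
        apply Finset.mem_union_left
        exact Finset.mem_filter.2 ⟨Finset.mem_range.2 htT, hN, hl⟩
      · apply Finset.mem_union_left
        exact hkey (lab (x t)) (by simp [hne]) h0 (not_lt.1 hl)
  -- A late point of label `k` occurs before `T < τ k`, where cells of depth `M k` tell points
  -- apart. So distinct late points carry distinct pairs of label and cell, and `V` counts these
  -- pairs.
  have hlateV : (((Finset.range T).filter late).image x).card ≤ V := by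
    have hmaps : ∀ a ∈ ((Finset.range T).filter late).image x,
        (lab a, genCell (M (lab a)) a) ∈
          (Finset.range T).image (fun t => (lab (x t), genCell (M (lab (x t))) (x t))) := by
      intro a ha
      obtain ⟨t, ht, rfl⟩ := Finset.mem_image.1 ha
      exact Finset.mem_image_of_mem (fun t => (lab (x t), genCell (M (lab (x t))) (x t)))
        (Finset.mem_filter.1 ht).1
    refine Finset.card_le_card_of_injOn _ hmaps ?_
    intro a ha b hb hab
    obtain ⟨s, hs, rfl⟩ := Finset.mem_image.1 (Finset.mem_coe.1 ha)
    obtain ⟨t, ht, rfl⟩ := Finset.mem_image.1 (Finset.mem_coe.1 hb)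
    obtain ⟨hsT, hsl⟩ := Finset.mem_filter.1 hs
    obtain ⟨htT, htl⟩ := Finset.mem_filter.1 ht
    rw [Finset.mem_range] at hsT htT
    obtain ⟨h1, h2⟩ := Prod.mk.inj hab
    rw [← h1] at h2
    have hk : m₀ ≤ lab (x s) := by
      by_contra hlt
      have := Finset.le_sup (f := τ) (Finset.mem_range.2 (not_le.1 hlt))
      exact absurd (this.trans hTm) (not_le.2 hsl)
    exact hm₀ (M (lab (x s))) (hk.trans (le_max_left _ _)) (τ (lab (x s))) (le_max_right _ _)
      s (hsT.trans hsl) t (htT.trans hsl) h2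
  have hPV : P.card ≤ N * V :=
    (card_filter_keyRank_lt_le N x T late).trans (Nat.mul_le_mul_left _ hlateV)
  have hGV : G.card ≤ (N * V) * L :=
    (Finset.card_biUnion_le_card_mul P _ L fun s _ => card_groupTimes_le κ hL T _).trans
      (Nat.mul_le_mul_right _ hPV)
  have hEV : (E.card : ℝ) ≤ ε * T := by
    calc (E.card : ℝ) ≤ ∑ k ∈ (Finset.range (T + 1)).filter (fun k => k ≠ 0 ∧ τ k ≤ T),
          ((mixedTimes N L (fun a => lab a = k) x T).card : ℝ) := by
          exact_mod_cast Finset.card_biUnion_le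
      _ ≤ ∑ k ∈ (Finset.range (T + 1)).filter (fun k => k ≠ 0 ∧ τ k ≤ T),
          (ε * (1 / 2) ^ (k + 1)) * T := by
          refine Finset.sum_le_sum fun k hk => ?_
          obtain ⟨-, hk0, hkT⟩ := Finset.mem_filter.1 hk
          exact hT₀ T hTT₀ k hkT hk0
      _ ≤ ∑ k ∈ Finset.range (T + 1), (ε * (1 / 2) ^ (k + 1)) * T := by
          refine Finset.sum_le_sum_of_subset_of_nonneg (Finset.filter_subset _ _) ?_
          intros
          positivity
      _ = ε * T * ((1 / 2) * ∑ k ∈ Finset.range (T + 1), (1 / 2 : ℝ) ^ k) := by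
          rw [Finset.mul_sum, Finset.mul_sum]
          refine Finset.sum_congr rfl fun k _ => ?_
          ring
      _ ≤ ε * T * ((1 / 2) * 2) := by
          gcongr
          exact sum_geometric_two_le _
      _ = ε * T := by ring
  have hcard : (mixedTimes N L lab x T).card ≤ E.card + (N * V + N * V * L) :=
    (Finset.card_le_card hsub).trans ((Finset.card_union_le _ _).trans
      (Nat.add_le_add_left ((Finset.card_union_le _ _).trans (Nat.add_le_add hPV hGV)) _))
  have hcard' : ((mixedTimes N L lab x T).card : ℝ) ≤ E.card + (1 + L) * N * V := by
    have : ((mixedTimes N L lab x T).card : ℝ) ≤ E.card + (N * V + N * V * L) := by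
      exact_mod_cast hcard
    linarith
  have hVT' : ((1 + L) * N + 1) * (V : ℝ) ≤ ε * T := by
    have h1 := mul_le_mul_of_nonneg_left hVT (show (0 : ℝ) ≤ (1 + L) * N + 1 by positivity)
    calc _ ≤ _ := h1
      _ = ε * T := by field_simp
  have hV0 : (0 : ℝ) ≤ V := Nat.cast_nonneg _
  linarith

/-- Under `SMV`, the groups asymptotically respect every measurable set. -/
theorem ae_sublinear_mixedTimes_mem {μ : ProbabilityMeasure (ℕ → 𝒳)} (hμ : μ ∈ SMV 𝒳)
    (N : ℕ) {L : ℕ} (hL : 0 < L) {A : Set 𝒳} (hA : MeasurableSet A) :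
    ∀ᵐ x ∂(μ : Measure (ℕ → 𝒳)), Sublinear (fun T => (mixedTimes N L (· ∈ A) x T).card) := by
  classical
  -- Sets of finite depth form a generating π-system, so the claim is propagated by the π-λ theorem.
  set C : Set (Set 𝒳) := {A | ∃ n, ∀ a b, genCell n a = genCell n b → (a ∈ A ↔ b ∈ A)} ∩
    {A | MeasurableSet A} with hC
  have hgen : ‹MeasurableSpace 𝒳› = MeasurableSpace.generateFrom C := by
    apply le_antisymm
    · conv_lhs => rw [← MeasurableSpace.generateFrom_natGeneratingSequence 𝒳]
      apply MeasurableSpace.generateFrom_mono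
      rintro _ ⟨i, rfl⟩
      refine ⟨⟨i + 1, fun a b hab => ?_⟩,
        MeasurableSpace.measurableSet_natGeneratingSequence i⟩
      have := genCell_eq_iff.1 hab i (Nat.lt_succ_self i)
      simpa [MeasurableSpace.mapNatBool] using this
    · exact MeasurableSpace.generateFrom_le fun s hs => hs.2
  have hpi : IsPiSystem C := by
    rintro A ⟨⟨m, hm⟩, hA⟩ B ⟨⟨n, hn⟩, hB⟩ -
    refine ⟨⟨max m n, fun a b hab => ?_⟩, hA.inter hB⟩
    exact and_congr (hm a b (genCell_mono (le_max_left _ _) hab))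
      (hn a b (genCell_mono (le_max_right _ _) hab))
  induction A, hA using MeasurableSpace.induction_on_inter hgen hpi with
  | empty =>
    exact Eventually.of_forall fun x =>
      sublinear_mixedTimes_of_genCell N L (n := 0) (fun a b _ => by simp) x
  | basic A hA =>
    obtain ⟨⟨n, hn⟩, -⟩ := hA
    exact Eventually.of_forall fun x =>
      sublinear_mixedTimes_of_genCell N L (n := n) (fun a b h => propext (hn a b h)) x
  | compl A hA ih =>
    filter_upwards [ih] with x hx
    refine hx.of_le fun T => Finset.card_le_card ?_
    intro t ht
    obtain ⟨htT, hN, s, hst, hg, hne⟩ := mem_mixedTimes.1 ht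
    refine mem_mixedTimes.2 ⟨htT, hN, s, hst, hg, fun h => hne ?_⟩
    simp only [Set.mem_compl_iff]
    exact congrArg Not h
  | iUnion f hd hf ih =>
    have hex : ∀ a : 𝒳, ∃ n, a ∈ f n ∨ a ∉ ⋃ i, f i := by
      intro a
      by_cases h : a ∈ ⋃ i, f i
      · obtain ⟨i, hi⟩ := Set.mem_iUnion.1 h
        exact ⟨i, Or.inl hi⟩
      · exact ⟨0, Or.inr h⟩
    obtain ⟨g, hg, hgf⟩ : ∃ g : 𝒳 → ℕ, Measurable g ∧ ∀ a, a ∈ f (g a) ∨ a ∉ ⋃ i, f i :=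
      ⟨fun a => Nat.find (hex a),
        measurable_find hex fun n => (hf n).union (MeasurableSet.iUnion hf).compl,
        fun a => Nat.find_spec (hex a)⟩
    -- Number the pieces from `1`. The value `0` is the complement of the union, about which nothing
    -- is known yet; this is why only nonzero values are assumed respected in
    -- `ae_sublinear_mixedTimes_of_values`.
    set lab : 𝒳 → ℕ := fun a => if a ∈ ⋃ i, f i then g a + 1 else 0 with hlabdef
    have hlab : Measurable lab :=
      Measurable.ite (MeasurableSet.iUnion hf)
        ((measurable_from_top (f := fun n : ℕ => n + 1)).comp hg) measurable_const
    have hin : ∀ a, a ∈ (⋃ i, f i) → lab a = g a + 1 := fun a ha => if_pos ha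
    have hout : ∀ a, a ∉ (⋃ i, f i) → lab a = 0 := fun a ha => if_neg ha
    have hval : ∀ k a, lab a = k + 1 ↔ a ∈ f k := by
      intro k a
      constructor
      · intro h
        by_cases ha : a ∈ ⋃ i, f i
        · rw [hin a ha, Nat.add_right_cancel_iff] at h
          rw [← h]
          exact (hgf a).resolve_right (not_not.2 ha)
        · rw [hout a ha] at h
          omega
      · intro h
        have ha : a ∈ ⋃ i, f i := Set.mem_iUnion.2 ⟨k, h⟩
        rw [hin a ha, Nat.add_right_cancel_iff]
        by_contra hne
        exact Set.disjoint_left.1 (hd hne) ((hgf a).resolve_right (not_not.2 ha)) h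
    have hzero : ∀ a, a ∈ (⋃ i, f i) ↔ lab a ≠ 0 := by
      intro a
      by_cases ha : a ∈ ⋃ i, f i
      · simp only [hin a ha, ha, ne_eq, Nat.add_eq_zero_iff, one_ne_zero, and_false, not_false_eq_true]
      · simp only [hout a ha, ha, ne_eq, not_true]
    have := ae_sublinear_mixedTimes_of_values hμ N hL hlab (by
      intro k hk
      obtain ⟨j, rfl⟩ := Nat.exists_eq_succ_of_ne_zero hk
      simpa only [Nat.succ_eq_add_one, hval] using ih j)
    filter_upwards [this] with x hx
    refine hx.of_le fun T => Finset.card_le_card ?_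
    intro t ht
    obtain ⟨htT, hN, s, hst, hg, hne⟩ := mem_mixedTimes.1 ht
    refine mem_mixedTimes.2 ⟨htT, hN, s, hst, hg, fun h => hne ?_⟩
    simp only [hzero, h]

/-- Under `SMV`, the groups asymptotically respect every countable measurable partition. -/
theorem ae_sublinear_mixedTimes {μ : ProbabilityMeasure (ℕ → 𝒳)} (hμ : μ ∈ SMV 𝒳)
    (N : ℕ) {L : ℕ} (hL : 0 < L) {lab : 𝒳 → ℕ} (hlab : Measurable lab) :
    ∀ᵐ x ∂(μ : Measure (ℕ → 𝒳)), Sublinear (fun T => (mixedTimes N L lab x T).card) :=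
  ae_sublinear_mixedTimes_of_values hμ N hL hlab fun k _ =>
    ae_sublinear_mixedTimes_mem hμ N hL (A := {a | lab a = k}) (hlab (measurableSet_singleton k))

end Mixed

/-! ### Counting keys -/

section Keys

variable {𝒳 : Type u} [MeasurableSpace 𝒳] [MeasurableSpace.CountablyGenerated 𝒳]

-- Cell keys before `T` have depth at most `D = Nat.log 16 (T + 1)`, so there are at most `(D + 1) *
-- 2 ^ D ≤ 4 ^ D` of them. A point that is its own key has occurred at least `N` times, so there are
-- at most `T / N` such points.
open Classical in
theorem card_image_groupKey_le {N : ℕ} (hN : 0 < N) (x : ℕ → 𝒳) (T : ℕ) :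
    (((Finset.range T).image (groupKey N x)).card : ℝ) ≤
      ((4 ^ Nat.log 16 (T + 1) : ℕ) : ℝ) + T / N := by
  set D := Nat.log 16 (T + 1) with hD
  set Pv := ((Finset.range T).filter (fun t => ¬ keyRank x t < N)).image x with hPv
  set Pu := ((Finset.range (D + 1)) ×ˢ (Finset.range D).powerset) with hPu
  have hsub : (Finset.range T).image (groupKey N x) ⊆
      Pu.image Sum.inl ∪ Pv.image Sum.inr := by
    intro k hk
    obtain ⟨t, ht, rfl⟩ := Finset.mem_image.1 hk
    by_cases h : keyRank x t < N
    · apply Finset.mem_union_left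
      rw [groupKey, if_pos h]
      have hd : cellDepth t ≤ D := Nat.log_mono_right (by have := Finset.mem_range.1 ht; omega)
      refine Finset.mem_image_of_mem _ (Finset.mem_product.2 ⟨?_, ?_⟩)
      · exact Finset.mem_range.2 (Nat.lt_succ_of_le hd)
      · refine Finset.mem_powerset.2 ((Finset.filter_subset _ _).trans ?_)
        intro i hi
        exact Finset.mem_range.2 ((Finset.mem_range.1 hi).trans_le hd)
    · apply Finset.mem_union_right
      rw [groupKey, if_neg h]
      exact Finset.mem_image_of_mem _ (Finset.mem_image_of_mem _ (Finset.mem_filter.2 ⟨ht, h⟩))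
  have hPuc : Pu.card ≤ 4 ^ D := by
    rw [hPu, Finset.card_product, Finset.card_range, Finset.card_powerset, Finset.card_range]
    calc (D + 1) * 2 ^ D ≤ 2 ^ D * 2 ^ D := Nat.mul_le_mul_right _ Nat.lt_two_pow_self
      _ = 4 ^ D := by rw [← mul_pow]; norm_num
  have hPvc : N * Pv.card ≤ T := by
    have h1 := Finset.mul_card_image_le_card_of_maps_to
      (s := (Finset.range T).filter (fun t => x t ∈ Pv)) (t := Pv) (f := x)
      (fun t ht => (Finset.mem_filter.1 ht).2) N (by
        intro a ha
        obtain ⟨t, ht, rfl⟩ := Finset.mem_image.1 ha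
        obtain ⟨htT, hr⟩ := Finset.mem_filter.1 ht
        refine (not_lt.1 hr).trans (Finset.card_le_card ?_)
        intro s hs
        obtain ⟨hst, hxs⟩ := Finset.mem_filter.1 hs
        rw [Finset.mem_range] at hst htT
        refine Finset.mem_filter.2 ⟨Finset.mem_filter.2 ⟨?_, hxs ▸ ha⟩, hxs⟩
        exact Finset.mem_range.2 (hst.trans htT))
    refine h1.trans ((Finset.card_filter_le _ _).trans (by simp))
  have hN' : (0 : ℝ) < N := Nat.cast_pos.2 hN
  have hPvc' : (Pv.card : ℝ) ≤ T / N := by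
    rw [le_div_iff₀ hN', mul_comm]
    exact_mod_cast hPvc
  have hc : ((Finset.range T).image (groupKey N x)).card ≤ Pu.card + Pv.card :=
    (Finset.card_le_card hsub).trans ((Finset.card_union_le _ _).trans
      (Nat.add_le_add Finset.card_image_le Finset.card_image_le))
  calc _ ≤ ((Pu.card + Pv.card : ℕ) : ℝ) := Nat.cast_le.2 hc
    _ ≤ _ := by
      push_cast
      refine add_le_add ?_ hPvc'
      exact_mod_cast hPuc

/-- Since `16 = 4 ^ 2`, the left side is at most the square root of `T + 1`; the base of `cellDepth`
serves this purpose. -/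
theorem sublinear_four_pow_log : Sublinear (fun T => 4 ^ Nat.log 16 (T + 1)) := by
  intro ε hε
  filter_upwards [eventually_ge_atTop ⌈2 / ε ^ 2⌉₊, eventually_ge_atTop 1] with T hT hT1
  have h1 : 2 / ε ^ 2 ≤ (T : ℝ) := Nat.ceil_le.1 hT
  rw [div_le_iff₀ (by positivity)] at h1
  have hsq : ((4 ^ Nat.log 16 (T + 1) : ℕ) : ℝ) ^ 2 ≤ T + 1 := by
    have : (4 ^ Nat.log 16 (T + 1)) ^ 2 ≤ T + 1 := by
      rw [← pow_mul, mul_comm, pow_mul]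
      exact Nat.pow_log_le_self 16 (by omega)
    exact_mod_cast this
  have hT1' : (1 : ℝ) ≤ T := by exact_mod_cast hT1
  apply le_of_sq_le_sq _ (by positivity)
  calc _ ≤ (T : ℝ) + 1 := hsq
    _ ≤ 2 * T := by linarith
    _ ≤ (T * ε ^ 2) * T := by gcongr
    _ = (ε * T) ^ 2 := by ring

end Keys

/-! ### A fresh copy of a covariate-free rule in each group, and its regret -/

section Expert

variable {𝒳 𝒴 : Type u} [MeasurableSpace 𝒳] [MeasurableSpace.CountablyGenerated 𝒳]
  [MeasurableSpace 𝒴]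

/-- The position of a time in its group. -/
noncomputable def groupPos (N L : ℕ) (x : ℕ → 𝒳) (t : ℕ) : ℕ := keyRank (groupKey N x) t % L

/-- The values observed at the successive times of the group of `t`. -/
noncomputable def groupPast (N L : ℕ) (x : ℕ → 𝒳) (y : ℕ → 𝒴) (t j : ℕ) : 𝒴 :=
  y (memberTime (groupKey N x) t (L * (keyRank (groupKey N x) t / L) + j))

/-- The prediction of a rule without covariates from the values `z`. -/
def OnlineRule.blindPredict (g : OnlineRule PUnit.{u + 1} 𝒴) (j : ℕ) (r : g.R) (z : ℕ → 𝒴) : 𝒴 :=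
  g.predict j r (fun _ => PUnit.unit) (fun i : Fin j => z i) PUnit.unit

/-- The expected loss of a rule without covariates against the values `z`. -/
noncomputable def OnlineRule.blindLoss (ℓ : 𝒴 → 𝒴 → ℝ) (g : OnlineRule PUnit.{u + 1} 𝒴) (j : ℕ)
    (z : ℕ → 𝒴) (y : 𝒴) : ℝ :=
  ∫ r, ℓ (g.blindPredict j r z) y ∂(g.law j)

/-- The expected loss at time `t` of the expert that runs a fresh copy of `g` in each group. -/
noncomputable def expertLoss (ℓ : 𝒴 → 𝒴 → ℝ) (N L : ℕ) (g : OnlineRule PUnit.{u + 1} 𝒴)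
    (x : ℕ → 𝒳) (y : ℕ → 𝒴) (t : ℕ) : ℝ :=
  g.blindLoss ℓ (groupPos N L x t) (groupPast N L x y t) (y t)

theorem OnlineRule.blindPredict_congr (g : OnlineRule PUnit.{u + 1} 𝒴) {j : ℕ} (r : g.R)
    {z z' : ℕ → 𝒴} (h : ∀ i < j, z i = z' i) : g.blindPredict j r z = g.blindPredict j r z' := by
  unfold OnlineRule.blindPredict
  congr 1
  funext i
  exact h i i.2

theorem OnlineRule.blindLoss_congr (ℓ : 𝒴 → 𝒴 → ℝ) (g : OnlineRule PUnit.{u + 1} 𝒴) {j : ℕ}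
    {z z' : ℕ → 𝒴} (h : ∀ i < j, z i = z' i) (y : 𝒴) :
    g.blindLoss ℓ j z y = g.blindLoss ℓ j z' y := by
  unfold OnlineRule.blindLoss
  simp only [g.blindPredict_congr _ h]

theorem OnlineRule.blindLoss_nonneg {ℓ : 𝒴 → 𝒴 → ℝ} (hℓ : ∀ a b, 0 ≤ ℓ a b)
    (g : OnlineRule PUnit.{u + 1} 𝒴) (j : ℕ) (z : ℕ → 𝒴) (y : 𝒴) : 0 ≤ g.blindLoss ℓ j z y :=
  integral_nonneg fun _ => hℓ _ _

theorem OnlineRule.blindLoss_le {ℓ : 𝒴 → 𝒴 → ℝ} {C : ℝ} (hℓ : ∀ a b, 0 ≤ ℓ a b)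
    (hC : ∀ a b, ℓ a b ≤ C) (g : OnlineRule PUnit.{u + 1} 𝒴) (j : ℕ) (z : ℕ → 𝒴) (y : 𝒴) :
    g.blindLoss ℓ j z y ≤ C := by
  have := integral_mono_of_nonneg (μ := g.law j) (Eventually.of_forall fun r => hℓ _ _)
    (integrable_const C) (Eventually.of_forall fun r => hC (g.blindPredict j r z) y)
  simpa [OnlineRule.blindLoss] using this

/-- On a complete group, the expert loses as much as one run of `g`. -/
theorem sum_expertLoss_groupTimes (ℓ : 𝒴 → 𝒴 → ℝ) (N : ℕ) {L : ℕ} (hL : 0 < L)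
    (g : OnlineRule PUnit.{u + 1} 𝒴) (x : ℕ → 𝒳) (y : ℕ → 𝒴) (T : ℕ)
    (γ : ((ℕ × Finset ℕ) ⊕ 𝒳) × ℕ) (hγ : (groupTimes (groupKey N x) L T γ).card = L) :
    ∃ z : ℕ → 𝒴, ∀ v : 𝒴, ∑ t ∈ groupTimes (groupKey N x) L T γ,
      (expertLoss ℓ N L g x y t - ℓ v (y t)) =
      ∑ j ∈ Finset.range L, (g.blindLoss ℓ j z (z j) - ℓ v (z j)) := by
  obtain ⟨τ, hτ, hsum⟩ := exists_enum_groupTimes (groupKey N x) hL T γ hγ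
  refine ⟨fun j => y (τ j), fun v => ?_⟩
  rw [hsum]
  refine Finset.sum_congr rfl fun j hj => ?_
  rw [Finset.mem_range] at hj
  obtain ⟨hjm, hjr⟩ := hτ j hj
  have hjk := (keyRank_of_mem_groupTimes hL hjm).1
  have hpos : groupPos N L x (τ j) = j := by
    rw [groupPos, hjr, Nat.mul_add_mod, Nat.mod_eq_of_lt hj]
  have hblock : keyRank (groupKey N x) (τ j) / L = γ.2 := by
    rw [hjr, Nat.mul_add_div hL, Nat.div_eq_of_lt hj, add_zero]
  congr 1
  rw [expertLoss, hpos]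
  apply OnlineRule.blindLoss_congr
  intro i hi
  obtain ⟨him, hir⟩ := hτ i (hi.trans hj)
  have hik := (keyRank_of_mem_groupTimes hL him).1
  -- Members of a group are met in order of rank, so the first `j` values of the block have all been
  -- observed when position `j` is played.
  have hlt : τ i < τ j := by
    by_contra hge
    rcases (not_lt.1 hge).lt_or_eq with h | h
    · have := keyRank_lt_keyRank h (hjk.trans hik.symm)
      omega
    · rw [h] at hjr
      omega
  rw [groupPast, hblock, ← hir, memberTime_eq hlt (hik.trans hjk.symm)]

variable [MeasurableEq 𝒳] [MeasurableSpace.SeparatesPoints 𝒳]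

/-- The regret of an expert against a predictor with countably many values. -/
theorem ae_expert_regret {μ : ProbabilityMeasure (ℕ → 𝒳)} (hμ : μ ∈ SMV 𝒳)
    {ℓ : 𝒴 → 𝒴 → ℝ} {C : ℝ} (hℓ : ∀ a b, 0 ≤ ℓ a b) (hC : ∀ a b, ℓ a b ≤ C) (hC0 : 0 ≤ C)
    {N L : ℕ} (hN : 0 < N) (hL : 0 < L) {η : ℝ} (hη : 0 ≤ η) (g : OnlineRule PUnit.{u + 1} 𝒴)
    (hg : ∀ (z : ℕ → 𝒴) (v : 𝒴),
      ∑ j ∈ Finset.range L, (g.blindLoss ℓ j z (z j) - ℓ v (z j)) ≤ η * L)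
    {lab : 𝒳 → ℕ} (hlab : Measurable lab) (v : ℕ → 𝒴) :
    ∀ᵐ x ∂(μ : Measure (ℕ → 𝒳)), ∀ y : ℕ → 𝒴, ∀ ε : ℝ, 0 < ε → ∀ᶠ T : ℕ in atTop,
      ∑ t ∈ Finset.range T, (expertLoss ℓ N L g x y t - ℓ (v (lab (x t))) (y t)) ≤
        (η + C * L / N + ε) * T := by
  classical
  -- The exceptional set concerns the instances only and is fixed before `y`; the responses may
  -- therefore be chosen adaptively.
  filter_upwards [ae_sublinear_mixedTimes hμ N hL hlab] with x hx y ε hε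
  have hCL : 0 ≤ C * L := by positivity
  have hε' : 0 < ε / (2 * (C * L + 1)) := by positivity
  filter_upwards [hx _ hε', sublinear_four_pow_log _ hε'] with T hT1 hT2
  have hmain := sum_le_of_groups (groupKey N x) hL T (fun t => lab (x t))
    (fun t => expertLoss ℓ N L g x y t - ℓ (v (lab (x t))) (y t)) hη hC0
    (fun t => by
      have h1 : expertLoss ℓ N L g x y t ≤ C := g.blindLoss_le hℓ hC _ _ _
      have h2 := hℓ (v (lab (x t))) (y t)
      show expertLoss ℓ N L g x y t - ℓ (v (lab (x t))) (y t) ≤ C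
      linarith)
    (by
      intro γ hγ hpure
      obtain ⟨z, hz⟩ := sum_expertLoss_groupTimes ℓ N hL g x y T γ hγ
      obtain ⟨t₀, ht₀⟩ : (groupTimes (groupKey N x) L T γ).Nonempty :=
        Finset.card_pos.1 (by rw [hγ]; exact hL)
      refine le_trans (le_of_eq ?_) (hg z (v (lab (x t₀))))
      rw [← hz]
      refine Finset.sum_congr rfl fun t ht => ?_
      rw [hpure t ht t₀ ht₀])
  refine hmain.trans ?_
  -- A group whose key is a point has constant label, so bad times occur only under cell keys.
  have hbad : ((Finset.range T).filter (fun t => ∃ s ≤ t, groupId (groupKey N x) L s =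
      groupId (groupKey N x) L t ∧ lab (x s) ≠ lab (x t))).card ≤
      (mixedTimes N L lab x T).card := by
    refine Finset.card_le_card fun t ht => ?_
    obtain ⟨htT, s, hst, hgr, hne⟩ := Finset.mem_filter.1 ht
    refine mem_mixedTimes.2 ⟨Finset.mem_range.1 htT, ?_, s, hst, hgr, hne⟩
    rcases groupKey_eq_iff.1 (congrArg Prod.fst hgr) with ⟨-, h, -⟩ | ⟨-, -, h⟩
    · exact h
    · exact absurd (congrArg lab h) hne
  have hkeys := card_image_groupKey_le hN x T
  have hbad' : (((Finset.range T).filter (fun t => ∃ s ≤ t, groupId (groupKey N x) L s =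
      groupId (groupKey N x) L t ∧ lab (x s) ≠ lab (x t))).card : ℝ) ≤
      ε / (2 * (C * L + 1)) * T := (Nat.cast_le.2 hbad).trans hT1
  calc _ ≤ η * T + C * L * ((ε / (2 * (C * L + 1)) * T + T / N) + ε / (2 * (C * L + 1)) * T) := by
        gcongr
        · refine le_trans (le_of_eq ?_) (hkeys.trans (add_le_add_left hT2 _))
          congr!
        · refine le_trans (le_of_eq ?_) hbad'
          congr!
    _ = (η + C * L / N) * T + (C * L) * (ε / (C * L + 1)) * T := by
        field_simp
        ring
    _ ≤ (η + C * L / N) * T + ε * T := by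
        gcongr
        rw [mul_div_assoc', div_le_iff₀ (by positivity)]
        nlinarith
    _ = _ := by ring

end Expert

/-! ### Multiplicative weights over countably many experts -/

section Aggregation

/-- The mean loss at time `t` when expert `i ≤ t` is chosen with probability proportional to
`η i * w i`. -/
noncomputable def weightedLoss (η w l : ℕ → ℝ) (t : ℕ) : ℝ :=
  (∑ i ∈ Finset.range (t + 1), η i * w i * l i) / ∑ i ∈ Finset.range (t + 1), η i * w i

/-- The weights of the experts, updated multiplicatively. Expert `i` enters at time `i`. -/
noncomputable def expertWeight (η : ℕ → ℝ) (l : ℕ → ℕ → ℝ) : ℕ → ℕ → ℝ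
  | 0, i => (1 / 2) ^ (i + 1)
  | t + 1, i => if i ≤ t then expertWeight η l t i *
      (1 + η i * (weightedLoss η (expertWeight η l t) (l t) t - l t i))
      else expertWeight η l t i

theorem expertWeight_of_le (η : ℕ → ℝ) (l : ℕ → ℕ → ℝ) {t i : ℕ} (h : t ≤ i) :
    expertWeight η l t i = (1 / 2) ^ (i + 1) := by
  induction t with
  | zero => rfl
  | succ t ih =>
    rw [expertWeight, if_neg (by omega)]
    exact ih (by omega)

theorem expertWeight_congr (η : ℕ → ℝ) {l l' : ℕ → ℕ → ℝ} {t : ℕ} (h : ∀ s < t, l s = l' s) :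
    expertWeight η l t = expertWeight η l' t := by
  induction t with
  | zero => rfl
  | succ t ih =>
    funext i
    rw [expertWeight, expertWeight, ih fun s hs => h s (by omega), h t (by omega)]

variable {η : ℕ → ℝ} {l : ℕ → ℕ → ℝ} {C : ℝ}

theorem weightedLoss_mem_Icc {w l : ℕ → ℝ} (hη : ∀ i, 0 < η i) (hw : ∀ i, 0 < w i)
    (hl : ∀ i, 0 ≤ l i) (hC : ∀ i, l i ≤ C) (t : ℕ) :
    0 ≤ weightedLoss η w l t ∧ weightedLoss η w l t ≤ C := by
  have hpos : 0 < ∑ i ∈ Finset.range (t + 1), η i * w i :=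
    Finset.sum_pos (fun i _ => mul_pos (hη i) (hw i)) ⟨0, by simp⟩
  constructor
  · exact div_nonneg (Finset.sum_nonneg fun i _ =>
      mul_nonneg (mul_pos (hη i) (hw i)).le (hl i)) hpos.le
  · rw [weightedLoss, div_le_iff₀ hpos, Finset.mul_sum]
    refine Finset.sum_le_sum fun i _ => ?_
    rw [mul_comm C]
    exact mul_le_mul_of_nonneg_left (hC i) (mul_pos (hη i) (hw i)).le

theorem abs_rate_mul_sub_le (hη : ∀ i, 0 < η i) (hηC : ∀ i, η i * C ≤ 1 / 2) {a b : ℝ} (ha : 0 ≤ a)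
    (ha' : a ≤ C) (hb : 0 ≤ b) (hb' : b ≤ C) (i : ℕ) : |η i * (a - b)| ≤ 1 / 2 := by
  rw [abs_mul, abs_of_pos (hη i)]
  refine le_trans (mul_le_mul_of_nonneg_left ?_ (hη i).le) (hηC i)
  rw [abs_le]
  constructor <;> linarith

theorem expertWeight_pos (hη : ∀ i, 0 < η i) (hηC : ∀ i, η i * C ≤ 1 / 2)
    (hl : ∀ t i, 0 ≤ l t i) (hC : ∀ t i, l t i ≤ C) (t : ℕ) : ∀ i, 0 < expertWeight η l t i := by
  induction t with
  | zero =>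
    intro i
    rw [expertWeight]
    positivity
  | succ t ih =>
    intro i
    rw [expertWeight]
    split_ifs
    · refine mul_pos (ih i) ?_
      have hm := weightedLoss_mem_Icc hη ih (hl t) (hC t) t
      have := abs_le.1 (abs_rate_mul_sub_le hη hηC hm.1 hm.2 (hl t i) (hC t i) i)
      linarith [this.1]
    · exact ih i

/-- Sampling proportionally to `η i * w i` makes the weighted deviations `η i * w i * (m - l i)` sum
to zero, so an update preserves the total weight of the active experts. Expert `t`, on entering,
adds its initial weight. -/
theorem sum_expertWeight (hη : ∀ i, 0 < η i) (hηC : ∀ i, η i * C ≤ 1 / 2)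
    (hl : ∀ t i, 0 ≤ l t i) (hC : ∀ t i, l t i ≤ C) (T : ℕ) :
    ∑ i ∈ Finset.range T, expertWeight η l T i = ∑ i ∈ Finset.range T, (1 / 2 : ℝ) ^ (i + 1) := by
  induction T with
  | zero => simp
  | succ t ih =>
    have hpos : 0 < ∑ i ∈ Finset.range (t + 1), η i * expertWeight η l t i :=
      Finset.sum_pos (fun i _ => mul_pos (hη i) (expertWeight_pos hη hηC hl hC t i)) ⟨0, by simp⟩
    set m := weightedLoss η (expertWeight η l t) (l t) t with hm
    have hstep : ∀ i ∈ Finset.range (t + 1), expertWeight η l (t + 1) i =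
        expertWeight η l t i + (η i * expertWeight η l t i * m
          - η i * expertWeight η l t i * l t i) := by
      intro i hi
      rw [expertWeight, if_pos (by have := Finset.mem_range.1 hi; omega)]
      ring
    rw [Finset.sum_congr rfl hstep, Finset.sum_add_distrib, Finset.sum_sub_distrib,
      ← Finset.sum_mul, hm, weightedLoss, mul_div_cancel₀ _ hpos.ne', sub_self, add_zero,
      Finset.sum_range_succ, ih, expertWeight_of_le η l le_rfl, ← Finset.sum_range_succ]

theorem expertWeight_le_one (hη : ∀ i, 0 < η i) (hηC : ∀ i, η i * C ≤ 1 / 2)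
    (hl : ∀ t i, 0 ≤ l t i) (hC : ∀ t i, l t i ≤ C) (T i : ℕ) : expertWeight η l T i ≤ 1 := by
  by_cases h : i < T
  · calc expertWeight η l T i ≤ ∑ j ∈ Finset.range T, expertWeight η l T j :=
          Finset.single_le_sum (fun j _ => (expertWeight_pos hη hηC hl hC T j).le)
            (Finset.mem_range.2 h)
      _ = ∑ j ∈ Finset.range T, (1 / 2 : ℝ) ^ (j + 1) := sum_expertWeight hη hηC hl hC T
      _ = (1 / 2) * ∑ j ∈ Finset.range T, (1 / 2 : ℝ) ^ j := by
          rw [Finset.mul_sum]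
          exact Finset.sum_congr rfl fun j _ => by ring
      _ ≤ (1 / 2) * 2 := by
          gcongr
          exact sum_geometric_two_le _
      _ = 1 := by norm_num
  · rw [expertWeight_of_le η l (not_lt.1 h)]
    exact pow_le_one₀ (by norm_num) (by norm_num)

/-- From `log (1 + x) ≥ 1 - 1 / (1 + x)`: the difference of the two bounds is `x ^ 2 * (1 + 2 * x) /
(1 + x)`, nonnegative because `x ≥ -1 / 2`. In the regret bound the linear term adds up to the
regret and the square is the price. -/
theorem sub_two_mul_sq_le_log_one_add {x : ℝ} (hx : |x| ≤ 1 / 2) :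
    x - 2 * x ^ 2 ≤ Real.log (1 + x) := by
  have h1 := (abs_le.1 hx).1
  have hpos : 0 < 1 + x := by linarith
  refine le_trans ?_ (Real.one_sub_inv_le_log_of_pos hpos)
  rw [← sub_nonneg]
  have : 1 - (1 + x)⁻¹ - (x - 2 * x ^ 2) = x ^ 2 * (1 + 2 * x) / (1 + x) := by
    field_simp
    ring
  rw [this]
  apply div_nonneg _ hpos.le
  exact mul_nonneg (sq_nonneg x) (by linarith)

/-- The aggregate is almost as good as each expert. -/
theorem exists_aggregate_regret (hη : ∀ i, 0 < η i) (hηC : ∀ i, η i * C ≤ 1 / 2) (hC0 : 0 ≤ C)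
    (i : ℕ) : ∃ K : ℝ, ∀ l : ℕ → ℕ → ℝ, (∀ t i, 0 ≤ l t i) → (∀ t i, l t i ≤ C) → ∀ T : ℕ,
      ∑ t ∈ Finset.range T, (weightedLoss η (expertWeight η l t) (l t) t - l t i) ≤
        K + 2 * η i * C ^ 2 * T := by
  -- `C * i` pays for the rounds before expert `i` enters, the logarithm for its small initial
  -- weight. The constant does not depend on the losses.
  refine ⟨C * i - Real.log ((1 / 2) ^ (i + 1)) / η i, fun l hl hC T => ?_⟩
  have hw := expertWeight_pos hη hηC hl hC
  set m : ℕ → ℝ := fun t => weightedLoss η (expertWeight η l t) (l t) t with hm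
  have hmb : ∀ t, 0 ≤ m t ∧ m t ≤ C := fun t => weightedLoss_mem_Icc hη (hw t) (hl t) (hC t) t
  -- Each active round raises the log-weight by at least `η i` times its regret, up to the quadratic
  -- price. Since weights never exceed `1`, the total rise is bounded.
  have key : ∀ T : ℕ, η i * ∑ t ∈ Finset.range T, (m t - l t i) ≤ η i * (C * (min i T : ℕ)) +
      (Real.log (expertWeight η l T i) - Real.log ((1 / 2) ^ (i + 1))) +
        2 * (η i) ^ 2 * C ^ 2 * T := by
    intro T
    induction T with
    | zero => simp [expertWeight]
    | succ t ih =>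
      rw [Finset.sum_range_succ, mul_add]
      have hd : m t - l t i ≤ C := by linarith [(hmb t).2, hl t i]
      have hd' : -C ≤ m t - l t i := by linarith [(hmb t).1, hC t i]
      have hη2 : 0 ≤ 2 * (η i) ^ 2 * C ^ 2 := by positivity
      by_cases hit : i ≤ t
      · have hx := abs_rate_mul_sub_le hη hηC (hmb t).1 (hmb t).2 (hl t i) (hC t i) i
        have hlog := sub_two_mul_sq_le_log_one_add hx
        have hpos : 0 < 1 + η i * (m t - l t i) := by linarith [(abs_le.1 hx).1]
        rw [expertWeight, if_pos hit, Real.log_mul (hw t i).ne' hpos.ne',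
          min_eq_left (by omega : i ≤ t + 1)]
        rw [min_eq_left hit] at ih
        have hsq : (m t - l t i) ^ 2 ≤ C ^ 2 := sq_le_sq' hd' hd
        have h2 : 2 * (η i * (m t - l t i)) ^ 2 ≤ 2 * (η i) ^ 2 * C ^ 2 := by
          rw [mul_pow]
          nlinarith [sq_nonneg (η i)]
        push_cast
        linarith
      · rw [expertWeight, if_neg hit, min_eq_right (by omega : t + 1 ≤ i)]
        rw [min_eq_right (by omega : t ≤ i)] at ih
        have := mul_le_mul_of_nonneg_left hd (hη i).le
        push_cast
        linarith
  have hlogle : Real.log (expertWeight η l T i) ≤ 0 :=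
    Real.log_nonpos (hw T i).le (expertWeight_le_one hη hηC hl hC T i)
  have hmin : C * ((min i T : ℕ) : ℝ) ≤ C * i :=
    mul_le_mul_of_nonneg_left (Nat.cast_le.2 (min_le_left _ _)) hC0
  have h3 := key T
  have h4 := mul_le_mul_of_nonneg_left hmin (hη i).le
  refine le_of_mul_le_mul_left ?_ (hη i)
  have h5 : η i * (C * i - Real.log ((1 / 2) ^ (i + 1)) / η i + 2 * η i * C ^ 2 * T) =
      η i * (C * i) - Real.log ((1 / 2) ^ (i + 1)) + 2 * (η i) ^ 2 * C ^ 2 * T := by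
    have := (hη i).ne'
    field_simp
  rw [h5]
  linarith

end Aggregation

/-- Sampling an index `i ≤ t` with probability proportional to `q i`, from a uniform variable. -/
theorem exists_index_sampler (t : ℕ) : ∃ f : (ℕ → ℝ) → unitInterval → ℕ,
    Measurable (Function.uncurry f) ∧ ∀ q : ℕ → ℝ, (∀ i, 0 < q i) → ∀ F : ℕ → ℝ,
      ∫ u, F (f q u) = (∑ i ∈ Finset.range (t + 1), q i * F i) /
        ∑ i ∈ Finset.range (t + 1), q i := by
  set m : (ℕ → ℝ) → ENNReal := fun q => ∑ i ∈ Finset.range (t + 1), ENNReal.ofReal (q i) with hm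
  have hmm : Measurable m := by fun_prop
  set ν : (ℕ → ℝ) → Measure ℕ := fun q =>
    ∑ i ∈ Finset.range (t + 1), ENNReal.ofReal (q i) • Measure.dirac i with hν
  have hνapp : ∀ q (s : Set ℕ), ν q s =
      ∑ i ∈ Finset.range (t + 1), ENNReal.ofReal (q i) * Measure.dirac i s := by
    intro q s
    simp [hν, Measure.finsetSum_apply]
  have hνm : ∀ s, Measurable fun q => ν q s := by
    intro s
    simp only [hνapp]
    fun_prop
  have hνuniv : ∀ q, ν q Set.univ = m q := by
    intro q
    rw [hνapp]
    simp [hm]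
  -- The normalised weights form a Markov kernel, and `dirac 0` is only a default for weights with
  -- no positive mass. Realising the kernel by a uniform variable gives joint measurability in
  -- weights and seed.
  set κ : Kernel (ℕ → ℝ) ℕ :=
    { toFun := fun q => if m q = 0 then Measure.dirac 0 else (m q)⁻¹ • ν q
      measurable' := by
        refine Measurable.ite (hmm (measurableSet_singleton 0)) measurable_const ?_
        refine Measure.measurable_of_measurable_coe _ fun s _ => ?_
        simp only [Measure.smul_apply, smul_eq_mul]
        exact hmm.inv.mul (hνm s) } with hκ
  have hκapp : ∀ q, κ q = if m q = 0 then Measure.dirac 0 else (m q)⁻¹ • ν q := fun q => rfl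
  have hmtop : ∀ q, m q ≠ ⊤ := fun q => by simp [hm]
  have : IsMarkovKernel κ := by
    refine ⟨fun q => ⟨?_⟩⟩
    rw [hκapp]
    split_ifs with h
    · simp
    · rw [Measure.smul_apply, hνuniv, smul_eq_mul, ENNReal.inv_mul_cancel h (hmtop q)]
  obtain ⟨f, hf, hfκ⟩ := κ.exists_measurable_map_eq_unitInterval
  refine ⟨f, hf, fun q hq F => ?_⟩
  have hfq : Measurable (f q) := hf.comp measurable_prodMk_left
  have h1 : ∫ u, F (f q u) = ∫ i, F i ∂(κ q) := by
    rw [← hfκ q, integral_map hfq.aemeasurable (measurable_from_top).aestronglyMeasurable]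
  have hS : 0 < ∑ i ∈ Finset.range (t + 1), q i :=
    Finset.sum_pos (fun i _ => hq i) ⟨0, by simp⟩
  have hmq : m q = ENNReal.ofReal (∑ i ∈ Finset.range (t + 1), q i) :=
    (ENNReal.ofReal_sum_of_nonneg fun i _ => (hq i).le).symm
  have hm0 : m q ≠ 0 := by
    rw [hmq]
    simpa using hS
  rw [h1, hκapp, if_neg hm0, integral_smul_measure, integral_finsetSum_measure]
  · rw [ENNReal.toReal_inv, hmq, ENNReal.toReal_ofReal hS.le, smul_eq_mul, inv_mul_eq_div]
    congr 1
    refine Finset.sum_congr rfl fun i _ => ?_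
    rw [integral_smul_measure, integral_dirac, ENNReal.toReal_ofReal (hq i).le, smul_eq_mul]
  · intro i _
    refine Integrable.smul_measure ?_ ENNReal.ofReal_ne_top
    exact integrable_dirac (by simp)

/-! ### Adaptedness and measurability of the experts -/

section Adapted

variable {𝒳 𝒴 : Type u} [MeasurableSpace 𝒳] [MeasurableSpace.CountablyGenerated 𝒳]
  [MeasurableSpace 𝒴]

theorem groupPos_congr (N L : ℕ) {x x' : ℕ → 𝒳} {t : ℕ} (h : ∀ s ≤ t, x s = x' s) :
    groupPos N L x t = groupPos N L x' t := by
  unfold groupPos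
  rw [keyRank_congr (κ := groupKey N x) (κ' := groupKey N x')]
  intro s hs
  rw [groupKey_congr fun r hr => h r (hr.trans hs), groupKey_congr h]

-- For `j` below the position of `t`, the rank looked up is below that of `t`, so the member is a
-- genuine time before `t`. No response at time `t` or later is read.
omit [MeasurableSpace 𝒴] in
theorem groupPast_congr (N L : ℕ) {x x' : ℕ → 𝒳} {y y' : ℕ → 𝒴} {t : ℕ}
    (h : ∀ s ≤ t, x s = x' s) (hy : ∀ s < t, y s = y' s) {j : ℕ} (hj : j < groupPos N L x t) :
    groupPast N L x y t j = groupPast N L x' y' t j := by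
  have hk : ∀ s ≤ t, groupKey N x s = groupKey N x' s := fun s hs =>
    groupKey_congr fun r hr => h r (hr.trans hs)
  have hr : keyRank (groupKey N x) t = keyRank (groupKey N x') t :=
    keyRank_congr fun s hs => by rw [hk s hs, hk t le_rfl]
  have hlt : L * (keyRank (groupKey N x) t / L) + j < keyRank (groupKey N x) t := by
    have := Nat.div_add_mod (keyRank (groupKey N x) t) L
    unfold groupPos at hj
    omega
  unfold groupPast
  rw [hy _ (memberTime_lt hlt), ← hr,
    memberTime_congr (κ := groupKey N x) (κ' := groupKey N x')]
  intro s hs r hr'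
  rw [hk s hs, hk r hr']

theorem expertLoss_congr (ℓ : 𝒴 → 𝒴 → ℝ) (N L : ℕ) (g : OnlineRule PUnit.{u + 1} 𝒴)
    {x x' : ℕ → 𝒳} {y y' : ℕ → 𝒴} {t : ℕ} (h : ∀ s ≤ t, x s = x' s) (hy : ∀ s ≤ t, y s = y' s) :
    expertLoss ℓ N L g x y t = expertLoss ℓ N L g x' y' t := by
  unfold expertLoss
  rw [← groupPos_congr N L h, ← hy t le_rfl]
  exact g.blindLoss_congr ℓ (fun i hi => groupPast_congr N L h (fun s hs => hy s hs.le) hi) _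

variable [MeasurableEq 𝒳]

theorem measurable_groupPos (N L t : ℕ) :
    Measurable fun x : ℕ → 𝒳 => groupPos N L x t :=
  (measurable_from_top (f := fun n : ℕ => n % L)).comp
    (measurable_keyRank (measurableSet_groupKey_eq N) t)

theorem measurable_groupPast (N L t : ℕ) :
    Measurable fun p : (ℕ → 𝒳) × (ℕ → 𝒴) => groupPast N L p.1 p.2 t := by
  refine measurable_pi_iff.2 fun j => ?_
  have h1 : Measurable fun p : ℕ × (ℕ → 𝒴) => p.2 p.1 :=
    measurable_from_prod_countable_right fun n => measurable_pi_apply n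
  have h2 : Measurable fun p : ℕ × (ℕ → 𝒳) => memberTime (groupKey N p.2) t p.1 :=
    measurable_from_prod_countable_right fun n =>
      measurable_memberTime (measurableSet_groupKey_eq N) t n
  have h3 : ∀ c : (ℕ → 𝒳) → ℕ, Measurable c → Measurable fun p : (ℕ → 𝒳) × (ℕ → 𝒴) =>
      p.2 (memberTime (groupKey N p.1) t (c p.1)) := by
    intro c hc
    have h4 : Measurable fun x : ℕ → 𝒳 => (c x, x) := hc.prodMk measurable_id
    have h5 : Measurable fun x : ℕ → 𝒳 => memberTime (groupKey N x) t (c x) :=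
      Measurable.comp (g := fun p : ℕ × (ℕ → 𝒳) => memberTime (groupKey N p.2) t p.1)
        (f := fun x => (c x, x)) h2 h4
    have h7 : Measurable fun p : (ℕ → 𝒳) × (ℕ → 𝒴) => memberTime (groupKey N p.1) t (c p.1) :=
      Measurable.comp (g := fun x : ℕ → 𝒳 => memberTime (groupKey N x) t (c x))
        (f := fun p : (ℕ → 𝒳) × (ℕ → 𝒴) => p.1) h5 measurable_fst
    have h6 : Measurable fun p : (ℕ → 𝒳) × (ℕ → 𝒴) =>
        (memberTime (groupKey N p.1) t (c p.1), p.2) := h7.prodMk measurable_snd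
    exact Measurable.comp (g := fun p : ℕ × (ℕ → 𝒴) => p.2 p.1)
      (f := fun p : (ℕ → 𝒳) × (ℕ → 𝒴) => (memberTime (groupKey N p.1) t (c p.1), p.2)) h1 h6
  exact h3 (fun x => L * (keyRank (groupKey N x) t / L) + j)
    ((measurable_from_top (f := fun n : ℕ => L * (n / L) + j)).comp
      (measurable_keyRank (measurableSet_groupKey_eq N) t))

theorem OnlineRule.measurable_blindPredict (g : OnlineRule PUnit.{u + 1} 𝒴) (j : ℕ) :
    Measurable fun p : g.R × (ℕ → 𝒴) => g.blindPredict j p.1 p.2 := by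
  have h : Measurable fun p : g.R × (ℕ → 𝒴) =>
      (p.1, ((fun _ => PUnit.unit : Fin j → PUnit), (fun i : Fin j => p.2 i), PUnit.unit)) := by
    fun_prop
  exact (g.measurable_predict j).comp h

theorem OnlineRule.measurable_loss_blindPredict {ℓ : 𝒴 → 𝒴 → ℝ}
    (hℓ : Measurable fun p : 𝒴 × 𝒴 => ℓ p.1 p.2) (g : OnlineRule PUnit.{u + 1} 𝒴) (j : ℕ)
    (z : ℕ → 𝒴) (y : 𝒴) : Measurable fun r : g.R => ℓ (g.blindPredict j r z) y := by
  have h : Measurable fun r : g.R => g.blindPredict j r z :=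
    Measurable.comp (g := fun p : g.R × (ℕ → 𝒴) => g.blindPredict j p.1 p.2) (f := fun r => (r, z))
      (g.measurable_blindPredict j) measurable_prodMk_right
  exact Measurable.comp (g := fun p : 𝒴 × 𝒴 => ℓ p.1 p.2)
    (f := fun r => (g.blindPredict j r z, y)) hℓ (h.prodMk measurable_const)

theorem OnlineRule.measurable_blindLoss {ℓ : 𝒴 → 𝒴 → ℝ}
    (hℓ : Measurable fun p : 𝒴 × 𝒴 => ℓ p.1 p.2) (g : OnlineRule PUnit.{u + 1} 𝒴) (j : ℕ) :
    Measurable fun p : (ℕ → 𝒴) × 𝒴 => g.blindLoss ℓ j p.1 p.2 := by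
  have h1 : Measurable fun p : ((ℕ → 𝒴) × 𝒴) × g.R => ℓ (g.blindPredict j p.2 p.1.1) p.1.2 := by
    have h2 : Measurable fun p : ((ℕ → 𝒴) × 𝒴) × g.R => g.blindPredict j p.2 p.1.1 :=
      (g.measurable_blindPredict j).comp
        (measurable_snd.prodMk (measurable_fst.comp measurable_fst))
    exact hℓ.comp (h2.prodMk (measurable_snd.comp measurable_fst))
  exact (h1.stronglyMeasurable.integral_prod_right' (ν := g.law j)).measurable

theorem measurable_expertLoss {ℓ : 𝒴 → 𝒴 → ℝ} (hℓ : Measurable fun p : 𝒴 × 𝒴 => ℓ p.1 p.2)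
    (N L : ℕ) (g : OnlineRule PUnit.{u + 1} 𝒴) (t : ℕ) :
    Measurable fun p : (ℕ → 𝒳) × (ℕ → 𝒴) => expertLoss ℓ N L g p.1 p.2 t := by
  have h1 : Measurable fun p : ℕ × ((ℕ → 𝒴) × 𝒴) => g.blindLoss ℓ p.1 p.2.1 p.2.2 :=
    measurable_from_prod_countable_right fun j => g.measurable_blindLoss hℓ j
  have hpos : Measurable fun p : (ℕ → 𝒳) × (ℕ → 𝒴) => groupPos N L p.1 t :=
    (measurable_groupPos N L t).comp measurable_fst
  have hy : Measurable fun p : (ℕ → 𝒳) × (ℕ → 𝒴) => p.2 t := by fun_prop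
  exact h1.comp (hpos.prodMk ((measurable_groupPast N L t).prodMk hy))

end Adapted

theorem measurable_expertWeight {Ω : Type*} [MeasurableSpace Ω] (η : ℕ → ℝ)
    {l : Ω → ℕ → ℕ → ℝ} (hl : ∀ t i, Measurable fun ω => l ω t i) (t : ℕ) :
    ∀ i, Measurable fun ω => expertWeight η (l ω) t i := by
  induction t with
  | zero => exact fun i => measurable_const
  | succ t ih =>
    intro i
    simp only [expertWeight, weightedLoss]
    split_ifs
    · fun_prop
    · exact ih i

/-! ### The aggregated learning rule and its mean loss -/

section Aggregate

variable {𝒳 𝒴 : Type u} [MeasurableSpace 𝒳] [MeasurableSpace.CountablyGenerated 𝒳]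
  [MeasurableEq 𝒳] [MeasurableSpace 𝒴]

/-- The index chosen by `exists_index_sampler`. -/
noncomputable def indexSampler (t : ℕ) : (ℕ → ℝ) → unitInterval → ℕ :=
  (exists_index_sampler t).choose

theorem measurable_indexSampler (t : ℕ) : Measurable (Function.uncurry (indexSampler t)) :=
  (exists_index_sampler t).choose_spec.1

theorem integral_indexSampler (t : ℕ) {q : ℕ → ℝ} (hq : ∀ i, 0 < q i) (F : ℕ → ℝ) :
    ∫ u, F (indexSampler t q u) = (∑ i ∈ Finset.range (t + 1), q i * F i) /
        ∑ i ∈ Finset.range (t + 1), q i :=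
  (exists_index_sampler t).choose_spec.2 q hq F

variable (ℓ : 𝒴 → 𝒴 → ℝ) (N L : ℕ → ℕ) (g : ℕ → OnlineRule PUnit.{u + 1} 𝒴) (η : ℕ → ℝ)

/-- The losses of all experts. -/
noncomputable def expertLosses (x : ℕ → 𝒳) (y : ℕ → 𝒴) (t i : ℕ) : ℝ :=
  expertLoss ℓ (N i) (L i) (g i) x y t

/-- The private randomness of the aggregate: a uniform variable to choose the expert, and the
randomness of each expert at each position of a group. -/
abbrev AggregateRand : Type := unitInterval × (∀ p : ℕ × ℕ, (g p.1).R)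

/-- The prediction of the aggregate, on whole sequences. -/
noncomputable def aggregatePredict (t : ℕ) (r : AggregateRand g) (x : ℕ → 𝒳) (y : ℕ → 𝒴) : 𝒴 :=
  let i := indexSampler t (fun i => η i * expertWeight η (expertLosses ℓ N L g x y) t i) r.1
  (g i).blindPredict (groupPos (N i) (L i) x t) (r.2 (i, groupPos (N i) (L i) x t))
    (groupPast (N i) (L i) x y t)

-- The weights at time `t` involve losses at earlier times only, and the chosen expert reads only
-- the past of its group. So the prediction, though written with whole sequences, depends on the
-- admissible history.
omit [MeasurableEq 𝒳] in
theorem aggregatePredict_congr {t : ℕ} (r : AggregateRand g) {x x' : ℕ → 𝒳} {y y' : ℕ → 𝒴}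
    (h : ∀ s ≤ t, x s = x' s) (hy : ∀ s < t, y s = y' s) :
    aggregatePredict ℓ N L g η t r x y = aggregatePredict ℓ N L g η t r x' y' := by
  have hw : expertWeight η (expertLosses ℓ N L g x y) t =
      expertWeight η (expertLosses ℓ N L g x' y') t := by
    apply expertWeight_congr
    intro s hs
    funext i
    exact expertLoss_congr ℓ _ _ _ (fun r hr => h r (hr.trans hs.le))
      (fun r hr => hy r (hr.trans_lt hs))
  unfold aggregatePredict
  rw [hw]
  dsimp only
  rw [← groupPos_congr _ _ h]
  exact (g _).blindPredict_congr _ fun j hj => groupPast_congr _ _ h hy hj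

variable {ℓ} in
theorem measurable_aggregatePredict (hℓ : Measurable fun p : 𝒴 × 𝒴 => ℓ p.1 p.2) (t : ℕ) :
    Measurable fun p : AggregateRand g × (ℕ → 𝒳) × (ℕ → 𝒴) =>
      aggregatePredict ℓ N L g η t p.1 p.2.1 p.2.2 := by
  have hidx : Measurable fun p : AggregateRand g × (ℕ → 𝒳) × (ℕ → 𝒴) =>
      indexSampler t
        (fun i => η i * expertWeight η (expertLosses ℓ N L g p.2.1 p.2.2) t i) p.1.1 := by
    have hq : Measurable fun p : AggregateRand g × (ℕ → 𝒳) × (ℕ → 𝒴) =>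
        fun i => η i * expertWeight η (expertLosses ℓ N L g p.2.1 p.2.2) t i := by
      refine measurable_pi_iff.2 fun i => Measurable.const_mul ?_ _
      exact measurable_expertWeight η (l := fun p : AggregateRand g × (ℕ → 𝒳) × (ℕ → 𝒴) =>
        expertLosses ℓ N L g p.2.1 p.2.2)
        (fun s i => (measurable_expertLoss hℓ (N i) (L i) (g i) s).comp measurable_snd) t i
    exact (measurable_indexSampler t).comp (hq.prodMk (measurable_fst.comp measurable_fst))
  have hbody : Measurable fun p : ℕ × (AggregateRand g × (ℕ → 𝒳) × (ℕ → 𝒴)) =>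
      (g p.1).blindPredict (groupPos (N p.1) (L p.1) p.2.2.1 t)
        (p.2.1.2 (p.1, groupPos (N p.1) (L p.1) p.2.2.1 t))
        (groupPast (N p.1) (L p.1) p.2.2.1 p.2.2.2 t) := by
    refine measurable_from_prod_countable_right fun i => ?_
    have h1 : Measurable fun p : ℕ × ((∀ p : ℕ × ℕ, (g p.1).R) × (ℕ → 𝒴)) =>
        (g i).blindPredict p.1 (p.2.1 (i, p.1)) p.2.2 := by
      refine measurable_from_prod_countable_right fun j => ?_
      have hj : Measurable fun p : (∀ p : ℕ × ℕ, (g p.1).R) × (ℕ → 𝒴) => (p.1 (i, j), p.2) :=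
        ((measurable_pi_apply (i, j)).comp measurable_fst).prodMk measurable_snd
      exact ((g i).measurable_blindPredict j).comp hj
    have hpos : Measurable fun p : AggregateRand g × (ℕ → 𝒳) × (ℕ → 𝒴) =>
        groupPos (N i) (L i) p.2.1 t :=
      (measurable_groupPos (N i) (L i) t).comp (measurable_fst.comp measurable_snd)
    have hpast : Measurable fun p : AggregateRand g × (ℕ → 𝒳) × (ℕ → 𝒴) =>
        groupPast (N i) (L i) p.2.1 p.2.2 t :=
      (measurable_groupPast (N i) (L i) t).comp measurable_snd
    exact h1.comp (hpos.prodMk ((measurable_snd.comp measurable_fst).prodMk hpast))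
  exact hbody.comp (hidx.prodMk measurable_id)

/-- The history before time `t` and the instance at time `t`, extended to a whole sequence. -/
def extendHistory {𝒵 : Type*} {t : ℕ} (h : Fin t → 𝒵) (a : 𝒵) (s : ℕ) : 𝒵 :=
  if hs : s < t then h ⟨s, hs⟩ else a

theorem measurable_extendHistory {𝒵 : Type*} [MeasurableSpace 𝒵] (t : ℕ) :
    Measurable fun p : (Fin t → 𝒵) × 𝒵 => extendHistory p.1 p.2 := by
  refine measurable_pi_iff.2 fun s => ?_
  unfold extendHistory
  split_ifs <;> fun_prop

variable {ℓ} in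
/-- The aggregate of the experts, as an online learning rule. -/
noncomputable def aggregateRule [Nonempty 𝒴] (hℓ : Measurable fun p : 𝒴 × 𝒴 => ℓ p.1 p.2) :
    OnlineRule 𝒳 𝒴 where
  R := AggregateRand g
  law := fun _ => (volume : Measure unitInterval).prod
    (Measure.infinitePi fun p : ℕ × ℕ => (g p.1).law p.2)
  -- The padding puts the current instance at time `t`; the arbitrary padded responses are never
  -- read, by `aggregatePredict_congr`.
  predict := fun t r xh yh a => aggregatePredict ℓ N L g η t r (extendHistory xh a)
    (extendHistory yh (Classical.arbitrary 𝒴))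
  measurable_predict := fun t => by
    have hx : Measurable fun p : AggregateRand g × (Fin t → 𝒳) × (Fin t → 𝒴) × 𝒳 =>
        extendHistory p.2.1 p.2.2.2 :=
      Measurable.comp (g := fun p : (Fin t → 𝒳) × 𝒳 => extendHistory p.1 p.2)
        (f := fun p : AggregateRand g × (Fin t → 𝒳) × (Fin t → 𝒴) × 𝒳 => (p.2.1, p.2.2.2))
        (measurable_extendHistory t) ((measurable_fst.comp measurable_snd).prodMk
          (measurable_snd.comp (measurable_snd.comp measurable_snd)))
    have hy : Measurable fun p : AggregateRand g × (Fin t → 𝒳) × (Fin t → 𝒴) × 𝒳 =>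
        extendHistory p.2.2.1 (Classical.arbitrary 𝒴) :=
      Measurable.comp (g := fun p : (Fin t → 𝒴) × 𝒴 => extendHistory p.1 p.2)
        (f := fun p : AggregateRand g × (Fin t → 𝒳) × (Fin t → 𝒴) × 𝒳 =>
          (p.2.2.1, Classical.arbitrary 𝒴))
        (measurable_extendHistory t)
        ((measurable_fst.comp (measurable_snd.comp measurable_snd)).prodMk measurable_const)
    exact Measurable.comp (g := fun p : AggregateRand g × (ℕ → 𝒳) × (ℕ → 𝒴) =>
      aggregatePredict ℓ N L g η t p.1 p.2.1 p.2.2)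
      (f := fun p : AggregateRand g × (Fin t → 𝒳) × (Fin t → 𝒴) × 𝒳 =>
        (p.1, extendHistory p.2.1 p.2.2.2, extendHistory p.2.2.1 (Classical.arbitrary 𝒴)))
      (measurable_aggregatePredict N L g η hℓ t) (measurable_fst.prodMk (hx.prodMk hy))

variable {ℓ}

theorem aggregateRule_predict [Nonempty 𝒴] (hℓ : Measurable fun p : 𝒴 × 𝒴 => ℓ p.1 p.2) (t : ℕ)
    (r : AggregateRand g) (x : ℕ → 𝒳) (y : ℕ → 𝒴) :
    (aggregateRule (𝒳 := 𝒳) N L g η hℓ).predict t r (fun i : Fin t => x i) (fun i : Fin t => y i)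
      (x t) = aggregatePredict ℓ N L g η t r x y := by
  apply aggregatePredict_congr
  · intro s hs
    unfold extendHistory
    split_ifs with h
    · rfl
    · rw [le_antisymm hs (not_lt.1 h)]
  · intro s hs
    unfold extendHistory
    rw [dif_pos hs]

/-- The expected loss of the aggregate. -/
theorem integral_aggregateRule [Nonempty 𝒴] (hℓ : Measurable fun p : 𝒴 × 𝒴 => ℓ p.1 p.2) {C : ℝ}
    (h0 : ∀ a b, 0 ≤ ℓ a b) (hC : ∀ a b, ℓ a b ≤ C) (hη : ∀ i, 0 < η i)
    (hηC : ∀ i, η i * C ≤ 1 / 2) (t : ℕ) (x : ℕ → 𝒳) (y : ℕ → 𝒴) :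
    ∫ r, ℓ ((aggregateRule (𝒳 := 𝒳) N L g η hℓ).predict t r (fun i : Fin t => x i)
      (fun i : Fin t => y i) (x t)) (y t) ∂((aggregateRule (𝒳 := 𝒳) N L g η hℓ).law t) =
    weightedLoss η (expertWeight η (expertLosses ℓ N L g x y) t) (expertLosses ℓ N L g x y t) t := by
  have hl0 : ∀ t i, 0 ≤ expertLosses ℓ N L g x y t i := fun t i => (g i).blindLoss_nonneg h0 _ _ _
  have hlC : ∀ t i, expertLosses ℓ N L g x y t i ≤ C := fun t i => (g i).blindLoss_le h0 hC _ _ _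
  have hw := expertWeight_pos hη hηC hl0 hlC t
  have hstep : ∀ r : AggregateRand g, (aggregateRule (𝒳 := 𝒳) N L g η hℓ).predict t r
      (fun i : Fin t => x i) (fun i : Fin t => y i) (x t) =
      aggregatePredict ℓ N L g η t r x y := fun r => aggregateRule_predict N L g η hℓ t r x y
  change ∫ r : AggregateRand g, ℓ ((aggregateRule (𝒳 := 𝒳) N L g η hℓ).predict t r
      (fun i : Fin t => x i) (fun i : Fin t => y i) (x t)) (y t) ∂((volume : Measure unitInterval).prod
    (Measure.infinitePi fun p : ℕ × ℕ => (g p.1).law p.2)) = _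
  simp only [hstep]
  have hmeas : Measurable fun r : AggregateRand g =>
      ℓ (aggregatePredict ℓ N L g η t r x y) (y t) := by
    have h1 : Measurable fun r : AggregateRand g => aggregatePredict ℓ N L g η t r x y :=
      Measurable.comp (g := fun p : AggregateRand g × (ℕ → 𝒳) × (ℕ → 𝒴) =>
        aggregatePredict ℓ N L g η t p.1 p.2.1 p.2.2) (f := fun r => (r, x, y))
        (measurable_aggregatePredict N L g η hℓ t) (measurable_id.prodMk measurable_const)
    exact Measurable.comp (g := fun p : 𝒴 × 𝒴 => ℓ p.1 p.2)
      (f := fun r : AggregateRand g => (aggregatePredict ℓ N L g η t r x y, y t)) hℓ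
      (h1.prodMk measurable_const)
  have hint : Integrable (fun r : AggregateRand g =>
      ℓ (aggregatePredict ℓ N L g η t r x y) (y t)) ((volume : Measure unitInterval).prod
        (Measure.infinitePi fun p : ℕ × ℕ => (g p.1).law p.2)) := by
    refine Integrable.of_bound hmeas.aestronglyMeasurable C (Eventually.of_forall fun r => ?_)
    rw [Real.norm_eq_abs, abs_of_nonneg (h0 _ _)]
    exact hC _ _
  rw [integral_prod (fun r : AggregateRand g =>
      ℓ (aggregatePredict ℓ N L g η t r x y) (y t)) hint]
  -- Once `u` is fixed, the expert `i` and its position `j` are determined, and coordinate `(i, j)`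
  -- has the law that `g i` uses at step `j`. Randomness for all positions is drawn at each time
  -- because the law of the rule cannot depend on the history.
  have hinner : ∀ u : unitInterval, ∫ ρ, ℓ (aggregatePredict ℓ N L g η t (u, ρ) x y) (y t)
      ∂(Measure.infinitePi fun p : ℕ × ℕ => (g p.1).law p.2) =
      expertLosses ℓ N L g x y t (indexSampler t
        (fun i => η i * expertWeight η (expertLosses ℓ N L g x y) t i) u) := by
    intro u
    unfold aggregatePredict
    dsimp only
    set i := indexSampler t (fun i => η i * expertWeight η (expertLosses ℓ N L g x y) t i) u
    set j := groupPos (N i) (L i) x t with hj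
    have hmap := Measure.infinitePi_map_eval (fun p : ℕ × ℕ => (g p.1).law p.2) (i, j)
    rw [expertLosses, expertLoss, OnlineRule.blindLoss, ← hj]
    conv_rhs => rw [← hmap]
    exact (integral_map (φ := fun ρ : ∀ p : ℕ × ℕ, (g p.1).R => ρ (i, j))
      (measurable_pi_apply (i, j)).aemeasurable
      ((g i).measurable_loss_blindPredict hℓ j _ _).aestronglyMeasurable).symm
  simp only [hinner]
  rw [integral_indexSampler t (fun i => mul_pos (hη i) (hw i))]
  rfl

end Aggregate

/-! ### A law of large numbers for orthogonal differences -/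

section LawOfLargeNumbers

variable {Ω : Type*} [MeasurableSpace Ω] {P : Measure Ω} [IsProbabilityMeasure P]

theorem integrable_of_measurable_of_abs_le {f : Ω → ℝ} (hf : Measurable f) {c : ℝ}
    (hc : ∀ ω, |f ω| ≤ c) : Integrable f P :=
  Integrable.of_bound hf.aestronglyMeasurable c (Eventually.of_forall hc)

theorem abs_sum_range_le {D : ℕ → ℝ} {C : ℝ} (hD : ∀ t, |D t| ≤ C) (n : ℕ) :
    |∑ t ∈ Finset.range n, D t| ≤ n * C := by
  refine (Finset.abs_sum_le_sum_abs _ _).trans ((Finset.sum_le_sum fun t _ => hD t).trans ?_)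
  simp

theorem integral_sq_sum_le_of_orthogonal {D : ℕ → Ω → ℝ} {C : ℝ} (hC : 0 ≤ C)
    (hm : ∀ t, Measurable (D t)) (hD : ∀ t ω, |D t ω| ≤ C)
    (ho : ∀ s t, s < t → ∫ ω, D s ω * D t ω ∂P = 0) (n : ℕ) :
    ∫ ω, (∑ t ∈ Finset.range n, D t ω) ^ 2 ∂P ≤ n * C ^ 2 := by
  induction n with
  | zero => simp
  | succ n ih =>
    have hSm : Measurable fun ω => ∑ t ∈ Finset.range n, D t ω :=
      Finset.measurable_sum _ fun t _ => hm t
    have hmul : ∀ s, Integrable (fun ω => D s ω * D n ω) P := fun s =>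
      integrable_of_measurable_of_abs_le ((hm s).mul (hm n)) (c := C * C) fun ω => by
        rw [abs_mul]
        exact mul_le_mul (hD s ω) (hD n ω) (abs_nonneg _) hC
    have i1 : Integrable (fun ω => (∑ t ∈ Finset.range n, D t ω) ^ 2) P :=
      integrable_of_measurable_of_abs_le (hSm.pow_const 2) (c := (n * C) ^ 2) fun ω => by
        rw [abs_pow]
        exact pow_le_pow_left₀ (abs_nonneg _) (abs_sum_range_le (fun t => hD t ω) n) 2
    have i2 : Integrable (fun ω => 2 * ∑ s ∈ Finset.range n, D s ω * D n ω) P :=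
      (integrable_finsetSum _ fun s _ => hmul s).const_mul 2
    have i3 : Integrable (fun ω => D n ω ^ 2) P := by
      simpa [sq] using hmul n
    have h3 : ∫ ω, D n ω ^ 2 ∂P ≤ C ^ 2 := by
      have := integral_mono i3 (integrable_const (C ^ 2)) fun ω => by
        show D n ω ^ 2 ≤ C ^ 2
        rw [← sq_abs]
        exact pow_le_pow_left₀ (abs_nonneg _) (hD n ω) 2
      simpa using this
    have h2 : ∫ ω, 2 * ∑ s ∈ Finset.range n, D s ω * D n ω ∂P = 0 := by
      rw [integral_const_mul, integral_finsetSum _ fun s _ => hmul s,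
        Finset.sum_eq_zero fun s hs => ho s n (Finset.mem_range.1 hs), mul_zero]
    have hexp : ∀ ω, (∑ t ∈ Finset.range (n + 1), D t ω) ^ 2 =
        (∑ t ∈ Finset.range n, D t ω) ^ 2 + 2 * ∑ s ∈ Finset.range n, D s ω * D n ω +
          D n ω ^ 2 := by
      intro ω
      rw [Finset.sum_range_succ, ← Finset.sum_mul]
      ring
    simp only [hexp]
    have i12 : Integrable (fun ω => (∑ t ∈ Finset.range n, D t ω) ^ 2 +
        2 * ∑ s ∈ Finset.range n, D s ω * D n ω) P := i1.add i2
    rw [integral_add i12 i3, integral_add i1 i2, h2]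
    push_cast
    linarith

/-- The law of large numbers for bounded orthogonal differences. -/
theorem ae_tendsto_average_of_orthogonal {D : ℕ → Ω → ℝ} {C : ℝ} (hC : 0 ≤ C)
    (hm : ∀ t, Measurable (D t)) (hD : ∀ t ω, |D t ω| ≤ C)
    (ho : ∀ s t, s < t → ∫ ω, D s ω * D t ω ∂P = 0) :
    ∀ᵐ ω ∂P, ∀ ε : ℝ, 0 < ε → ∀ᶠ n : ℕ in atTop, ∑ t ∈ Finset.range n, D t ω ≤ ε * n := by
  -- Along the squares `n = (m + 1) ^ 2` the second moments of the averages are at most `C ^ 2 / (m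
  -- + 1) ^ 2`. They are summable, so these averages tend to `0` almost surely.
  set a : ℕ → Ω → ℝ := fun m ω =>
    (∑ t ∈ Finset.range ((m + 1) ^ 2), D t ω) / ((m + 1 : ℕ) : ℝ) ^ 2 with ha
  have ham : ∀ m, Measurable (a m) := fun m =>
    (Finset.measurable_sum _ fun t _ => hm t).div_const _
  have haC : ∀ m ω, |a m ω| ≤ C := by
    intro m ω
    have hpos : (0 : ℝ) < ((m + 1 : ℕ) : ℝ) ^ 2 := by positivity
    rw [ha, abs_div, abs_of_pos hpos, div_le_iff₀ hpos, mul_comm]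
    have := abs_sum_range_le (fun t => hD t ω) ((m + 1) ^ 2)
    push_cast at this ⊢
    exact this
  have hai : ∀ m, ∫⁻ ω, ENNReal.ofReal (a m ω ^ 2) ∂P ≤
      ENNReal.ofReal (C ^ 2 * (1 / ((m + 1 : ℕ) : ℝ) ^ 2)) := by
    intro m
    rw [← ofReal_integral_eq_lintegral_ofReal
      (integrable_of_measurable_of_abs_le ((ham m).pow_const 2) (c := C ^ 2) fun ω => by
        rw [abs_pow]
        exact pow_le_pow_left₀ (abs_nonneg _) (haC m ω) 2)
      (Eventually.of_forall fun ω => sq_nonneg _)]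
    apply ENNReal.ofReal_le_ofReal
    have h := integral_sq_sum_le_of_orthogonal (P := P) hC hm hD ho ((m + 1) ^ 2)
    have hpos : (0 : ℝ) < ((m + 1 : ℕ) : ℝ) ^ 2 := by positivity
    simp only [ha, div_pow]
    rw [integral_div, div_le_iff₀ (by positivity)]
    refine h.trans (le_of_eq ?_)
    push_cast at hpos ⊢
    field_simp
  have hsum : ∑' m, ENNReal.ofReal (C ^ 2 * (1 / ((m + 1 : ℕ) : ℝ) ^ 2)) ≠ ⊤ := by
    have hs : Summable fun m : ℕ => C ^ 2 * (1 / ((m + 1 : ℕ) : ℝ) ^ 2) :=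
      ((summable_nat_add_iff 1).2 (Real.summable_one_div_nat_pow.2 one_lt_two)).mul_left _
    exact hs.tsum_ofReal_ne_top
  have hfin : ∫⁻ ω, ∑' m, ENNReal.ofReal (a m ω ^ 2) ∂P ≠ ⊤ := by
    rw [lintegral_tsum fun m => ((ham m).pow_const 2).ennreal_ofReal.aemeasurable]
    exact ((ENNReal.tsum_le_tsum hai).trans_lt (lt_top_iff_ne_top.2 hsum)).ne
  have hmeas : Measurable fun ω => ∑' m, ENNReal.ofReal (a m ω ^ 2) :=
    Measurable.tsum fun m => ((ham m).pow_const 2).ennreal_ofReal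
  filter_upwards [ae_lt_top hmeas hfin] with ω hω ε hε
  have hlim := ENNReal.tendsto_atTop_zero_of_tsum_ne_top hω.ne
  have hev := hlim.eventually (ge_mem_nhds (ENNReal.ofReal_pos.2
    (show (0 : ℝ) < (ε / 2) ^ 2 by positivity)))
  -- Between consecutive squares there are at most `2 * m + 2` further terms; `4 * C / ε ≤ m` makes
  -- their contribution at most half of `ε * (m + 1) ^ 2`.
  obtain ⟨M, hM⟩ := eventually_atTop.1 (hev.and
    (eventually_ge_atTop ⌈4 * C / ε⌉₊))
  filter_upwards [eventually_ge_atTop ((M + 1) ^ 2)] with n hn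
  set q := Nat.sqrt n with hq
  have hMq : M + 1 ≤ q := Nat.le_sqrt'.2 hn
  obtain ⟨m, hm1⟩ : ∃ m, q = m + 1 := ⟨q - 1, by omega⟩
  obtain ⟨hm2, hm3⟩ := hM m (by omega)
  have ham : a m ω ≤ ε / 2 := by
    rw [ENNReal.ofReal_le_ofReal_iff (by positivity)] at hm2
    exact le_of_sq_le_sq hm2 (by positivity)
  have hmC : 4 * C / ε ≤ m := Nat.ceil_le.1 hm3
  rw [div_le_iff₀ hε] at hmC
  have hlow : (m + 1) ^ 2 ≤ n := hm1 ▸ Nat.sqrt_le' n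
  have hup : n < (m + 1 + 1) ^ 2 := hm1 ▸ Nat.lt_succ_sqrt' n
  have hsplit : ∑ t ∈ Finset.range n, D t ω = ∑ t ∈ Finset.range ((m + 1) ^ 2), D t ω +
      ∑ t ∈ Finset.Ico ((m + 1) ^ 2) n, D t ω := (Finset.sum_range_add_sum_Ico _ hlow).symm
  have h1 : ∑ t ∈ Finset.range ((m + 1) ^ 2), D t ω ≤ ε / 2 * ((m : ℝ) + 1) ^ 2 := by
    have hpos : (0 : ℝ) < ((m + 1 : ℕ) : ℝ) ^ 2 := by positivity
    have := (div_le_iff₀ hpos).1 ham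
    push_cast at this
    exact this
  have h2 : ∑ t ∈ Finset.Ico ((m + 1) ^ 2) n, D t ω ≤ (2 * (m : ℝ) + 2) * C := by
    calc _ ≤ ∑ t ∈ Finset.Ico ((m + 1) ^ 2) n, C :=
          Finset.sum_le_sum fun t _ => (le_abs_self _).trans (hD t ω)
      _ = ((n - (m + 1) ^ 2 : ℕ) : ℝ) * C := by simp
      _ ≤ (2 * (m : ℝ) + 2) * C := by
          refine mul_le_mul_of_nonneg_right ?_ hC
          have : n - (m + 1) ^ 2 ≤ 2 * m + 2 := by
            have : (m + 1 + 1) ^ 2 = (m + 1) ^ 2 + (2 * m + 3) := by ring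
            omega
          exact_mod_cast this
  have hlow' : ((m : ℝ) + 1) ^ 2 ≤ n := by exact_mod_cast hlow
  have hm0 : (0 : ℝ) ≤ m := Nat.cast_nonneg _
  rw [hsplit]
  nlinarith

/-- A centred function of an independent variable is orthogonal to every function of the rest. -/
theorem integral_mul_centered_eq_zero {R H : Type*} [MeasurableSpace R] [MeasurableSpace H]
    {r : Ω → R} {h : Ω → H} (hr : Measurable r) (hh : Measurable h) (hind : IndepFun r h P)
    {Φ : R × H → ℝ} (hΦ : Measurable Φ) {C : ℝ} (hΦC : ∀ p, |Φ p| ≤ C) {G : H → ℝ}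
    (hG : Measurable G) {C' : ℝ} (hGC : ∀ p, |G p| ≤ C') :
    ∫ ω, G (h ω) * (Φ (r ω, h ω) - ∫ r', Φ (r', h ω) ∂(P.map r)) ∂P = 0 := by
  have : IsProbabilityMeasure (P.map r) := Measure.isProbabilityMeasure_map hr.aemeasurable
  have : IsProbabilityMeasure (P.map h) := Measure.isProbabilityMeasure_map hh.aemeasurable
  have hprod := (indepFun_iff_map_prod_eq_prod_map_map hr.aemeasurable hh.aemeasurable).1 hind
  have hmean : Measurable fun b : H => ∫ r', Φ (r', b) ∂(P.map r) :=
    (hΦ.stronglyMeasurable.integral_prod_left').measurable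
  have hsec : ∀ b, Integrable (fun r' => Φ (r', b)) (P.map r) := fun b =>
    integrable_of_measurable_of_abs_le (hΦ.comp measurable_prodMk_right) fun r' => hΦC _
  have hmeanC : ∀ b, |∫ r', Φ (r', b) ∂(P.map r)| ≤ C := fun b => by
    have := norm_integral_le_of_norm_le_const (μ := P.map r) (f := fun r' => Φ (r', b)) (C := C)
      (Eventually.of_forall fun r' => hΦC _)
    simpa using this
  set F : R × H → ℝ := fun p => G p.2 * (Φ p - ∫ r', Φ (r', p.2) ∂(P.map r)) with hF
  have hFm : Measurable F :=
    (hG.comp measurable_snd).mul (hΦ.sub (hmean.comp measurable_snd))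
  have hFi : Integrable F ((P.map r).prod (P.map h)) :=
    integrable_of_measurable_of_abs_le hFm (c := C' * (C + C)) fun p => by
      rw [hF, abs_mul]
      refine mul_le_mul (hGC _) ((abs_sub _ _).trans (add_le_add (hΦC p) (hmeanC _)))
        (abs_nonneg _) ((abs_nonneg _).trans (hGC p.2))
  calc _ = ∫ ω, F (r ω, h ω) ∂P := rfl
    _ = ∫ p, F p ∂(P.map fun ω => (r ω, h ω)) :=
        (integral_map (hr.prodMk hh).aemeasurable hFm.aestronglyMeasurable).symm
    _ = ∫ p, F p ∂((P.map r).prod (P.map h)) := by rw [hprod]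
    _ = ∫ b, ∫ r', F (r', b) ∂(P.map r) ∂(P.map h) := integral_prod_symm F hFi
    _ = 0 := by
        refine integral_eq_zero_of_ae (Eventually.of_forall fun b => ?_)
        simp only [hF, Pi.zero_apply]
        rw [integral_const_mul, integral_sub (hsec b) (integrable_const _)]
        simp

end LawOfLargeNumbers

/-! ### Actual loss versus mean loss along a run -/

section Runs

variable {𝒳 𝒴 : Type u} [MeasurableSpace 𝒳] [MeasurableSpace 𝒴]

/-- The expected loss of a rule at time `t`, given the instances and the values. -/
noncomputable def OnlineRule.meanLoss (ℓ : 𝒴 → 𝒴 → ℝ) (f : OnlineRule 𝒳 𝒴) (x : ℕ → 𝒳)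
    (y : ℕ → 𝒴) (t : ℕ) : ℝ :=
  ∫ r, ℓ (f.predict t r (fun i : Fin t => x i) (fun i : Fin t => y i) (x t)) (y t) ∂(f.law t)

/-- Along a run, the average loss is asymptotically at most the average expected loss. -/
theorem IsRun.ae_sum_loss_sub_meanLoss_le {ℓ : 𝒴 → 𝒴 → ℝ}
    (hℓ : Measurable fun p : 𝒴 × 𝒴 => ℓ p.1 p.2) {C : ℝ} (h0 : ∀ a b, 0 ≤ ℓ a b)
    (hC : ∀ a b, ℓ a b ≤ C) (hC0 : 0 ≤ C) {f : OnlineRule 𝒳 𝒴} {M : AdversarialMechanism 𝒳 𝒴 f.R}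
    {Ω' : Type u} [MeasurableSpace Ω'] {Q : Measure Ω'} [IsProbabilityMeasure Q]
    {ω : Ω' → M.Ω} {r : ℕ → Ω' → f.R} {Y : ℕ → Ω' → 𝒴} (hrun : IsRun f M Q ω r Y) :
    ∀ᵐ w ∂Q, ∀ ε : ℝ, 0 < ε → ∀ᶠ n : ℕ in atTop, ∑ t ∈ Finset.range n,
      (ℓ (f.predict t (r t w) (fun i : Fin t => M.X i (ω w)) (fun i : Fin t => Y i w)
        (M.X t (ω w))) (Y t w) - f.meanLoss ℓ (fun t => M.X t (ω w)) (fun t => Y t w) t) ≤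
        ε * n := by
  set H : ℕ → Type u := fun t => M.Ω × (Fin (t + 1) → 𝒴) with hH
  set Φ : (t : ℕ) → f.R × H t → ℝ := fun t p => ℓ (f.predict t p.1 (fun i : Fin t => M.X i p.2.1)
    (fun i : Fin t => p.2.2 i.castSucc) (M.X t p.2.1)) (p.2.2 (Fin.last t)) with hΦ
  have hX := M.measurable_X
  have hΦm : ∀ t, Measurable (Φ t) := by
    intro t
    have h1 : Measurable fun p : f.R × H t => (p.1, (fun i : Fin t => M.X i p.2.1),
        (fun i : Fin t => p.2.2 i.castSucc), M.X t p.2.1) := by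
      refine measurable_fst.prodMk (Measurable.prodMk ?_ (Measurable.prodMk ?_ ?_))
      · exact measurable_pi_iff.2 fun i => (hX i).comp (measurable_fst.comp measurable_snd)
      · exact measurable_pi_iff.2 fun i =>
          (measurable_pi_apply _).comp (measurable_snd.comp measurable_snd)
      · exact (hX t).comp (measurable_fst.comp measurable_snd)
    have h2 : Measurable fun p : f.R × H t => p.2.2 (Fin.last t) :=
      (measurable_pi_apply _).comp (measurable_snd.comp measurable_snd)
    exact hℓ.comp (((f.measurable_predict t).comp h1).prodMk h2)
  have hΦC : ∀ t p, |Φ t p| ≤ C := fun t p => by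
    rw [abs_of_nonneg (h0 _ _)]
    exact hC _ _
  set m : (t : ℕ) → H t → ℝ := fun t b => ∫ r', Φ t (r', b) ∂(f.law t) with hm
  have hmm : ∀ t, Measurable (m t) := fun t =>
    ((hΦm t).stronglyMeasurable.integral_prod_left' (μ := f.law t)).measurable
  have hmC : ∀ t b, |m t b| ≤ C := fun t b => by
    have := norm_integral_le_of_norm_le_const (μ := f.law t) (f := fun r' => Φ t (r', b)) (C := C)
      (Eventually.of_forall fun r' => hΦC t _)
    simpa using this
  set b : (t : ℕ) → Ω' → H t := fun t w => (ω w, fun i : Fin (t + 1) => Y i w) with hb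
  have hbm : ∀ t, Measurable (b t) := fun t =>
    hrun.measurable_outcome.prodMk (measurable_pi_iff.2 fun i => hrun.measurable_resp i)
  refine ae_tendsto_average_of_orthogonal (P := Q)
    (D := fun t w => Φ t (r t w, b t w) - m t (b t w)) (C := C + C) (by positivity) ?_ ?_ ?_
  · exact fun t => ((hΦm t).comp ((hrun.measurable_rand t).prodMk (hbm t))).sub
      ((hmm t).comp (hbm t))
  · exact fun t w => (abs_sub _ _).trans (add_le_add (hΦC t _) (hmC t _))
  · intro s t hst
    -- The difference at time `s < t` is a function of the outcome, the randomness before `t` and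
    -- the responses up to `t`. `r t` is independent of all of these jointly, hence the
    -- orthogonality.
    set H' := M.Ω × (Fin t → f.R) × (Fin (t + 1) → 𝒴) with hH'
    set toH : H' → H t := fun p => (p.1, p.2.2) with htoH
    have htoHm : Measurable toH := measurable_fst.prodMk (measurable_snd.comp measurable_snd)
    set past : H' → f.R × H s := fun p => (p.2.1 ⟨s, hst⟩,
      (p.1, fun i : Fin (s + 1) => p.2.2 ⟨i, by have := i.2; omega⟩)) with hpast
    have hpastm : Measurable past := by
      refine Measurable.prodMk ?_ (measurable_fst.prodMk (measurable_pi_iff.2 fun i => ?_))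
      · exact (measurable_pi_apply _).comp (measurable_fst.comp measurable_snd)
      · exact (measurable_pi_apply _).comp (measurable_snd.comp measurable_snd)
    have hhm : Measurable fun w => (ω w, (fun i : Fin t => r i w),
        (fun i : Fin (t + 1) => Y i w)) :=
      hrun.measurable_outcome.prodMk
        ((measurable_pi_iff.2 fun i : Fin t => hrun.measurable_rand i).prodMk
          (measurable_pi_iff.2 fun i : Fin (t + 1) => hrun.measurable_resp i))
    have key := integral_mul_centered_eq_zero (P := Q) (hrun.measurable_rand t) hhm
      (hrun.indep_rand t) (Φ := fun p => Φ t (p.1, toH p.2))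
      ((hΦm t).comp (measurable_fst.prodMk (htoHm.comp measurable_snd))) (fun p => hΦC t _)
      (G := fun p => Φ s (past p) - m s (past p).2)
      (((hΦm s).comp hpastm).sub ((hmm s).comp (measurable_snd.comp hpastm)))
      (C' := C + C) (fun p => (abs_sub _ _).trans (add_le_add (hΦC s _) (hmC s _)))
    rw [hrun.law_rand t] at key
    exact key

end Runs

/-- The total mass of `Q` is read off from the image under `r 0`, a probability law. -/
theorem IsRun.isProbabilityMeasure {𝒳 𝒴 : Type u} [MeasurableSpace 𝒳] [MeasurableSpace 𝒴]
    {f : OnlineRule 𝒳 𝒴} {M : AdversarialMechanism 𝒳 𝒴 f.R} {Ω' : Type u} [MeasurableSpace Ω']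
    {Q : Measure Ω'} {ω : Ω' → M.Ω} {r : ℕ → Ω' → f.R} {Y : ℕ → Ω' → 𝒴}
    (hrun : IsRun f M Q ω r Y) : IsProbabilityMeasure Q := by
  refine ⟨?_⟩
  have h : (Q.map (r 0)) Set.univ = 1 := by
    rw [hrun.law_rand 0]
    exact measure_univ
  rwa [Measure.map_apply (hrun.measurable_rand 0) MeasurableSet.univ, Set.preimage_univ] at h

theorem limsup_coe_average_le {S : ℕ → ℝ} {c : ℝ}
    (h : ∀ ε : ℝ, 0 < ε → ∀ᶠ T : ℕ in atTop, S T ≤ (c + ε) * T) :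
    limsup (fun T : ℕ => (((1 / (T : ℝ)) * S T : ℝ) : EReal)) atTop ≤ (c : EReal) := by
  refine EReal.le_of_forall_lt_iff_le.1 fun z hz => ?_
  have hz' : c < z := EReal.coe_lt_coe_iff.1 hz
  refine limsup_le_of_le (by isBoundedDefault) ?_
  filter_upwards [h (z - c) (sub_pos.2 hz'), eventually_gt_atTop 0] with T hT hT0
  rw [EReal.coe_le_coe_iff, one_div, inv_mul_le_iff₀ (Nat.cast_pos.2 hT0)]
  linarith

/-! ### Sufficiency: one rule for all processes in `SMV` -/

section Universal

variable {𝒴 : Type u} [MeasurableSpace 𝒴] {ℓ : 𝒴 → 𝒴 → ℝ} {C : ℝ}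

/-- The guarantee of `FTiME`, in terms of the expected losses at the successive times. -/
theorem FTiME.exists_blindLoss (hF : FTiME ℓ) (hℓ : Measurable fun p : 𝒴 × 𝒴 => ℓ p.1 p.2)
    (h0 : ∀ a b, 0 ≤ ℓ a b) (hC : ∀ a b, ℓ a b ≤ C) {η : ℝ} (hη : 0 < η) :
    ∃ L : ℕ, 0 < L ∧ ∃ g : OnlineRule PUnit.{u + 1} 𝒴, ∀ (z : ℕ → 𝒴) (v : 𝒴),
      ∑ j ∈ Finset.range L, (g.blindLoss ℓ j z (z j) - ℓ v (z j)) ≤ η * L := by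
  obtain ⟨L, hL, g, hg⟩ := hF η hη
  refine ⟨L, hL, g, fun z v => ?_⟩
  have hint : ∀ j, Integrable (fun r => ℓ (g.blindPredict j r z) (z j)) (g.law j) := fun j =>
    integrable_of_measurable_of_abs_le (g.measurable_loss_blindPredict hℓ j z (z j)) (c := C)
      fun r => by
        rw [abs_of_nonneg (h0 _ _)]
        exact hC _ _
  have hmp := measurePreserving_eval_infinitePi g.law
  have hint' : ∀ j, Integrable (fun r : ℕ → g.R => ℓ (g.blindPredict j (r j) z) (z j))
      (Measure.infinitePi g.law) := fun j => (hmp j).integrable_comp_of_integrable (hint j)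
  have hval : ∀ j, ∫ r : ℕ → g.R, ℓ (g.blindPredict j (r j) z) (z j) ∂(Measure.infinitePi g.law) =
      g.blindLoss ℓ j z (z j) := by
    intro j
    rw [OnlineRule.blindLoss, ← (hmp j).map_eq]
    exact (integral_map (φ := fun r : ℕ → g.R => r j)
      (f := fun r : g.R => ℓ (g.blindPredict j r z) (z j)) (hmp j).measurable.aemeasurable
      (g.measurable_loss_blindPredict hℓ j z (z j)).aestronglyMeasurable).symm
  have h := hg z v
  have hsum : ∫ r : ℕ → g.R, ∑ t ∈ Finset.range L, (ℓ (g.predict t (r t) (fun _ => PUnit.unit)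
      (fun i : Fin t => z i) PUnit.unit) (z t) - ℓ v (z t)) ∂(Measure.infinitePi g.law) =
      ∑ j ∈ Finset.range L, (g.blindLoss ℓ j z (z j) - ℓ v (z j)) := by
    rw [integral_finsetSum]
    · refine Finset.sum_congr rfl fun j _ => ?_
      change ∫ r : ℕ → g.R, (ℓ (g.blindPredict j (r j) z) (z j) - ℓ v (z j))
        ∂(Measure.infinitePi g.law) = _
      rw [← hval j, integral_sub (hint' j) (integrable_const _)]
      simp
    · exact fun j _ => (hint' j).sub (integrable_const _)
  rw [hsum, one_div, inv_mul_le_iff₀ (Nat.cast_pos.2 hL)] at h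
  linarith

end Universal

section Universal

variable {𝒳 𝒴 : Type u} [MeasurableSpace 𝒳] [MetricSpace 𝒴] [TopologicalSpace.SeparableSpace 𝒴]
  [MeasurableSpace 𝒴] [BorelSpace 𝒴] {ℓ : 𝒴 → 𝒴 → ℝ} {C : ℝ}

/-- A measurable predictor is uniformly approximated by one with countably many values. -/
theorem exists_countable_approximation [Nonempty 𝒴] {h : 𝒳 → 𝒴} (hh : Measurable h) {ρ : ℝ}
    (hρ : 0 < ρ) : ∃ lab : 𝒳 → ℕ, Measurable lab ∧ ∃ v : ℕ → 𝒴, ∀ a, dist (v (lab a)) (h a) < ρ := by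
  classical
  have hex : ∀ a, ∃ n, dist (TopologicalSpace.denseSeq 𝒴 n) (h a) < ρ := by
    intro a
    obtain ⟨n, hn⟩ := (TopologicalSpace.denseRange_denseSeq 𝒴).exists_dist_lt (h a) hρ
    exact ⟨n, by rwa [dist_comm]⟩
  refine ⟨fun a => Nat.find (hex a), measurable_find hex fun n => ?_,
    TopologicalSpace.denseSeq 𝒴, fun a => Nat.find_spec (hex a)⟩
  have hd : Measurable fun a => dist (TopologicalSpace.denseSeq 𝒴 n) (h a) :=
    (Continuous.measurable (by fun_prop : Continuous fun b =>
      dist (TopologicalSpace.denseSeq 𝒴 n) b)).comp hh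
  exact measurableSet_lt hd measurable_const

variable [MeasurableSpace.CountablyGenerated 𝒳] [MeasurableSpace.SeparatesPoints 𝒳]
  [MeasurableEq 𝒳]

/-- One rule is universally consistent under all processes in `SMV`. -/
theorem exists_universallyConsistent_of_FTiME [Nonempty 𝒴] (hF : FTiME ℓ)
    (hℓ : Measurable fun p : 𝒴 × 𝒴 => ℓ p.1 p.2) (h0 : ∀ a b, 0 ≤ ℓ a b) (hC : ∀ a b, ℓ a b ≤ C)
    (hU : ∀ δ : ℝ, 0 < δ → ∃ ρ : ℝ, 0 < ρ ∧ ∀ a b y, dist a b < ρ → ℓ a y ≤ ℓ b y + δ) :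
    ∃ f : OnlineRule 𝒳 𝒴, ∀ μ ∈ SMV 𝒳, UniversallyConsistent ℓ f μ := by
  have hC0 : 0 ≤ C := (h0 (Classical.arbitrary 𝒴) (Classical.arbitrary 𝒴)).trans (hC _ _)
  have hpos : ∀ i : ℕ, (0 : ℝ) < 1 / ((i : ℝ) + 1) := fun i => Nat.one_div_pos_of_nat
  choose L hL g hg using fun i : ℕ => hF.exists_blindLoss hℓ h0 hC (hpos i)
  -- With this `N`, the cost `C * L / N` of unfinished blocks of point keys is `C / (i + 1)`. The
  -- rates below tend to `0` and satisfy `η i * C ≤ 1 / 2`.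
  set N : ℕ → ℕ := fun i => L i * (i + 1) with hN
  set η : ℕ → ℝ := fun i => 1 / (2 * (C + 1)) * (1 / ((i : ℝ) + 1)) with hη
  have hη0 : ∀ i, 0 < η i := fun i => mul_pos (by positivity) (hpos i)
  have hle1 : ∀ i : ℕ, 1 / ((i : ℝ) + 1) ≤ 1 := fun i => by
    rw [div_le_one (by positivity)]
    linarith [(Nat.cast_nonneg i : (0 : ℝ) ≤ i)]
  have hηle : ∀ i, η i * C ≤ 1 / 2 * (1 / ((i : ℝ) + 1)) := by
    intro i
    have : 1 / (2 * (C + 1)) * C ≤ 1 / 2 := by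
      rw [div_mul_eq_mul_div, div_le_iff₀ (by positivity)]
      linarith
    calc η i * C = (1 / (2 * (C + 1)) * C) * (1 / ((i : ℝ) + 1)) := by rw [hη]; ring
      _ ≤ _ := mul_le_mul_of_nonneg_right this (hpos i).le
  have hηC : ∀ i, η i * C ≤ 1 / 2 := fun i => (hηle i).trans (by linarith [hle1 i])
  refine ⟨aggregateRule N L g η hℓ, fun μ hμ M hM Ω' _ Q ω r Y hrun _ h hh => ?_⟩
  have := hrun.isProbabilityMeasure
  have hxm : Measurable fun w t => M.X t (ω w) :=
    measurable_pi_iff.2 fun t => (M.measurable_X t).comp hrun.measurable_outcome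
  have hmap : Q.map (fun w t => M.X t (ω w)) = (μ : Measure (ℕ → 𝒳)) := by
    rw [← hM, AdversarialMechanism.instanceLaw, ← hrun.law_outcome,
      Measure.map_map (measurable_pi_iff.2 fun t => M.measurable_X t) hrun.measurable_outcome]
    rfl
  choose ρ hρ hρU using fun i : ℕ => hU (1 / ((i : ℝ) + 1)) (hpos i)
  choose lab hlab v hv using fun i : ℕ => exists_countable_approximation hh (hρ i)
  have hexp := fun i : ℕ => ae_expert_regret hμ h0 hC hC0
    (N := N i) (Nat.mul_pos (hL i) (Nat.succ_pos i)) (hL i) (hpos i).le (g i) (hg i) (hlab i) (v i)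
  -- The event is one about instances only, so it transfers through their law and can then be
  -- applied to the responses of the run.
  have hexpQ : ∀ᵐ w ∂Q, ∀ i : ℕ, ∀ y : ℕ → 𝒴, ∀ ε : ℝ, 0 < ε → ∀ᶠ T : ℕ in atTop,
      ∑ t ∈ Finset.range T, (expertLoss ℓ (N i) (L i) (g i) (fun t => M.X t (ω w)) y t -
        ℓ (v i (lab i (M.X t (ω w)))) (y t)) ≤
        (1 / ((i : ℝ) + 1) + C * L i / N i + ε) * T := by
    have := ae_all_iff.2 hexp
    rw [← hmap] at this
    exact ae_of_ae_map hxm.aemeasurable this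
  filter_upwards [hexpQ, hrun.ae_sum_loss_sub_meanLoss_le hℓ h0 hC hC0] with w hw1 hw2
  set x : ℕ → 𝒳 := fun t => M.X t (ω w) with hx
  set y : ℕ → 𝒴 := fun t => Y t w with hy
  have hmean : ∀ t, (aggregateRule (𝒳 := 𝒳) N L g η hℓ).meanLoss ℓ x y t =
      weightedLoss η (expertWeight η (expertLosses ℓ N L g x y) t)
        (expertLosses ℓ N L g x y t) t := fun t =>
    integral_aggregateRule N L g η hℓ h0 hC hη0 hηC t x y
  refine (limsup_coe_average_le (c := 0) fun ε hε => ?_)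
  -- Per unit of time the errors are `(2 + C) * κ` for the expert, `κ + C * κ` for the aggregation,
  -- `κ` for the fluctuation of the loss and `κ` for the approximation of `h`: less than `(3 + 2 * C
  -- + 3) * κ`.
  obtain ⟨i, hi⟩ := exists_nat_one_div_lt (show 0 < ε / (3 + 2 * C + 3) by positivity)
  set κ : ℝ := 1 / ((i : ℝ) + 1) with hκ
  have hκ0 : 0 < κ := hpos i
  obtain ⟨K, hK⟩ := exists_aggregate_regret hη0 hηC hC0 i
  have hK' := hK (expertLosses ℓ N L g x y) (fun t i => (g i).blindLoss_nonneg h0 _ _ _)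
    (fun t i => (g i).blindLoss_le h0 hC _ _ _)
  filter_upwards [hw1 i y κ hκ0, hw2 κ hκ0, eventually_ge_atTop ⌈K / κ⌉₊] with T hT1 hT2 hT3
  have hT4 : K ≤ κ * T := by
    have := Nat.ceil_le.1 hT3
    rw [div_le_iff₀ hκ0] at this
    linarith
  have hCLN : C * L i / N i = C * κ := by
    have h1 : (L i : ℝ) ≠ 0 := Nat.cast_ne_zero.2 (hL i).ne'
    rw [hN, hκ]
    push_cast
    field_simp
  have hKT := hK' T
  have hrate : 2 * η i * C ^ 2 * T ≤ C * κ * T := by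
    refine mul_le_mul_of_nonneg_right ?_ (Nat.cast_nonneg _)
    have := mul_le_mul_of_nonneg_left (hηle i) hC0
    nlinarith
  have happ : ∑ t ∈ Finset.range T, (ℓ (v i (lab i (x t))) (y t) - ℓ (h (x t)) (y t)) ≤ κ * T := by
    calc _ ≤ ∑ t ∈ Finset.range T, κ := Finset.sum_le_sum fun t _ => by
            have := hρU i _ _ (y t) (hv i (x t))
            linarith
      _ = κ * T := by simp [mul_comm]
  rw [hCLN] at hT1
  simp only [hmean] at hT2
  simp only [Finset.sum_sub_distrib] at hT1 hT2 hKT happ ⊢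
  have hdef : ∀ t, expertLosses ℓ N L g x y t i = expertLoss ℓ (N i) (L i) (g i) x y t :=
    fun t => rfl
  simp only [hdef] at hKT
  have hκε : κ * (3 + 2 * C + 3) ≤ ε := by
    have := (lt_div_iff₀ (by positivity)).1 hi
    exact this.le
  have hfinal := mul_le_mul_of_nonneg_right hκε (Nat.cast_nonneg (α := ℝ) T)
  have hκT : 0 ≤ κ * T := by positivity
  linarith

end Universal

/-! ### The canonical run against noiseless responses -/

/-- Checked on boxes, where the product measure factors. It adjoins the instances to the past
randomness without losing independence from the current draw. -/
theorem indepFun_snd_prodMk_fst {α β γ δ : Type*} [MeasurableSpace α] [MeasurableSpace β]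
    [MeasurableSpace γ] [MeasurableSpace δ] {μ : Measure α} {ν : Measure β}
    [IsProbabilityMeasure μ] [IsProbabilityMeasure ν] {f : β → γ} {g : β → δ} (hf : Measurable f)
    (hg : Measurable g) (h : IndepFun f g ν) :
    IndepFun (fun w : α × β => f w.2) (fun w => (w.1, g w.2)) (μ.prod ν) := by
  have hf' : Measurable fun w : α × β => f w.2 := hf.comp measurable_snd
  have hg' : Measurable fun w : α × β => (w.1, g w.2) :=
    measurable_fst.prodMk (hg.comp measurable_snd)
  rw [indepFun_iff_map_prod_eq_prod_map_map hf'.aemeasurable hg'.aemeasurable]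
  have : IsProbabilityMeasure ((μ.prod ν).map fun w : α × β => f w.2) :=
    Measure.isProbabilityMeasure_map hf'.aemeasurable
  have : IsProbabilityMeasure ((μ.prod ν).map fun w : α × β => (w.1, g w.2)) :=
    Measure.isProbabilityMeasure_map hg'.aemeasurable
  have : IsProbabilityMeasure ((μ.prod ν).map fun w : α × β => (f w.2, (w.1, g w.2))) :=
    Measure.isProbabilityMeasure_map (hf'.prodMk hg').aemeasurable
  rw [Measure.ext_prod₃_iff]
  intro s t u hs ht hu
  rw [Measure.map_apply (hf'.prodMk hg') (hs.prod (ht.prod hu)), Measure.prod_prod,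
    Measure.map_apply hf' hs, Measure.map_apply hg' (ht.prod hu)]
  have e1 : (fun w : α × β => (f w.2, (w.1, g w.2))) ⁻¹' (s ×ˢ t ×ˢ u) =
      t ×ˢ (f ⁻¹' s ∩ g ⁻¹' u) := by
    ext w
    simp only [Set.mem_preimage, Set.mem_prod, Set.mem_inter_iff]
    tauto
  have e2 : (fun w : α × β => f w.2) ⁻¹' s = Set.univ ×ˢ (f ⁻¹' s) := by
    ext w
    simp
  have e3 : (fun w : α × β => (w.1, g w.2)) ⁻¹' (t ×ˢ u) = t ×ˢ (g ⁻¹' u) := by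
    ext w
    simp
  rw [e1, e2, e3, Measure.prod_prod, Measure.prod_prod, Measure.prod_prod, measure_univ, one_mul,
    h.measure_inter_preimage_eq_mul s u hs hu]
  ring

section NoiselessRun

variable {𝒳 𝒴 : Type u} [MeasurableSpace 𝒳] [MeasurableSpace 𝒴]

/-- The canonical run of a rule against noiseless responses. -/
theorem isRun_noiseless (f : OnlineRule 𝒳 𝒴) (μ : ProbabilityMeasure (ℕ → 𝒳)) {h : 𝒳 → 𝒴}
    (hh : Measurable h) :
    IsRun f (noiselessMechanism μ h hh) ((μ : Measure (ℕ → 𝒳)).prod (Measure.infinitePi f.law))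
      (fun w => w.1) (fun t w => w.2 t) (fun t w => h (w.1 t)) := by
  have hrand : ∀ t, Measurable fun w : (ℕ → 𝒳) × (ℕ → f.R) => w.2 t := fun t =>
    (measurable_pi_apply t).comp measurable_snd
  have hpast : ∀ t, Measurable fun r : ℕ → f.R => fun i : Fin t => r i := fun t =>
    measurable_pi_iff.2 fun i => measurable_pi_apply _
  have hresp : ∀ t, Measurable fun w : (ℕ → 𝒳) × (ℕ → f.R) => h (w.1 t) := fun t =>
    hh.comp ((measurable_pi_apply t).comp measurable_fst)
  refine ⟨measurable_fst, hrand, hresp, ?_, ?_, ?_, ?_⟩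
  · change Measure.map Prod.fst _ = (μ : Measure (ℕ → 𝒳))
    rw [Measure.map_fst_prod, measure_univ, one_smul]
  · intro t
    have : (fun w : (ℕ → 𝒳) × (ℕ → f.R) => w.2 t) = (fun r : ℕ → f.R => r t) ∘ Prod.snd := rfl
    rw [this, ← Measure.map_map (measurable_pi_apply t) measurable_snd, Measure.map_snd_prod,
      measure_univ, one_smul, Measure.infinitePi_map_eval]
  · intro t
    have hind : IndepFun (fun r : ℕ → f.R => r t) (fun r => fun i : Fin t => r i)
        (Measure.infinitePi f.law) := by
      have hi := iIndepFun_infinitePi (P := f.law) (X := fun _ r => r) fun _ => measurable_id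
      have hfin := hi.indepFun_finset {t} (Finset.range t) (by simp) fun i => measurable_pi_apply i
      exact hfin.comp (φ := fun z : ({t} : Finset ℕ) → f.R => z ⟨t, by simp⟩)
        (ψ := fun z : (Finset.range t) → f.R => fun i : Fin t => z ⟨i, by simp⟩)
        (measurable_pi_apply _) (measurable_pi_iff.2 fun i => measurable_pi_apply _)
    have h1 := indepFun_snd_prodMk_fst (μ := (μ : Measure (ℕ → 𝒳))) (measurable_pi_apply t)
      (hpast t) hind
    exact h1.comp (φ := id) (ψ := fun p : (ℕ → 𝒳) × (Fin t → f.R) =>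
      (p.1, p.2, fun i : Fin (t + 1) => h (p.1 i))) measurable_id
      (measurable_fst.prodMk (measurable_snd.prodMk (measurable_pi_iff.2 fun i =>
        hh.comp ((measurable_pi_apply _).comp measurable_fst))))
  · intro t
    have hb : Measurable fun w : (ℕ → 𝒳) × (ℕ → f.R) => (w.1, fun i : Fin t => w.2 i) :=
      measurable_fst.prodMk ((hpast t).comp measurable_snd)
    have hg : Measurable fun p : (ℕ → 𝒳) × (Fin t → f.R) => h (p.1 t) :=
      hh.comp ((measurable_pi_apply t).comp measurable_fst)
    have : IsProbabilityMeasure (((μ : Measure (ℕ → 𝒳)).prod (Measure.infinitePi f.law)).map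
        fun w : (ℕ → 𝒳) × (ℕ → f.R) => (w.1, fun i : Fin t => w.2 i)) :=
      Measure.isProbabilityMeasure_map hb.aemeasurable
    have key : ((μ : Measure (ℕ → 𝒳)).prod (Measure.infinitePi f.law)).map
        (fun w : (ℕ → 𝒳) × (ℕ → f.R) => ((w.1, fun i : Fin t => w.2 i), h (w.1 t))) =
        (((μ : Measure (ℕ → 𝒳)).prod (Measure.infinitePi f.law)).map
          fun w : (ℕ → 𝒳) × (ℕ → f.R) => (w.1, fun i : Fin t => w.2 i)) ⊗ₘ
          Kernel.deterministic _ hg := by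
      rw [Measure.compProd_deterministic hg, Measure.map_map (measurable_id'.prodMk hg) hb]
      rfl
    exact key

end NoiselessRun

/-! ### Fair coins and flips -/

section FairCoins

/-- The law of a fair coin. -/
noncomputable def fairCoin : Measure Bool :=
  (2 : ENNReal)⁻¹ • (Measure.dirac true + Measure.dirac false)

instance : IsProbabilityMeasure fairCoin := by
  refine ⟨?_⟩
  simp only [fairCoin, Measure.smul_apply, Measure.add_apply, measure_univ, smul_eq_mul]
  rw [one_add_one_eq_two]
  exact ENNReal.inv_mul_cancel two_ne_zero ENNReal.ofNat_ne_top

theorem map_not_fairCoin : fairCoin.map (fun b => !b) = fairCoin := by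
  have hm : Measurable fun b : Bool => !b := measurable_from_top
  rw [fairCoin, Measure.map_smul, Measure.map_add _ _ hm, Measure.map_dirac' hm,
    Measure.map_dirac' hm, add_comm]
  rfl

/-- Flip the `k`-th coin. -/
def flipCoin (k : ℕ) (b : ℕ → Bool) (i : ℕ) : Bool := if i = k then !b i else b i

theorem measurePreserving_flipCoin (k : ℕ) : MeasurePreserving (flipCoin k)
    (Measure.infinitePi fun _ : ℕ => fairCoin) (Measure.infinitePi fun _ : ℕ => fairCoin) := by
  have hf : ∀ i, Measurable fun c : Bool => if i = k then !c else c := fun i => measurable_from_top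
  refine ⟨measurable_pi_iff.2 fun i => (hf i).comp (measurable_pi_apply i), ?_⟩
  have h := Measure.infinitePi_map_pi (fun _ : ℕ => fairCoin) hf
  refine h.trans ?_
  congr 1
  funext i
  by_cases hi : i = k
  · simp only [hi, if_true]
    exact map_not_fairCoin
  · simp only [hi, if_false]
    exact Measure.map_id

/-- If each pair of values obtained by flipping the `k`-th coin sums to at least `c`, then the mean
is at least `c / 2`. -/
theorem half_le_integral_of_flip {φ : (ℕ → Bool) → ℝ} (hφ : Measurable φ) {C c : ℝ}
    (hC : ∀ b, |φ b| ≤ C) (k : ℕ) (hc : ∀ b, c ≤ φ b + φ (flipCoin k b)) :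
    c / 2 ≤ ∫ b, φ b ∂(Measure.infinitePi fun _ : ℕ => fairCoin) := by
  have hp := measurePreserving_flipCoin k
  have i1 : Integrable φ (Measure.infinitePi fun _ : ℕ => fairCoin) :=
    integrable_of_measurable_of_abs_le hφ hC
  have i2 : Integrable (fun b => φ (flipCoin k b)) (Measure.infinitePi fun _ : ℕ => fairCoin) :=
    integrable_of_measurable_of_abs_le (hφ.comp hp.measurable) fun b => hC _
  have h2 : ∫ b, φ (flipCoin k b) ∂(Measure.infinitePi fun _ : ℕ => fairCoin) =
      ∫ b, φ b ∂(Measure.infinitePi fun _ : ℕ => fairCoin) := by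
    conv_rhs => rw [← hp.map_eq]
    exact (integral_map hp.measurable.aemeasurable hφ.aestronglyMeasurable).symm
  have h3 := integral_mono (integrable_const c) (i1.add i2) hc
  have h4 : ∫ b, (φ + fun b => φ (flipCoin k b)) b ∂(Measure.infinitePi fun _ : ℕ => fairCoin) =
      ∫ b, φ b ∂(Measure.infinitePi fun _ : ℕ => fairCoin) +
      ∫ b, φ (flipCoin k b) ∂(Measure.infinitePi fun _ : ℕ => fairCoin) := integral_add i1 i2
  rw [h4, h2] at h3
  simp only [integral_const, probReal_univ, smul_eq_mul, one_mul] at h3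
  linarith

end FairCoins

-- Each value is charged to the time of its first appearance.
open Classical in
theorem card_image_le_card_first {ι : Type*} (x : ℕ → ι) (T : ℕ) :
    ((Finset.range T).image x).card ≤
      ((Finset.range T).filter (fun t => ∀ s < t, x s ≠ x t)).card := by
  refine le_trans (Finset.card_le_card ?_) (Finset.card_image_le (f := x))
  intro a ha
  obtain ⟨t, ht, hta⟩ := Finset.mem_image.1 ha
  have hex : ∃ s, x s = a := ⟨t, hta⟩
  refine Finset.mem_image.2 ⟨Nat.find hex, Finset.mem_filter.2 ⟨?_, ?_⟩, Nat.find_spec hex⟩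
  · exact Finset.mem_range.2 ((Nat.find_min' hex hta).trans_lt (Finset.mem_range.1 ht))
  · intro s hs
    rw [Nat.find_spec hex]
    exact Nat.find_min hex hs

/-! ### Necessity of `SMV` -/

section Necessity

variable {𝒳 𝒴 : Type u} [MeasurableSpace 𝒳] [MeasurableSpace 𝒴] {ℓ : 𝒴 → 𝒴 → ℝ} {C c : ℝ}

/-- A process that admits a universally consistent rule for noiseless responses is in `SMV`. -/
theorem mem_SMV_of_noiselessUniversallyConsistent (hℓ : Measurable fun p : 𝒴 × 𝒴 => ℓ p.1 p.2)
    (h0 : ∀ a b, 0 ≤ ℓ a b) (hC : ∀ a b, ℓ a b ≤ C) (hself : ∀ a, ℓ a a = 0) {y₀ y₁ : 𝒴}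
    (hc0 : 0 < c) (hc : ∀ z, c ≤ ℓ z y₀ + ℓ z y₁) {μ : ProbabilityMeasure (ℕ → 𝒳)}
    {f : OnlineRule 𝒳 𝒴} (hf : NoiselessUniversallyConsistent ℓ f μ) : μ ∈ SMV 𝒳 := by
  classical
  intro A hA hdisj hcov
  have hex : ∀ a : 𝒳, ∃ k, a ∈ A k := fun a =>
    Set.mem_iUnion.1 (hcov.symm ▸ Set.mem_univ a)
  choose Λ hΛ using hex
  have hΛA : ∀ k a, a ∈ A k ↔ Λ a = k := by
    intro k a
    constructor
    · intro h
      by_contra hne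
      exact Set.disjoint_left.1 (hdisj hne) (hΛ a) h
    · rintro rfl
      exact hΛ a
  have hΛm : Measurable Λ := measurable_to_countable' fun k => by
    convert hA k using 1
    ext a
    exact (hΛA k a).symm
  -- random labels of the cells
  set β : Measure (ℕ → Bool) := Measure.infinitePi fun _ : ℕ => fairCoin with hβ
  set val : Bool → 𝒴 := fun e => if e then y₁ else y₀ with hval
  set h : (ℕ → Bool) → 𝒳 → 𝒴 := fun b a => val (b (Λ a)) with hh
  have hhm : Measurable fun p : (ℕ → Bool) × 𝒳 => h p.1 p.2 := by
    have h1 : Measurable fun p : ℕ × (ℕ → Bool) => val (p.2 p.1) :=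
      measurable_from_prod_countable_right fun n =>
        (measurable_from_top (f := val)).comp (measurable_pi_apply n)
    exact h1.comp ((hΛm.comp measurable_snd).prodMk measurable_fst)
  have hhb : ∀ b, Measurable (h b) := fun b => hhm.comp measurable_prodMk_left
  set W := (ℕ → 𝒳) × (ℕ → f.R) with hW
  set Q : Measure W := (μ : Measure (ℕ → 𝒳)).prod (Measure.infinitePi f.law) with hQ
  set loss : ℕ → (ℕ → Bool) × W → ℝ := fun t p => ℓ (f.predict t (p.2.2 t)
    (fun i : Fin t => p.2.1 i) (fun i : Fin t => h p.1 (p.2.1 i)) (p.2.1 t))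
    (h p.1 (p.2.1 t)) with hloss
  have hlossm : ∀ t, Measurable (loss t) := by
    intro t
    have hx : ∀ s, Measurable fun p : (ℕ → Bool) × W => p.2.1 s := fun s =>
      (measurable_pi_apply s).comp (measurable_fst.comp measurable_snd)
    have hy : ∀ s, Measurable fun p : (ℕ → Bool) × W => h p.1 (p.2.1 s) := fun s =>
      hhm.comp (measurable_fst.prodMk (hx s))
    have hr : Measurable fun p : (ℕ → Bool) × W => p.2.2 t :=
      (measurable_pi_apply t).comp (measurable_snd.comp measurable_snd)
    have h1 : Measurable fun p : (ℕ → Bool) × W => (p.2.2 t, (fun i : Fin t => p.2.1 i),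
        (fun i : Fin t => h p.1 (p.2.1 i)), p.2.1 t) :=
      hr.prodMk ((measurable_pi_iff.2 fun i : Fin t => hx i).prodMk
        ((measurable_pi_iff.2 fun i : Fin t => hy i).prodMk (hx t)))
    exact hℓ.comp (((f.measurable_predict t).comp h1).prodMk (hy t))
  have hlossC : ∀ t p, |loss t p| ≤ C := fun t p => by
    rw [abs_of_nonneg (h0 _ _)]
    exact hC _ _
  set avg : ℕ → (ℕ → Bool) × W → ℝ := fun T p =>
    (1 / (T : ℝ)) * ∑ t ∈ Finset.range T, loss t p with havg
  have havgm : ∀ T, Measurable (avg T) := fun T =>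
    (Finset.measurable_sum _ fun t _ => hlossm t).const_mul _
  have havg0 : ∀ T p, 0 ≤ avg T p := fun T p =>
    mul_nonneg (by positivity) (Finset.sum_nonneg fun t _ => h0 _ _)
  have hC0 : 0 ≤ C := (h0 y₀ y₀).trans (hC y₀ y₀)
  have havgC : ∀ T p, avg T p ≤ C := fun T p => by
    rcases Nat.eq_zero_or_pos T with rfl | hT
    · simpa [havg] using hC0
    · rw [havg]
      dsimp only
      rw [one_div, inv_mul_le_iff₀ (Nat.cast_pos.2 hT)]
      exact (le_abs_self _).trans (abs_sum_range_le (fun t => hlossC t p) T)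
  -- The comparator is the target `h b` itself, whose loss is zero.
  have hlim : ∀ b, ∀ᵐ w ∂Q, limsup (fun T => ((avg T (b, w) : ℝ) : EReal)) atTop ≤ 0 := by
    intro b
    have hcons := hf (h b) (hhb b) W Q (fun w => w.1) (fun t w => w.2 t)
      (fun t w => h b (w.1 t)) (isRun_noiseless f μ (hhb b)) (h b) (hhb b)
    filter_upwards [hcons] with w hw
    unfold excessLoss at hw
    simpa only [hself, sub_zero] using hw
  have hset : MeasurableSet {p : (ℕ → Bool) × W |
      limsup (fun T => ((avg T (p.1, p.2) : ℝ) : EReal)) atTop ≤ 0} :=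
    measurableSet_le (Measurable.limsup fun T => (havgm T).coe_real_ereal) measurable_const
  -- Fubini fixes instances and private randomness first, so that the coins can be averaged along a
  -- single trajectory.
  have hswap : ∀ᵐ w ∂Q, ∀ᵐ b ∂β, limsup (fun T => ((avg T (b, w) : ℝ) : EReal)) atTop ≤ 0 :=
    (Measure.ae_ae_comm (μ := β) (ν := Q) hset).1 (Eventually.of_forall hlim)
  have hconcl : ∀ᵐ w ∂Q, (fun T : ℕ => (({k : ℕ | ∃ t < T, w.1 t ∈ A k}.ncard : ℕ) : ℝ))
      =o[atTop] (fun T : ℕ => (T : ℝ)) := by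
    filter_upwards [hswap] with w hw
    have htend : Tendsto (fun T => ∫ b, avg T (b, w) ∂β) atTop (nhds 0) := by
      have h1 := tendsto_integral_of_dominated_convergence (μ := β)
        (F := fun T b => avg T (b, w)) (f := fun _ => (0 : ℝ)) (fun _ => C)
        (fun T => ((havgm T).comp measurable_prodMk_right).aestronglyMeasurable)
        (integrable_const C)
        (fun T => Eventually.of_forall fun b => by
          rw [Real.norm_eq_abs, abs_of_nonneg (havg0 _ _)]
          exact havgC _ _)
        (by
          filter_upwards [hw] with b hb
          refine tendsto_order.2 ⟨fun a ha => Eventually.of_forall fun T =>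
            ha.trans_le (havg0 T _), fun a ha => ?_⟩
          have hlt : limsup (fun T => ((avg T (b, w) : ℝ) : EReal)) atTop < (a : EReal) :=
            hb.trans_lt (by exact_mod_cast ha)
          filter_upwards [eventually_lt_of_limsup_lt hlt (by isBoundedDefault)] with T hT
          exact EReal.coe_lt_coe_iff.1 hT)
      simpa using h1
    have hlow : ∀ T : ℕ, c / 2 * (({k : ℕ | ∃ t < T, w.1 t ∈ A k}.ncard : ℕ) : ℝ) ≤
        T * ∫ b, avg T (b, w) ∂β := by
      intro T
      rcases Nat.eq_zero_or_pos T with rfl | hT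
      · simp
      have hcard : {k : ℕ | ∃ t < T, w.1 t ∈ A k}.ncard ≤
          ((Finset.range T).filter (fun t => ∀ s < t, Λ (w.1 s) ≠ Λ (w.1 t))).card := by
        have he : {k : ℕ | ∃ t < T, w.1 t ∈ A k} =
            ((Finset.range T).image (fun t => Λ (w.1 t)) : Set ℕ) := by
          ext k
          simp [hΛA]
        rw [he, Set.ncard_coe_finset]
        exact le_trans (le_of_eq (by congr!)) ((card_image_le_card_first (fun t => Λ (w.1 t)) T).trans
          (le_of_eq (by congr!)))
      have hi : ∀ t, Integrable (fun b => loss t (b, w)) β := fun t =>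
        integrable_of_measurable_of_abs_le ((hlossm t).comp measurable_prodMk_right)
          fun b => hlossC t _
      have hint : T * ∫ b, avg T (b, w) ∂β = ∑ t ∈ Finset.range T, ∫ b, loss t (b, w) ∂β := by
        have hT' : (T : ℝ) ≠ 0 := Nat.cast_ne_zero.2 hT.ne'
        simp only [havg]
        rw [integral_const_mul, integral_finsetSum _ fun t _ => hi t]
        field_simp
      -- At a first visit the past responses do not involve the coin of the current cell. Flipping
      -- it keeps the prediction and swaps the target, and the two losses sum to at least `c`.
      have hfirst : ∀ t ∈ (Finset.range T).filter (fun t => ∀ s < t, Λ (w.1 s) ≠ Λ (w.1 t)),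
          c / 2 ≤ ∫ b, loss t (b, w) ∂β := by
        intro t ht
        have hne := (Finset.mem_filter.1 ht).2
        refine half_le_integral_of_flip ((hlossm t).comp measurable_prodMk_right)
          (fun b => hlossC t _) (Λ (w.1 t)) fun b => ?_
        have hpast : (fun i : Fin t => h (flipCoin (Λ (w.1 t)) b) (w.1 i)) =
            fun i : Fin t => h b (w.1 i) := by
          funext i
          simp only [hh, flipCoin, if_neg (hne i i.2)]
        have hcur : h (flipCoin (Λ (w.1 t)) b) (w.1 t) = val (!b (Λ (w.1 t))) := by
          simp [hh, flipCoin]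
        have hflip : loss t (flipCoin (Λ (w.1 t)) b, w) =
            ℓ (f.predict t (w.2 t) (fun i : Fin t => w.1 i) (fun i : Fin t => h b (w.1 i)) (w.1 t))
              (val (!b (Λ (w.1 t)))) := by
          change ℓ (f.predict t (w.2 t) (fun i : Fin t => w.1 i)
            (fun i : Fin t => h (flipCoin (Λ (w.1 t)) b) (w.1 i)) (w.1 t))
              (h (flipCoin (Λ (w.1 t)) b) (w.1 t)) = _
          rw [hpast, hcur]
        have hval' : ∀ z e, c ≤ ℓ z (val e) + ℓ z (val !e) := by
          rintro z (_ | _)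
          · exact hc z
          · rw [add_comm]
            exact hc z
        rw [Function.comp_apply, Function.comp_apply, hflip]
        exact hval' _ (b (Λ (w.1 t)))
      calc c / 2 * (({k : ℕ | ∃ t < T, w.1 t ∈ A k}.ncard : ℕ) : ℝ) ≤
            c / 2 * (((Finset.range T).filter
              (fun t => ∀ s < t, Λ (w.1 s) ≠ Λ (w.1 t))).card : ℝ) :=
            mul_le_mul_of_nonneg_left (Nat.cast_le.2 hcard) (by positivity)
        _ = ∑ t ∈ (Finset.range T).filter (fun t => ∀ s < t, Λ (w.1 s) ≠ Λ (w.1 t)), c / 2 := by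
            simp [mul_comm]
        _ ≤ ∑ t ∈ (Finset.range T).filter (fun t => ∀ s < t, Λ (w.1 s) ≠ Λ (w.1 t)),
            ∫ b, loss t (b, w) ∂β := Finset.sum_le_sum hfirst
        _ ≤ ∑ t ∈ Finset.range T, ∫ b, loss t (b, w) ∂β :=
            Finset.sum_le_sum_of_subset_of_nonneg (Finset.filter_subset _ _)
              fun t _ _ => integral_nonneg fun b => h0 _ _
        _ = _ := hint.symm
    rw [Asymptotics.isLittleO_iff]
    intro ε hε
    filter_upwards [(tendsto_order.1 htend).2 (c / 2 * ε) (by positivity)] with T hT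
    rw [Real.norm_natCast, Real.norm_natCast]
    have h1 := (hlow T).trans (mul_le_mul_of_nonneg_left hT.le (Nat.cast_nonneg T))
    refine le_of_mul_le_mul_left ?_ (half_pos hc0)
    linarith
  filter_upwards [Measure.ae_ae_of_ae_prod hconcl] with x hx
  exact hx.exists.choose_spec

end Necessity

/-! ### Properties of the power loss, and the conclusion -/

section PowLoss

variable {𝒴 : Type u} [MetricSpace 𝒴] {α C : ℝ}

theorem powLoss_nonneg (a b : 𝒴) : 0 ≤ powLoss α a b := Real.rpow_nonneg dist_nonneg _

theorem powLoss_self (hα : 0 < α) (a : 𝒴) : powLoss α a a = 0 := by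
  rw [powLoss, dist_self, Real.zero_rpow hα.ne']

theorem continuous_powLoss (hα : 0 < α) : Continuous fun p : 𝒴 × 𝒴 => powLoss α p.1 p.2 :=
  (Real.continuous_rpow_const hα.le).comp continuous_dist

/-- A bounded power loss is uniformly continuous in its first argument, uniformly in the second. -/
theorem exists_forall_powLoss_le_add (hα : 0 < α) (hC : ∀ a b : 𝒴, powLoss α a b ≤ C) {δ : ℝ}
    (hδ : 0 < δ) :
    ∃ ρ, 0 < ρ ∧ ∀ a b y : 𝒴, dist a b < ρ → powLoss α a y ≤ powLoss α b y + δ := by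
  -- A bounded loss confines distances to a compact interval, on which the power is uniformly
  -- continuous.
  have hD : ∀ a b : 𝒴, dist a b ∈ Set.Icc 0 (C ^ α⁻¹) := fun a b =>
    ⟨dist_nonneg, by
      rw [← Real.rpow_rpow_inv (dist_nonneg (x := a) (y := b)) hα.ne']
      exact Real.rpow_le_rpow (powLoss_nonneg a b) (hC a b) (inv_nonneg.2 hα.le)⟩
  have huc := isCompact_Icc.uniformContinuousOn_of_continuous (s := Set.Icc 0 (C ^ α⁻¹))
    (Real.continuous_rpow_const hα.le).continuousOn
  obtain ⟨ρ, hρ, h⟩ := Metric.uniformContinuousOn_iff.1 huc δ hδ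
  refine ⟨ρ, hρ, fun a b y hab => ?_⟩
  have hd : dist (dist a y) (dist b y) < ρ := (dist_dist_dist_le_left a b y).trans_lt hab
  have h1 := (abs_lt.1 (h _ (hD a y) _ (hD b y) hd)).2
  unfold powLoss
  linarith

/-- No value is close to both of two distinct values. -/
theorem half_dist_rpow_le_powLoss_add (hα : 0 ≤ α) (y₀ y₁ z : 𝒴) :
    (dist y₀ y₁ / 2) ^ α ≤ powLoss α z y₀ + powLoss α z y₁ := by
  have htri : dist y₀ y₁ ≤ dist z y₀ + dist z y₁ := dist_triangle_left y₀ y₁ z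
  rcases le_total (dist z y₀) (dist z y₁) with h | h
  · exact le_add_of_nonneg_of_le (powLoss_nonneg _ _)
      (Real.rpow_le_rpow (by positivity) (by linarith) hα)
  · exact le_add_of_le_of_nonneg (Real.rpow_le_rpow (by positivity) (by linarith) hα)
      (powLoss_nonneg _ _)

end PowLoss

/-- Values of a bounded loss are empirically integrable. -/
theorem empiricallyIntegrable_of_le {𝒴 : Type u} [Nonempty 𝒴] {ℓ : 𝒴 → 𝒴 → ℝ} {C : ℝ}
    (hC : ∀ a b, ℓ a b ≤ C) {Ω' : Type u} [MeasurableSpace Ω'] (Q : Measure Ω')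
    (Y : ℕ → Ω' → 𝒴) : EmpiricallyIntegrable ℓ Q Y := by
  refine ⟨Classical.arbitrary 𝒴, fun ε hε => Eventually.of_forall fun w =>
    ⟨max C 0 + 1, by positivity, ?_⟩⟩
  have h : ∀ t, ¬ max C 0 + 1 ≤ ℓ (Classical.arbitrary 𝒴) (Y t w) := fun t ht => by
    have := (hC (Classical.arbitrary 𝒴) (Y t w)).trans (le_max_left C 0)
    linarith
  simp only [h, if_false, Finset.sum_const_zero, mul_zero, EReal.coe_zero, limsup_const]
  exact_mod_cast hε.le

/-- Noiseless responses are adversarial responses. -/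
theorem UniversallyConsistent.noiseless {𝒳 𝒴 : Type u} [MeasurableSpace 𝒳] [MeasurableSpace 𝒴]
    [Nonempty 𝒴] {ℓ : 𝒴 → 𝒴 → ℝ} {C : ℝ} (hC : ∀ a b, ℓ a b ≤ C) {f : OnlineRule 𝒳 𝒴}
    {μ : ProbabilityMeasure (ℕ → 𝒳)} (hf : UniversallyConsistent ℓ f μ) :
    NoiselessUniversallyConsistent ℓ f μ := fun h hh Ω' _ Q x r Y hrun =>
  hf (noiselessMechanism μ h hh) Measure.map_id Ω' Q x r Y hrun (empiricallyIntegrable_of_le hC Q Y)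

theorem mainTheorem5 {𝒳 𝒴 : Type u}
    [MetricSpace 𝒳] [TopologicalSpace.SeparableSpace 𝒳] [MeasurableSpace 𝒳] [BorelSpace 𝒳]
    [MetricSpace 𝒴] [TopologicalSpace.SeparableSpace 𝒴] [MeasurableSpace 𝒴] [BorelSpace 𝒴]
    [Nontrivial 𝒴] (α : ℝ) (hα : 1 ≤ α)
    (hbdd : ∃ C : ℝ, ∀ y y' : 𝒴, powLoss α y y' ≤ C)
    (hF : FTiME (powLoss α : 𝒴 → 𝒴 → ℝ)) :
    SOLAR (𝒳 := 𝒳) (powLoss α : 𝒴 → 𝒴 → ℝ) = SMV 𝒳 ∧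
    SOUL (𝒳 := 𝒳) (powLoss α : 𝒴 → 𝒴 → ℝ) = SMV 𝒳 ∧
    ∃ f : OnlineRule 𝒳 𝒴,
      OptimisticallyUniversal (powLoss α) f ∧
      ∀ μ ∈ SMV 𝒳, UniversallyConsistent (powLoss α) f μ := by
  obtain ⟨C, hC⟩ := hbdd
  have hα0 : 0 < α := zero_lt_one.trans_le hα
  have : SecondCountableTopology 𝒳 := UniformSpace.secondCountable_of_separable 𝒳
  have : SecondCountableTopology 𝒴 := UniformSpace.secondCountable_of_separable 𝒴
  have hℓ : Measurable fun p : 𝒴 × 𝒴 => powLoss α p.1 p.2 := (continuous_powLoss hα0).measurable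
  obtain ⟨y₀, y₁, hne⟩ := exists_pair_ne 𝒴
  obtain ⟨f, hf⟩ := exists_universallyConsistent_of_FTiME (𝒳 := 𝒳) hF hℓ powLoss_nonneg hC
    fun δ hδ => exists_forall_powLoss_le_add hα0 hC hδ
  -- Boundedness makes noiseless responses a case of the adversarial ones, so the inclusions `SOLAR
  -- ⊆ SOUL ⊆ SMV ⊆ SOLAR` close up.
  have hsub : SOUL (𝒳 := 𝒳) (powLoss α : 𝒴 → 𝒴 → ℝ) ⊆ SMV 𝒳 := fun μ ⟨f', hf'⟩ =>
    mem_SMV_of_noiselessUniversallyConsistent hℓ powLoss_nonneg hC (powLoss_self hα0)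
      (Real.rpow_pos_of_pos (half_pos (dist_pos.2 hne)) α)
      (half_dist_rpow_le_powLoss_add hα0.le y₀ y₁) hf'
  have hsolar : SOLAR (𝒳 := 𝒳) (powLoss α : 𝒴 → 𝒴 → ℝ) = SMV 𝒳 :=
    Set.Subset.antisymm (fun μ ⟨f', hf'⟩ => hsub ⟨f', hf'.noiseless hC⟩) fun μ hμ => ⟨f, hf μ hμ⟩
  exact ⟨hsolar, Set.Subset.antisymm hsub fun μ hμ => ⟨f, (hf μ hμ).noiseless hC⟩, f,
    fun μ hμ => hf μ (hsolar ▸ hμ), hf⟩
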